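/- Let $d\ge 1$, let $p=(p_x)_{x\in\mathbb Z^d}$ be a probability kernel on $\mathbb Z^d$ that is irreducible and such that the random walk on $\mathbb Z^d$ with the symmetrised jump kernel $\widehat p_x=(p_x+p_{-x})/2$ is recurrent. Let $b:\mathbb N_0\to[0,\infty)$ be a branching rate function with $b(1)>0$; empty sites do not branch, so $b(0)$ plays no role (conventionally $b(0)=0$). Let $(\eta(t))_{t\ge0}$, $\eta(t)=(\eta_x(t))_{x\in\mathbb Z^d}\in\mathbb N_0^{\mathbb Z^d}$, be the system of self-catalytic critical binary branching random walks $\mathrm{SCBRW}_b$ with (possibly random) initial configuration $\eta(0)$, i.e. the particle system with formal generator $$Lf(\eta)=\sum_{x,y}\eta_x\,p_{y-x}\big(f(\eta+\delta_y-\delta_x)-f(\eta)\big)+\sum_{x:\,\eta_x\ge1} b(\eta_x)\,\tfrac12\big(f(\eta+\delta_x)+f(\eta-\delta_x)-2f(\eta)\big).$$ Here, from a finite configuration the system is the continuous-time Markov chain with these jump rates, and from a general initial configuration its finite-dimensional distributions are the limits, as the finite set $\Lambda$ increases to $\mathbb Z^d$, of those of the systems started from the particles of $\eta(0)$ in $\Lambda$.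 Suppose that $$\sup_{x\in\mathbb Z^d}\mathbb E[\eta_x(0)]<\infty .$$ Then $\eta$ dies out locally in probability: $$\lim_{t\to\infty}\mathbb P(\eta_x(t)=0)=1\qquad\text{for every }x\in\mathbb Z^d .$$ -/

import Mathlib

open MeasureTheory Filter Topology
open scoped NNReal ENNReal

namespace SCBRW

noncomputable section

/-- The lattice `ℤ^d`. -/
abbrev Site (d : ℕ) : Type := Fin d → ℤ

/-- Particle configurations `η = (η_x)` on `ℤ^d`: `η x` is the number of particles at `x`. -/
abbrev Config (d : ℕ) : Type := Site d → ℕ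

/-- Configurations with finitely many particles (a countable set). -/
abbrev FinConfig (d : ℕ) : Type := Site d →₀ ℕ

/-! ### Random walks on the lattice -/

/-- `stepProb k n x` is the probability that the discrete time random walk with jump kernel `k`
started at the origin is at `x` after `n` steps. -/
def stepProb {d : ℕ} (k : Site d → ℝ≥0∞) : ℕ → Site d → ℝ≥0∞
  | 0, x => if x = 0 then 1 else 0
  | n + 1, x => ∑' y, stepProb k n y * k (x - y)

/-- The kernel `k` is irreducible: every site can be reached from every other one. -/
def IsIrreducible {d : ℕ} (k : Site d → ℝ≥0∞) : Prop :=
  ∀ x y : Site d, ∃ n : ℕ, 0 < stepProb k n (y - x)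

/-- `tabooProb k n x` is the probability that the walk with kernel `k` started at the origin avoids
the origin at the times `1, …, n` and is at `x` at time `n + 1`. -/
def tabooProb {d : ℕ} (k : Site d → ℝ≥0∞) : ℕ → Site d → ℝ≥0∞
  | 0, x => k x
  | n + 1, x => ∑' y, if y = 0 then 0 else tabooProb k n y * k (x - y)

/-- The walk with kernel `k` is recurrent: it returns to its starting point with probability one
(the `n`-th summand is the probability that the first return happens at time `n + 1`). -/
def IsRecurrent {d : ℕ} (k : Site d → ℝ≥0∞) : Prop :=
  ∑' n, tabooProb k n 0 = 1

/-- The symmetrised jump kernel `(p_x + p_{-x}) / 2`. -/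
def symmetrised {d : ℕ} (p : PMF (Site d)) : Site d → ℝ≥0∞ :=
  fun x => (p x + p (-x)) / 2

/-! ### The system with finitely many particles

A continuous time Markov chain on the countable set of finite configurations, with formal generator
`L f (ξ) = ∑_{x,y} ξ_x p_{y-x} (f (ξ + δ_y - δ_x) - f ξ)
  + ∑_x b(ξ_x) ½ (f (ξ + δ_x) + f (ξ - δ_x) - 2 f ξ)`. -/

/-- `ξ + δ_y - δ_x`: a particle moves from `x` to `y` (used only when `ξ x ≥ 1`). -/
def move {d : ℕ} (ξ : FinConfig d) (x y : Site d) : FinConfig d :=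
  ξ + Finsupp.single y 1 - Finsupp.single x 1

/-- `ξ + δ_x`: a particle is added at `x`. -/
def addAt {d : ℕ} (ξ : FinConfig d) (x : Site d) : FinConfig d :=
  ξ + Finsupp.single x 1

/-- `ξ - δ_x`: a particle is removed at `x` (used only when `ξ x ≥ 1`). -/
def removeAt {d : ℕ} (ξ : FinConfig d) (x : Site d) : FinConfig d :=
  ξ - Finsupp.single x 1

/-- The rate at which the system jumps from `ξ` to a configuration `ζ ≠ ξ`: each particle
jumps from its site `x` to `y` at rate `p (y - x)`, and at each occupied site `x` a particle
is added, or removed, at rate `b (ξ x) / 2` each. The sums are over the occupied sites. -/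
def rate {d : ℕ} (p : PMF (Site d)) (b : ℕ → ℝ≥0) (ξ ζ : FinConfig d) : ℝ≥0∞ :=
  if ζ = ξ then 0 else
    (∑ x ∈ ξ.support, (ξ x : ℝ≥0∞) * ∑' y, if move ξ x y = ζ then p (y - x) else 0) +
    ∑ x ∈ ξ.support, ((b (ξ x) : ℝ≥0∞) / 2) *
      ((if addAt ξ x = ζ then 1 else 0) + (if removeAt ξ x = ζ then 1 else 0))

/-- The total rate at which the system leaves `ξ` (always finite). -/
def exitRate {d : ℕ} (p : PMF (Site d)) (b : ℕ → ℝ≥0) (ξ : FinConfig d) : ℝ≥0∞ :=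
  ∑' ζ, rate p b ξ ζ

/-- `transAux p b n t ξ ζ` is the probability that the Markov chain with jump rates `rate p b`
started in `ξ` has made fewer than `n` jumps by time `t` and is in `ζ` at time `t`
(decomposition at the first jump). -/
def transAux {d : ℕ} (p : PMF (Site d)) (b : ℕ → ℝ≥0) :
    ℕ → ℝ → FinConfig d → FinConfig d → ℝ≥0∞
  | 0, _, _, _ => 0
  | n + 1, t, ξ, ζ =>
    (if ξ = ζ then ENNReal.ofReal (Real.exp (-((exitRate p b ξ).toReal * t))) else 0) +
    ∫⁻ s in Set.Icc 0 t, ENNReal.ofReal (Real.exp (-((exitRate p b ξ).toReal * s))) *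
      ∑' χ, rate p b ξ χ * transAux p b n (t - s) χ ζ

/-- The transition probabilities of the Markov chain with jump rates `rate p b` (the minimal
nonnegative solution of the Kolmogorov equations). -/
def trans {d : ℕ} (p : PMF (Site d)) (b : ℕ → ℝ≥0) (t : ℝ≥0) (ξ ζ : FinConfig d) : ℝ≥0∞ :=
  ⨆ n, transAux p b n t ξ ζ

/-- An observation: wait for a time `wait`, then require that the numbers of particles at
the finitely many sites `x ∈ sites` are equal to `count x`. -/
structure Observation (d : ℕ) where
  wait : ℝ≥0
  sites : Finset (Site d)
  count : Site d → ℕ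

/-- Finite dimensional distributions of the chain: the probability that the chain started in `ξ`
satisfies all requirements of a list of successive observations. -/
def finDimProb {d : ℕ} (p : PMF (Site d)) (b : ℕ → ℝ≥0) :
    List (Observation d) → FinConfig d → ℝ≥0∞
  | [], _ => 1
  | o :: l, ξ => ∑' ζ : FinConfig d,
      open Classical in
      if ∀ x ∈ o.sites, ζ x = o.count x then trans p b o.wait ξ ζ * finDimProb p b l ζ else 0

/-! ### The system with possibly infinitely many particles -/

/-- The finite configuration that consists of the particles of `η` in `Λ`. -/
def restrict {d : ℕ} (Λ : Finset (Site d)) (η : Config d) : FinConfig d :=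
  Finsupp.indicator Λ (fun x _ => η x)

/-- The event that the process `η`, observed from time `t` on, satisfies all requirements of a list
of successive observations. -/
def cylinderEvent {d : ℕ} {Ω : Type*} (η : ℝ≥0 → Ω → Config d) :
    List (Observation d) → ℝ≥0 → Set Ω
  | [], _ => Set.univ
  | o :: l, t => {ω | ∀ x ∈ o.sites, η (t + o.wait) ω x = o.count x} ∩
      cylinderEvent η l (t + o.wait)

/-- `η = (η(t))_{t ≥ 0}`, a process with values in the locally finite configurations, is a system of
self-catalytic critical binary branching random walks with jump kernel `p` and branching rate
function `b`, started in the (random) configuration `η(0)`: its finite dimensional distributions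
are the limits, as `Λ ↑ ℤ^d`, of those of the systems started from the finitely many particles
of `η(0)` in `Λ`. (Waiting times may vanish, so that the joint law with `η(0)` is included.) -/
structure IsSCBRW {d : ℕ} (p : PMF (Site d)) (b : ℕ → ℝ≥0) {Ω : Type*} [MeasurableSpace Ω]
    (P : Measure Ω) (η : ℝ≥0 → Ω → Config d) : Prop where
  measurable : ∀ t, Measurable (η t)
  tendsto_finDimProb : ∀ l : List (Observation d),
    Tendsto (fun Λ : Finset (Site d) => ∫⁻ ω, finDimProb p b l (restrict Λ (η 0 ω)) ∂P)
      atTop (𝓝 (P (cylinderEvent η l 0)))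

end

end SCBRW

/-! Call a function of the configuration concave (`Conc`) if it increases when a particle is added
and its increments decrease. Independent motion preserves this class, and so does critical branching
of particles that are alone at their site. By Jensen's inequality any critical branching lowers the
mean of a concave function. Hence branching may be discarded: the mean of a bounded concave function
under the self-catalytic system is at most its mean under the `lonely` system, where only a particle
alone at a site of a finite region branches, at rate b(1) (`trans_act_le`). The occupation
probability is the mean of the concave function min(n,1), so it suffices to treat the lonely system.
Only upper bounds are needed, so explosion plays no role.

Fix an intensity bound M. Let ℓ_K be the infimum over times and regions of the largest mean of
min(n,K) at a site, over Poisson initial states of intensity at most M (`limOcc`). These largest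
means decrease in time and in the region, so ℓ_K is a limit. Since 1{n=1} = 2 min(n,1) - min(n,2),
the difference 2ℓ₁ - ℓ₂ measures single particles.

Single particles become rare (`two_mul_limOcc_one_le`). Keep each particle at a site o at the final
time with small probability θ, and consider the probability that some particle is kept. If a lone
particle at x branches a time v before the end, this probability drops by about θ² p_v(x,o)²/2. The
total drop is at most θM, whereas ∫ Σ_x p_v(x,o)² dv is the Green function of the symmetrised walk
up to a factor, hence infinite by recurrence. So 2ℓ₁ ≤ ℓ₂.

Occupied sites become rare (`limOcc_one_le`, `limOcc_one_eq_zero`). An occupied site without too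
many particles around is, after a fixed time h of motion, occupied by exactly one particle with a
probability bounded below. As single particles are rare, ℓ₁ = 0.

Other initial states are reduced to Poisson ones (`eventually_exists_lonely_le`). After a long time
each particle hits a given finite set B with small probability, by irreducibility, and is dominated
there by a Poisson configuration (`Conc.bernoulli_le_poi`). The random intensity on B has bounded
mean and is nearly constant on B, since the walk forgets its starting point, so by a Markov type
bound it exceeds a large M only rarely. This gives an occupation bound ε plus a linear function of
the initial state of total weight at most 2ε, which is integrated against η(0). -/

namespace SCBRW

/-! ### Nonnegative kernels -/

/-- Kernels on `X` with values in `[0, ∞]`. -/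
def Ker (X : Type*) : Type _ := X → X → ℝ≥0∞

namespace Ker

variable {X Y : Type*}

noncomputable section

open Classical in
instance : One (Ker X) := ⟨fun x y => if x = y then 1 else 0⟩

instance : Mul (Ker X) := ⟨fun a b x z => ∑' y, a x y * b y z⟩

@[ext] theorem ext' {a b : Ker X} (h : ∀ x y, a x y = b x y) : a = b :=
  funext fun x => funext fun y => h x y

theorem mul_apply (a b : Ker X) (x z : X) : (a * b) x z = ∑' y, a x y * b y z := rfl

open Classical in
theorem one_apply (x y : X) : (1 : Ker X) x y = if x = y then 1 else 0 := rfl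

theorem one_apply_self (x : X) : (1 : Ker X) x x = 1 := by simp [one_apply]

theorem one_apply_of_ne {x y : X} (h : x ≠ y) : (1 : Ker X) x y = 0 := by simp [one_apply, h]

/-- Sums in `ℝ≥0∞` always converge and may be interchanged, so arbitrary infinite matrices form a
semiring. This gives access to powers, `Commute` and the binomial theorem without summability
conditions. -/
instance : Semiring (Ker X) :=
  { (inferInstanceAs (AddCommMonoid (X → X → ℝ≥0∞)) : AddCommMonoid (Ker X)) with
    left_distrib := fun a b c => by
      ext x z
      exact (tsum_congr fun y => mul_add _ _ _).trans ENNReal.tsum_add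
    right_distrib := fun a b c => by
      ext x z
      exact (tsum_congr fun y => add_mul _ _ _).trans ENNReal.tsum_add
    zero_mul := fun a => by
      ext x z
      exact (tsum_congr fun y => zero_mul _).trans tsum_zero
    mul_zero := fun a => by
      ext x z
      exact (tsum_congr fun y => mul_zero _).trans tsum_zero
    mul_assoc := fun a b c => by
      ext x z
      simp only [mul_apply, ← ENNReal.tsum_mul_left, ← ENNReal.tsum_mul_right]
      rw [ENNReal.tsum_comm]
      simp only [mul_assoc]
    one_mul := fun a => by
      ext x z
      rw [mul_apply, tsum_eq_single x, one_apply_self, one_mul]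
      intro y hy
      rw [one_apply_of_ne hy.symm, zero_mul]
    mul_one := fun a => by
      ext x z
      rw [mul_apply, tsum_eq_single z, one_apply_self, mul_one]
      intro y hy
      rw [one_apply_of_ne hy, mul_zero] }

instance : Module ℝ≥0∞ (Ker X) := inferInstanceAs (Module ℝ≥0∞ (X → X → ℝ≥0∞))

theorem add_apply (a b : Ker X) (x z : X) : (a + b) x z = a x z + b x z := rfl

theorem zero_apply (x z : X) : (0 : Ker X) x z = 0 := rfl

theorem smul_apply (c : ℝ≥0∞) (b : Ker X) (x z : X) : (c • b) x z = c * b x z := rfl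

instance : IsScalarTower ℝ≥0∞ (Ker X) (Ker X) where
  smul_assoc c a b := by
    ext x z
    simp only [smul_eq_mul, mul_apply, smul_apply, ← ENNReal.tsum_mul_left, mul_assoc]

instance : SMulCommClass ℝ≥0∞ (Ker X) (Ker X) where
  smul_comm c a b := by
    ext x z
    simp only [smul_eq_mul, mul_apply, smul_apply, ← ENNReal.tsum_mul_left]
    exact tsum_congr fun y => by ring

/-- The action of a kernel on functions. -/
def act (k : Ker X) (g : X → ℝ≥0∞) (x : X) : ℝ≥0∞ := ∑' y, k x y * g y

theorem act_mul (a b : Ker X) (g : X → ℝ≥0∞) : act (a * b) g = act a (act b g) := by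
  funext x
  simp only [act, mul_apply, ← ENNReal.tsum_mul_left, ← ENNReal.tsum_mul_right]
  rw [ENNReal.tsum_comm]
  simp only [mul_assoc]

theorem act_one (g : X → ℝ≥0∞) : act 1 g = g := by
  funext x
  rw [act, tsum_eq_single x, one_apply_self, one_mul]
  intro y hy
  rw [one_apply_of_ne hy.symm, zero_mul]

theorem act_add_left (a b : Ker X) (g : X → ℝ≥0∞) : act (a + b) g = act a g + act b g := by
  funext x
  simp only [act, add_apply, add_mul, ENNReal.tsum_add, Pi.add_apply]

theorem act_smul_left (c : ℝ≥0∞) (b : Ker X) (g : X → ℝ≥0∞) (x : X) :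
    act (c • b) g x = c * act b g x := by
  simp only [act, smul_apply, mul_assoc, ENNReal.tsum_mul_left]

theorem act_zero_left (g : X → ℝ≥0∞) : act 0 g = 0 := by
  funext x
  simp [act, zero_apply]

theorem act_add_apply (a : Ker X) (f g : X → ℝ≥0∞) (x : X) :
    act a (fun y => f y + g y) x = act a f x + act a g x := by
  simp only [act, mul_add, ENNReal.tsum_add]

theorem act_const_mul (a : Ker X) (c : ℝ≥0∞) (g : X → ℝ≥0∞) (x : X) :
    act a (fun y => c * g y) x = c * act a g x := by
  simp only [act, ← ENNReal.tsum_mul_left]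
  exact tsum_congr fun y => by ring

theorem act_mul_const (a : Ker X) (c : ℝ≥0∞) (g : X → ℝ≥0∞) (x : X) :
    act a (fun y => g y * c) x = act a g x * c := by
  simp only [act, ← ENNReal.tsum_mul_right, mul_assoc]

theorem act_mono (a : Ker X) {f g : X → ℝ≥0∞} (h : ∀ x, f x ≤ g x) (x : X) :
    act a f x ≤ act a g x :=
  ENNReal.tsum_le_tsum fun y => mul_le_mul_right (h y) _

theorem act_tsum {ι : Type*} (a : Ker X) (f : ι → X → ℝ≥0∞) (x : X) :
    act a (fun y => ∑' i, f i y) x = ∑' i, act a (f i) x := by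
  simp only [act, ← ENNReal.tsum_mul_left]
  rw [ENNReal.tsum_comm]

theorem act_sum {ι : Type*} (s : Finset ι) (a : Ker X) (f : ι → X → ℝ≥0∞) (x : X) :
    act a (fun y => ∑ i ∈ s, f i y) x = ∑ i ∈ s, act a (f i) x := by
  simp only [act, Finset.mul_sum]
  exact Summable.tsum_finsetSum fun i _ => ENNReal.summable

open Classical in
theorem act_indicator (a : Ker X) (x z : X) : act a (fun y => if y = z then 1 else 0) x = a x z := by
  rw [act, tsum_eq_single z] <;> simp +contextual

theorem ext_act {a b : Ker X} (h : ∀ g x, act a g x = act b g x) : a = b := by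
  classical
  ext x z
  rw [← act_indicator a, ← act_indicator b, h]

/-! ### Exponentials of kernels -/

/-- The exponential series. -/
def exp (k : Ker X) : Ker X := fun x y => ∑' n : ℕ, (n.factorial : ℝ≥0∞)⁻¹ * (k ^ n) x y

theorem act_exp (k : Ker X) (g : X → ℝ≥0∞) (x : X) :
    act (exp k) g x = ∑' n : ℕ, (n.factorial : ℝ≥0∞)⁻¹ * act (k ^ n) g x := by
  simp only [act, exp, ← ENNReal.tsum_mul_left, ← ENNReal.tsum_mul_right]
  rw [ENNReal.tsum_comm]
  simp only [mul_assoc]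

/-- If `u` intertwines two kernels it intertwines their powers, and hence their exponentials.
Translations, the insertion of a particle and shifts of configurations are all treated in this way.
-/
theorem act_pow_comp (k : Ker X) (k' : Ker Y) (u : Y → X)
    (h : ∀ (g : X → ℝ≥0∞) y, act k g (u y) = act k' (g ∘ u) y) (n : ℕ) (g : X → ℝ≥0∞) (y : Y) :
    act (k ^ n) g (u y) = act (k' ^ n) (g ∘ u) y := by
  induction n generalizing y with
  | zero => simp [act_one]
  | succ n ih =>
    rw [pow_succ', act_mul, h, pow_succ', act_mul]
    congr 1
    funext z
    exact ih z

theorem act_exp_comp (k : Ker X) (k' : Ker Y) (u : Y → X)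
    (h : ∀ (g : X → ℝ≥0∞) y, act k g (u y) = act k' (g ∘ u) y) (g : X → ℝ≥0∞) (y : Y) :
    act (exp k) g (u y) = act (exp k') (g ∘ u) y := by
  rw [act_exp, act_exp]
  simp only [act_pow_comp k k' u h]

theorem inv_factorial_mul_choose (n : ℕ) (p : ℕ × ℕ) (h : p ∈ Finset.HasAntidiagonal.antidiagonal n) :
    (n.factorial : ℝ≥0∞)⁻¹ * (n.choose p.1 : ℝ≥0∞) =
      (p.1.factorial : ℝ≥0∞)⁻¹ * (p.2.factorial : ℝ≥0∞)⁻¹ := by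
  obtain ⟨i, j⟩ := p
  rw [Finset.HasAntidiagonal.mem_antidiagonal] at h
  simp only at h
  subst h
  have h1 := Nat.choose_mul_factorial_mul_factorial (Nat.le_add_right i j)
  rw [Nat.add_sub_cancel_left] at h1
  have hi : (i.factorial : ℝ≥0∞) ≠ 0 := by exact_mod_cast i.factorial_ne_zero
  have hj : (j.factorial : ℝ≥0∞) ≠ 0 := by exact_mod_cast j.factorial_ne_zero
  have hij : ((i + j).factorial : ℝ≥0∞) ≠ 0 := by exact_mod_cast (i + j).factorial_ne_zero
  have h2 : ((i + j).choose i : ℝ≥0∞) * i.factorial * j.factorial = (i + j).factorial := by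
    exact_mod_cast h1
  have h3 : ((i + j).choose i : ℝ≥0∞) =
      (i + j).factorial * ((i.factorial : ℝ≥0∞)⁻¹ * (j.factorial : ℝ≥0∞)⁻¹) := by
    rw [← h2]
    calc ((i + j).choose i : ℝ≥0∞)
        = (i + j).choose i * (i.factorial * (i.factorial : ℝ≥0∞)⁻¹) *
          (j.factorial * (j.factorial : ℝ≥0∞)⁻¹) := by
          rw [ENNReal.mul_inv_cancel hi (ENNReal.natCast_ne_top _),
            ENNReal.mul_inv_cancel hj (ENNReal.natCast_ne_top _), mul_one, mul_one]
      _ = _ := by ring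
  rw [h3, ← mul_assoc, ENNReal.inv_mul_cancel hij (ENNReal.natCast_ne_top _), one_mul]

theorem tsum_tsum_eq_tsum_antidiagonal (f : ℕ → ℕ → ℝ≥0∞) :
    ∑' i, ∑' j, f i j = ∑' n, ∑ p ∈ Finset.HasAntidiagonal.antidiagonal n, f p.1 p.2 := by
  rw [← ENNReal.tsum_prod (f := f), ← Finset.HasAntidiagonal.sigmaAntidiagonalEquivProd.tsum_eq,
    ENNReal.tsum_sigma']
  refine tsum_congr fun n => ?_
  rw [tsum_fintype]
  exact Finset.sum_coe_sort (Finset.HasAntidiagonal.antidiagonal n) (fun p => f p.1 p.2)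

/-- Binomial theorem for commuting kernels and Cauchy product. Every independence statement below
comes from this identity. -/
theorem exp_add {a b : Ker X} (h : Commute a b) : exp (a + b) = exp a * exp b := by
  refine ext_act fun g x => ?_
  have h1 : act (exp a * exp b) g x = ∑' i : ℕ, ∑' j : ℕ,
      (i.factorial : ℝ≥0∞)⁻¹ * ((j.factorial : ℝ≥0∞)⁻¹ * act (a ^ i * b ^ j) g x) := by
    rw [act_mul, act_exp]
    refine tsum_congr fun i => ?_
    rw [ENNReal.tsum_mul_left]
    congr 1
    have : act (exp b) g = fun y => ∑' j : ℕ, (j.factorial : ℝ≥0∞)⁻¹ * act (b ^ j) g y := by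
      funext y; exact act_exp b g y
    rw [this, act_tsum]
    refine tsum_congr fun j => ?_
    rw [act_const_mul, act_mul]
  rw [h1, tsum_tsum_eq_tsum_antidiagonal, act_exp]
  refine tsum_congr fun n => ?_
  have h2 : act ((a + b) ^ n) g x =
      ∑ p ∈ Finset.HasAntidiagonal.antidiagonal n, (n.choose p.1 : ℝ≥0∞) * act (a ^ p.1 * b ^ p.2) g x := by
    rw [h.add_pow']
    induction Finset.HasAntidiagonal.antidiagonal n using Finset.cons_induction with
    | empty => simp [act_zero_left]
    | cons p s hp ih =>
      rw [Finset.sum_cons, Finset.sum_cons, act_add_left, Pi.add_apply, ih,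
        ← Nat.cast_smul_eq_nsmul ℝ≥0∞, act_smul_left]
  rw [h2, Finset.mul_sum]
  refine Finset.sum_congr rfl fun p hp => ?_
  rw [← mul_assoc, inv_factorial_mul_choose n p hp, mul_assoc]

theorem commute_of_act {a b : Ker X} (h : ∀ g x, act a (act b g) x = act b (act a g) x) :
    Commute a b := by
  refine ext_act fun g x => ?_
  rw [act_mul, act_mul, h]

theorem commute_smul_smul {a b : Ker X} (h : Commute a b) (c d : ℝ≥0∞) :
    Commute (c • a) (d • b) :=
  (h.smul_left c).smul_right d

theorem act_pow_const {k : Ker X} {c : ℝ≥0∞} (h : ∀ x, act k (fun _ => 1) x = c) (n : ℕ) (x : X) :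
    act (k ^ n) (fun _ => 1) x = c ^ n := by
  induction n generalizing x with
  | zero => simp [act_one]
  | succ n ih =>
    rw [pow_succ', act_mul]
    have : act (k ^ n) (fun _ => 1) = fun _ => c ^ n * 1 := by funext y; rw [ih, mul_one]
    rw [this, act_const_mul, h, pow_succ]

theorem ofReal_exp_eq_tsum {r : ℝ} (hr : 0 ≤ r) :
    ENNReal.ofReal (Real.exp r) = ∑' n : ℕ, (n.factorial : ℝ≥0∞)⁻¹ * ENNReal.ofReal r ^ n := by
  rw [Real.exp_eq_exp_ℝ, NormedSpace.exp_eq_tsum_div, ENNReal.ofReal_tsum_of_nonneg]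
  · refine tsum_congr fun n => ?_
    rw [div_eq_inv_mul, ENNReal.ofReal_mul (by positivity), ENNReal.ofReal_inv_of_pos
      (by exact_mod_cast n.factorial_pos), ENNReal.ofReal_natCast, ENNReal.ofReal_pow hr]
  · intro n; positivity
  · exact Real.summable_pow_div_factorial r

theorem act_exp_const {k : Ker X} {r : ℝ} (hr : 0 ≤ r)
    (h : ∀ x, act k (fun _ => 1) x = ENNReal.ofReal r) (x : X) :
    act (exp k) (fun _ => 1) x = ENNReal.ofReal (Real.exp r) := by
  rw [act_exp, ofReal_exp_eq_tsum hr]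
  simp only [act_pow_const h]

theorem exp_smul_add (k : Ker X) (s t : ℝ≥0∞) : exp ((s + t) • k) = exp (s • k) * exp (t • k) := by
  rw [add_smul]
  exact exp_add (commute_smul_smul (Commute.refl k) s t)

end

end Ker

end SCBRW

namespace SCBRW

namespace Ker

variable {X : Type*}

noncomputable section

/-! ### Time convolution of families of kernels -/

/-- Entrywise integral of a family of kernels. -/
def lint (F : ℝ → Ker X) : Ker X := fun x z => ∫⁻ s, F s x z

theorem lint_apply (F : ℝ → Ker X) (x z : X) : lint F x z = ∫⁻ s, F s x z := rfl

/-- Time convolution of two families of kernels. -/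
def conv (F G : ℝ → Ker X) (t : ℝ) : Ker X := lint fun s => F s * G (t - s)

/-- A family of kernels depends measurably on time. -/
def TMeas (F : ℝ → Ker X) : Prop := ∀ x y, Measurable fun t => F t x y

/-- A family of kernels vanishes for negative times. -/
def Causal (F : ℝ → Ker X) : Prop := ∀ t < 0, F t = 0

theorem TMeas.mul_comp [Countable X] {F G : ℝ → Ker X} (hF : TMeas F) (hG : TMeas G)
    {α : Type*} [MeasurableSpace α] {u v : α → ℝ} (hu : Measurable u) (hv : Measurable v)
    (x z : X) : Measurable fun a => (F (u a) * G (v a)) x z :=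
  Measurable.tsum fun y => ((hF x y).comp hu).mul ((hG y z).comp hv)

theorem TMeas.mul [Countable X] {F G : ℝ → Ker X} (hF : TMeas F) (hG : TMeas G) :
    TMeas fun t => F t * G t :=
  fun x z => hF.mul_comp hG measurable_id measurable_id x z

theorem TMeas.const (k : Ker X) : TMeas fun _ => k := fun _ _ => measurable_const

theorem TMeas.comp {F : ℝ → Ker X} (hF : TMeas F) {u : ℝ → ℝ} (hu : Measurable u) :
    TMeas fun t => F (u t) := fun x y => (hF x y).comp hu

theorem TMeas.smul {F : ℝ → Ker X} (hF : TMeas F) {c : ℝ → ℝ≥0∞} (hc : Measurable c) :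
    TMeas fun t => c t • F t :=
  fun x y => hc.mul (hF x y)

theorem TMeas.act [Countable X] {F : ℝ → Ker X} (hF : TMeas F) (g : X → ℝ≥0∞) (x : X) :
    Measurable fun t => act (F t) g x :=
  Measurable.tsum fun y => (hF x y).mul_const _

theorem TMeas.act_act [Countable X] {F : ℝ → Ker X} (hF : TMeas F) {w : ℝ → X → ℝ≥0∞}
    (hw : ∀ x, Measurable fun t => w t x) (x : X) : Measurable fun t => Ker.act (F t) (w t) x :=
  Measurable.tsum fun y => (hF x y).mul (hw y)

theorem mul_lint [Countable X] (k : Ker X) {F : ℝ → Ker X} (hF : TMeas F) :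
    k * lint F = lint fun s => k * F s := by
  ext x z
  simp only [mul_apply, lint]
  rw [lintegral_tsum fun y => ((hF y z).const_mul _).aemeasurable]
  exact tsum_congr fun y => (lintegral_const_mul _ (hF y z)).symm

theorem lint_mul [Countable X] (k : Ker X) {F : ℝ → Ker X} (hF : TMeas F) :
    lint F * k = lint fun s => F s * k := by
  ext x z
  simp only [mul_apply, lint]
  rw [lintegral_tsum fun y => ((hF x y).mul_const _).aemeasurable]
  exact tsum_congr fun y => (lintegral_mul_const _ (hF x y)).symm

theorem act_lint [Countable X] {F : ℝ → Ker X} (hF : TMeas F) (g : X → ℝ≥0∞) (x : X) :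
    act (lint F) g x = ∫⁻ s, act (F s) g x := by
  simp only [act, lint]
  rw [lintegral_tsum fun y => ((hF x y).mul_const _).aemeasurable]
  exact tsum_congr fun y => (lintegral_mul_const _ (hF x y)).symm

theorem act_lintegral [Countable X] (k : Ker X) {w : ℝ → X → ℝ≥0∞}
    (hw : ∀ x, Measurable fun t => w t x) (μ : Measure ℝ) (x : X) :
    act k (fun y => ∫⁻ s, w s y ∂μ) x = ∫⁻ s, act k (w s) x ∂μ := by
  simp only [act]
  rw [lintegral_tsum fun y => ((hw y).const_mul _).aemeasurable]
  exact tsum_congr fun y => (lintegral_const_mul _ (hw y)).symm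

theorem lint_add {F : ℝ → Ker X} (hF : TMeas F) (G : ℝ → Ker X) :
    lint (fun s => F s + G s) = lint F + lint G := by
  ext x z
  exact lintegral_add_left (hF x z) _

theorem lint_smul {F : ℝ → Ker X} (hF : TMeas F) (c : ℝ≥0∞) :
    lint (fun s => c • F s) = c • lint F := by
  ext x z
  exact lintegral_const_mul c (hF x z)

theorem TMeas.conv_aux [Countable X] {F G : ℝ → Ker X} (hF : TMeas F) (hG : TMeas G) (t : ℝ) :
    TMeas fun s => F s * G (t - s) :=
  hF.mul (hG.comp (measurable_const.sub measurable_id))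

theorem TMeas.conv [Countable X] {F G : ℝ → Ker X} (hF : TMeas F) (hG : TMeas G) :
    TMeas (conv F G) := by
  intro x z
  exact Measurable.lintegral_prod_right'
    (f := fun a : ℝ × ℝ => (F a.2 * G (a.1 - a.2)) x z)
    (hF.mul_comp hG measurable_snd (measurable_fst.sub measurable_snd) x z)

/-- Tonelli and translation invariance of Lebesgue measure. Convolutions run over the whole line,
and causality of the factors cuts them down to `[0, t]`, so no limits of integration have to be
tracked here. -/
theorem conv_assoc [Countable X] {F G H : ℝ → Ker X} (hF : TMeas F) (hG : TMeas G)
    (hH : TMeas H) (t : ℝ) : conv (conv F G) H t = conv F (conv G H) t := by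
  have h1 : ∀ s, conv F G s * H (t - s) = lint fun r => F r * (G (s - r) * H (t - s)) := by
    intro s
    rw [conv, lint_mul _ (hF.conv_aux hG s)]
    simp only [mul_assoc]
  have h2 : ∀ r, F r * conv G H (t - r) = lint fun s => F r * (G (s - r) * H (t - s)) := by
    intro r
    rw [conv, mul_lint _ (hG.conv_aux hH (t - r))]
    ext x z
    simp only [lint]
    rw [← lintegral_sub_right_eq_self _ r]
    refine lintegral_congr fun s => ?_
    rw [sub_sub_sub_cancel_right]
  ext x z
  change ∫⁻ s, (conv F G s * H (t - s)) x z = ∫⁻ r, (F r * conv G H (t - r)) x z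
  simp only [h1, h2]
  change ∫⁻ s, ∫⁻ r, (F r * (G (s - r) * H (t - s))) x z =
    ∫⁻ r, ∫⁻ s, (F r * (G (s - r) * H (t - s))) x z
  rw [lintegral_lintegral_swap]
  refine Measurable.aemeasurable ?_
  refine Measurable.tsum fun y => ?_
  exact ((hF x y).comp measurable_snd).mul (hG.mul_comp hH
    (measurable_fst.sub measurable_snd) (measurable_const.sub measurable_fst) y z)

theorem conv_add [Countable X] {F G : ℝ → Ker X} (hF : TMeas F) (hG : TMeas G) (H : ℝ → Ker X)
    (t : ℝ) : conv F (fun s => G s + H s) t = conv F G t + conv F H t := by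
  simp only [conv, mul_add]
  exact lint_add (hF.conv_aux hG t) _

theorem add_conv [Countable X] {F G H : ℝ → Ker X} (hF : TMeas F) (hH : TMeas H)
    (t : ℝ) : conv (fun s => F s + G s) H t = conv F H t + conv G H t := by
  simp only [conv, add_mul]
  exact lint_add (hF.conv_aux hH t) _

theorem mul_conv [Countable X] {F G : ℝ → Ker X} (hF : TMeas F) (hG : TMeas G) (k : Ker X)
    (t : ℝ) : conv (fun s => k * F s) G t = k * conv F G t := by
  simp only [conv, mul_assoc]
  rw [mul_lint _ (hF.conv_aux hG t)]

theorem mul_mid_conv (F G : ℝ → Ker X) (k : Ker X) (t : ℝ) :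
    conv (fun s => F s * k) G t = conv F (fun s => k * G s) t := by
  simp only [conv, mul_assoc]

theorem smul_conv [Countable X] {F G : ℝ → Ker X} (hF : TMeas F) (hG : TMeas G) (c : ℝ≥0∞)
    (t : ℝ) : conv (fun s => c • F s) G t = c • conv F G t := by
  simp only [conv, smul_mul_assoc]
  exact lint_smul (hF.conv_aux hG t) c

theorem act_conv [Countable X] {F G : ℝ → Ker X} (hF : TMeas F) (hG : TMeas G)
    (g : X → ℝ≥0∞) (t : ℝ) (x : X) :
    act (conv F G t) g x = ∫⁻ s, act (F s) (act (G (t - s)) g) x := by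
  rw [conv, act_lint (hF.conv_aux hG t)]
  simp only [act_mul]

theorem lintegral_eq_Icc {f : ℝ → ℝ≥0∞} {t : ℝ} (h0 : ∀ s < 0, f s = 0)
    (h1 : ∀ s, t < s → f s = 0) : ∫⁻ s, f s = ∫⁻ s in Set.Icc 0 t, f s := by
  rw [← lintegral_indicator measurableSet_Icc]
  refine lintegral_congr fun s => ?_
  by_cases hs : s ∈ Set.Icc 0 t
  · rw [Set.indicator_of_mem hs]
  · rw [Set.indicator_of_notMem hs]
    by_cases h : s < 0
    · exact h0 s h
    · exact h1 s (by by_contra h2; exact hs ⟨not_lt.mp h, not_lt.mp h2⟩)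

theorem act_zero (k : Ker X) : act k 0 = 0 := by
  funext x
  simp [act]

theorem act_conv_Icc [Countable X] {F G : ℝ → Ker X} (hF : TMeas F) (hG : TMeas G)
    (hF' : Causal F) (hG' : Causal G) (g : X → ℝ≥0∞) (t : ℝ) (x : X) :
    act (conv F G t) g x = ∫⁻ s in Set.Icc 0 t, act (F s) (act (G (t - s)) g) x := by
  rw [act_conv hF hG]
  refine lintegral_eq_Icc (fun s hs => ?_) fun s hs => ?_
  · rw [hF' s hs, act_zero_left]; rfl
  · rw [hG' (t - s) (by linarith), act_zero_left, act_zero]; rfl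

theorem Causal.conv {F G : ℝ → Ker X} (hF : Causal F) (hG : Causal G) : Causal (conv F G) := by
  intro t ht
  ext x z
  change ∫⁻ s, (F s * G (t - s)) x z = 0
  rw [← lintegral_zero (μ := (volume : Measure ℝ))]
  refine lintegral_congr fun s => ?_
  by_cases hs : s < 0
  · rw [hF s hs, zero_mul]; rfl
  · rw [hG (t - s) (by linarith [not_lt.mp hs]), mul_zero]; rfl

theorem Causal.mul_const {F : ℝ → Ker X} (hF : Causal F) (k : Ker X) : Causal fun s => F s * k := by
  intro t ht
  simp only [hF t ht, zero_mul]

/-! ### Perturbation series -/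

/-- The terms of the perturbation series of the family `N` by the kernel `k`. -/
def dysonTerm (N : ℝ → Ker X) (k : Ker X) : ℕ → ℝ → Ker X
  | 0 => N
  | n + 1 => conv (fun s => N s * k) (dysonTerm N k n)

/-- The perturbation series of the family `N` by the kernel `k`. -/
def dyson (N : ℝ → Ker X) (k : Ker X) (t : ℝ) : Ker X := fun x z => ∑' n, dysonTerm N k n t x z

variable {N : ℝ → Ker X} {k : Ker X}

theorem dysonTerm_succ (n : ℕ) :
    dysonTerm N k (n + 1) = conv (fun s => N s * k) (dysonTerm N k n) := rfl

theorem dysonTerm_meas [Countable X] (hN : TMeas N) (n : ℕ) : TMeas (dysonTerm N k n) := by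
  induction n with
  | zero => exact hN
  | succ n ih => exact (hN.mul (TMeas.const k)).conv ih

theorem dyson_meas [Countable X] (hN : TMeas N) : TMeas (dyson N k) :=
  fun x z => Measurable.tsum fun n => dysonTerm_meas hN n x z

theorem dysonTerm_causal (hN : Causal N) (n : ℕ) : Causal (dysonTerm N k n) := by
  induction n with
  | zero => exact hN
  | succ n ih => exact (hN.mul_const k).conv ih

theorem dyson_causal (hN : Causal N) : Causal (dyson N k) := by
  intro t ht
  ext x z
  simp only [dyson, dysonTerm_causal hN _ t ht, zero_apply, tsum_zero]

theorem act_dyson (g : X → ℝ≥0∞) (t : ℝ) (x : X) :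
    act (dyson N k t) g x = ∑' n, act (dysonTerm N k n t) g x := by
  simp only [act, dyson, ← ENNReal.tsum_mul_right]
  rw [ENNReal.tsum_comm]

theorem conv_dyson [Countable X] (hN : TMeas N) {F : ℝ → Ker X} (hF : TMeas F) (t : ℝ) (x z : X) :
    conv F (dyson N k) t x z = ∑' n, conv F (dysonTerm N k n) t x z := by
  change ∫⁻ s, (F s * dyson N k (t - s)) x z = ∑' n, ∫⁻ s, (F s * dysonTerm N k n (t - s)) x z
  rw [← lintegral_tsum fun n => (hF.conv_aux (dysonTerm_meas hN n) t x z).aemeasurable]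
  refine lintegral_congr fun s => ?_
  simp only [mul_apply, dyson, ← ENNReal.tsum_mul_left]
  rw [ENNReal.tsum_comm]

theorem dyson_conv [Countable X] (hN : TMeas N) {F : ℝ → Ker X} (hF : TMeas F) (t : ℝ) (x z : X) :
    conv (dyson N k) F t x z = ∑' n, conv (dysonTerm N k n) F t x z := by
  change ∫⁻ s, (dyson N k s * F (t - s)) x z = ∑' n, ∫⁻ s, (dysonTerm N k n s * F (t - s)) x z
  rw [← lintegral_tsum fun n => ((dysonTerm_meas hN n).conv_aux hF t x z).aemeasurable]
  refine lintegral_congr fun s => ?_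
  simp only [mul_apply, dyson, ← ENNReal.tsum_mul_right]
  rw [ENNReal.tsum_comm]

theorem dyson_apply_eq (t : ℝ) (x z : X) :
    dyson N k t x z = N t x z + ∑' n, dysonTerm N k (n + 1) t x z :=
  tsum_eq_zero_add' (f := fun n => dysonTerm N k n t x z) ENNReal.summable

theorem dyson_left [Countable X] (hN : TMeas N) (t : ℝ) :
    dyson N k t = N t + conv (fun s => N s * k) (dyson N k) t := by
  ext x z
  rw [add_apply, conv_dyson hN (hN.mul (TMeas.const k)), dyson_apply_eq]
  simp only [dysonTerm_succ]

/-- By associativity the last perturbation event may be singled out instead of the first. -/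
theorem dysonTerm_succ_right [Countable X] (hN : TMeas N) (n : ℕ) :
    dysonTerm N k (n + 1) = conv (dysonTerm N k n) (fun s => k * N s) := by
  induction n with
  | zero => funext t; exact mul_mid_conv _ _ _ _
  | succ n ih =>
    have hk : TMeas fun s => N s * k := hN.mul (TMeas.const k)
    have hk' : TMeas fun s => k * N s := (TMeas.const k).mul hN
    funext t
    rw [dysonTerm_succ (n + 1), ih, ← conv_assoc hk (dysonTerm_meas hN n) hk', ← dysonTerm_succ, ih]

theorem dyson_right [Countable X] (hN : TMeas N) (t : ℝ) :
    dyson N k t = N t + conv (dyson N k) (fun s => k * N s) t := by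
  ext x z
  rw [add_apply, dyson_conv hN ((TMeas.const k).mul hN), dyson_apply_eq]
  simp only [dysonTerm_succ_right hN]

/-- The partial sums are Picard iterates. Properties stable under one iteration and under monotone
limits therefore pass to the whole series. -/
theorem sum_act_dysonTerm_succ [Countable X] (hN : TMeas N) (hN' : Causal N) (f : X → ℝ≥0∞)
    (n : ℕ) (t : ℝ) (x : X) : ∑ i ∈ Finset.range (n + 1), act (dysonTerm N k i t) f x =
      act (N t) f x + ∫⁻ s in Set.Icc 0 t, act (N s)
        (act k fun y => ∑ i ∈ Finset.range n, act (dysonTerm N k i (t - s)) f y) x := by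
  have hk : TMeas fun s => N s * k := hN.mul (TMeas.const k)
  rw [Finset.sum_range_succ', add_comm]
  congr 1
  have : ∀ i, act (dysonTerm N k (i + 1) t) f x =
      ∫⁻ s in Set.Icc 0 t, act (N s) (act k (act (dysonTerm N k i (t - s)) f)) x := by
    intro i
    rw [dysonTerm_succ, act_conv_Icc hk (dysonTerm_meas hN i) (hN'.mul_const k)
      (dysonTerm_causal hN' i)]
    simp only [act_mul]
  simp only [this]
  rw [← lintegral_finsetSum]
  · refine lintegral_congr fun s => ?_
    rw [← act_sum]
    congr 1
    funext y
    rw [← act_sum]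
  · intro i _
    exact hN.act_act (fun y => (TMeas.const k).act_act (fun z =>
      ((dysonTerm_meas hN i).act f z).comp (measurable_const.sub measurable_id)) y) x

/-- The perturbation series is the smallest solution of the perturbation equation. -/
theorem act_dyson_le [Countable X] (hN : TMeas N) (hN' : Causal N) {f : X → ℝ≥0∞}
    {w : ℝ → X → ℝ≥0∞}
    (h : ∀ t, 0 ≤ t → ∀ x, act (N t) f x + ∫⁻ s in Set.Icc 0 t, act (N s) (act k (w (t - s))) x
      ≤ w t x) {t : ℝ} (ht : 0 ≤ t) (x : X) : act (dyson N k t) f x ≤ w t x := by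
  have key : ∀ n t, 0 ≤ t → ∀ x, ∑ i ∈ Finset.range n, act (dysonTerm N k i t) f x ≤ w t x := by
    intro n
    induction n with
    | zero => intro t _ x; simp
    | succ n ih =>
      intro t ht x
      refine le_trans ?_ (h t ht x)
      rw [sum_act_dysonTerm_succ hN hN']
      refine add_le_add le_rfl (setLIntegral_mono' measurableSet_Icc fun s hs => ?_)
      refine act_mono _ (fun y => act_mono _ (fun z => ?_) _) _
      exact ih (t - s) (by linarith [hs.2]) z
  rw [act_dyson, ENNReal.tsum_eq_iSup_nat]
  exact iSup_le fun n => key n t ht x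

/-- Of `n` perturbation events in `[0, t + s]`, the first coordinate counts those before time `t`
and the second those after. -/
theorem dysonTerm_add [Countable X] (hN : TMeas N) (hN' : Causal N)
    (hadd : ∀ s t, 0 ≤ s → 0 ≤ t → N (s + t) = N s * N t) (n : ℕ) {s t : ℝ} (hs : 0 ≤ s)
    (ht : 0 ≤ t) : dysonTerm N k n (t + s) =
      ∑ p ∈ Finset.HasAntidiagonal.antidiagonal n, dysonTerm N k p.1 t * dysonTerm N k p.2 s := by
  induction n generalizing t with
  | zero => simp [dysonTerm, hadd t s ht hs]
  | succ n ih =>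
    have hk : TMeas fun s => N s * k := hN.mul (TMeas.const k)
    rw [Finset.Nat.sum_antidiagonal_succ]
    ext x z
    change ∫⁻ r, (N r * k * dysonTerm N k n (t + s - r)) x z = _
    -- Case distinction by the time `r` of the first event. For `r ≥ t` the semigroup property
    -- factors `N t` out and gives the term without events before `t`; for `r < t` the induction
    -- hypothesis splits the remaining events.
    rw [← lintegral_add_compl _ (measurableSet_Iio (a := t)), add_comm, add_apply]
    congr 1
    · change _ = (N t * conv _ (dysonTerm N k n) s) x z
      rw [conv, mul_lint _ (hk.conv_aux (dysonTerm_meas hN n) s)]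
      rw [lint_apply, ← lintegral_sub_right_eq_self
          (fun r => (N t * (N r * k * dysonTerm N k n (s - r))) x z) t,
        ← lintegral_indicator (measurableSet_Iio (a := t)).compl]
      refine lintegral_congr fun r => ?_
      by_cases hr : r < t
      · rw [Set.indicator_of_notMem (by simpa using hr), hN' (r - t) (by linarith)]
        simp [zero_apply]
      · rw [Set.indicator_of_mem (by simpa using hr)]
        have h1 : N r = N t * N (r - t) := by
          rw [← hadd t (r - t) ht (by linarith)]; congr 1; ring
        have h2 : t + s - r = s - (r - t) := by ring
        rw [h2, h1]
        simp only [mul_assoc]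
    · have h1 : ∀ r ∈ Set.Iio t, (N r * k * dysonTerm N k n (t + s - r)) x z =
          (∑ p ∈ Finset.HasAntidiagonal.antidiagonal n,
            N r * k * dysonTerm N k p.1 (t - r) * dysonTerm N k p.2 s) x z := by
        intro r hr
        have h2 : t + s - r = (t - r) + s := by ring
        rw [h2, ih (by linarith [Set.mem_Iio.mp hr]), Finset.mul_sum]
        simp only [mul_assoc]
      rw [setLIntegral_congr_fun measurableSet_Iio h1]
      have hsum : ∀ (S : Finset (ℕ × ℕ)) (f : ℕ × ℕ → Ker X),
          (∑ p ∈ S, f p) x z = ∑ p ∈ S, f p x z := by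
        intro S f
        induction S using Finset.cons_induction with
        | empty => rfl
        | cons a S ha ih => rw [Finset.sum_cons, Finset.sum_cons, add_apply, ih]
      simp only [hsum]
      have hm : ∀ p : ℕ × ℕ, TMeas fun r =>
          N r * k * dysonTerm N k p.1 (t - r) * dysonTerm N k p.2 s := fun p =>
        (hk.conv_aux (dysonTerm_meas hN p.1) t).mul (TMeas.const _)
      rw [lintegral_finsetSum _ fun p _ => hm p x z]
      refine Finset.sum_congr rfl fun p _ => ?_
      change _ = (conv _ (dysonTerm N k p.1) t * dysonTerm N k p.2 s) x z
      rw [conv, lint_mul _ (hk.conv_aux (dysonTerm_meas hN p.1) t)]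
      rw [lint_apply, setLIntegral_congr (Iio_ae_eq_Iic (a := t)), ← lintegral_indicator measurableSet_Iic]
      refine lintegral_congr fun r => ?_
      by_cases hr : r ≤ t
      · rw [Set.indicator_of_mem (by simpa using hr)]
      · rw [Set.indicator_of_notMem (by simpa using hr),
          dysonTerm_causal hN' p.1 (t - r) (by linarith)]
        simp [zero_apply]

theorem dyson_add [Countable X] (hN : TMeas N) (hN' : Causal N)
    (hadd : ∀ s t, 0 ≤ s → 0 ≤ t → N (s + t) = N s * N t) {s t : ℝ} (hs : 0 ≤ s)
    (ht : 0 ≤ t) : dyson N k (t + s) = dyson N k t * dyson N k s := by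
  refine ext_act fun g x => ?_
  have h1 : act (dyson N k t * dyson N k s) g x =
      ∑' i, ∑' j, act (dysonTerm N k i t * dysonTerm N k j s) g x := by
    rw [act_mul, act_dyson]
    refine tsum_congr fun i => ?_
    have : act (dyson N k s) g = fun y => ∑' j, act (dysonTerm N k j s) g y := by
      funext y; exact act_dyson g s y
    rw [this, act_tsum]
    simp only [act_mul]
  rw [h1, tsum_tsum_eq_tsum_antidiagonal, act_dyson]
  refine tsum_congr fun n => ?_
  rw [dysonTerm_add hN hN' hadd n hs ht]
  induction Finset.HasAntidiagonal.antidiagonal n using Finset.cons_induction with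
  | empty => simp [act_zero_left]
  | cons p S hp ih => rw [Finset.sum_cons, Finset.sum_cons, act_add_left, Pi.add_apply, ih]

end

end Ker

end SCBRW

namespace SCBRW

noncomputable section

/-! ### Poisson weights and their integral equations -/

theorem lintegral_Icc_ofReal {f : ℝ → ℝ} {t : ℝ} (ht : 0 ≤ t) (hf : ContinuousOn f (Set.Icc 0 t))
    (h0 : ∀ s ∈ Set.Icc 0 t, 0 ≤ f s) :
    ∫⁻ s in Set.Icc 0 t, ENNReal.ofReal (f s) = ENNReal.ofReal (∫ s in (0 : ℝ)..t, f s) := by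
  rw [intervalIntegral.integral_of_le ht, ← integral_Icc_eq_integral_Ioc,
    ofReal_integral_eq_lintegral_ofReal]
  · exact hf.integrableOn_Icc
  · exact (ae_restrict_iff' measurableSet_Icc).mpr (Eventually.of_forall h0)

theorem lintegral_Icc_sub (f : ℝ → ℝ≥0∞) (t : ℝ) :
    ∫⁻ s in Set.Icc 0 t, f (t - s) = ∫⁻ s in Set.Icc 0 t, f s := by
  rw [← lintegral_indicator measurableSet_Icc, ← lintegral_indicator measurableSet_Icc,
    ← lintegral_sub_left_eq_self ((Set.Icc 0 t).indicator f) t]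
  refine lintegral_congr fun s => ?_
  by_cases hs : s ∈ Set.Icc 0 t
  · rw [Set.indicator_of_mem hs, Set.indicator_of_mem]
    exact ⟨by linarith [hs.2], by linarith [hs.1]⟩
  · rw [Set.indicator_of_notMem hs, Set.indicator_of_notMem]
    exact fun h => hs ⟨by linarith [h.2], by linarith [h.1]⟩

/-- Poisson weights with a general exponential factor. -/
def poissonWeight (a t : ℝ) (j : ℕ) : ℝ := Real.exp (-(a * t)) * (t ^ j / j.factorial)

theorem poissonWeight_nonneg (a : ℝ) {t : ℝ} (ht : 0 ≤ t) (j : ℕ) : 0 ≤ poissonWeight a t j := by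
  unfold poissonWeight; positivity

theorem poissonWeight_continuous (a : ℝ) (j : ℕ) : Continuous fun t => poissonWeight a t j := by
  unfold poissonWeight; fun_prop

theorem hasDerivAt_poissonWeight_succ (a t : ℝ) (j : ℕ) :
    HasDerivAt (fun t => poissonWeight a t (j + 1))
      (poissonWeight a t j - a * poissonWeight a t (j + 1)) t := by
  unfold poissonWeight
  have h1 : HasDerivAt (fun t : ℝ => Real.exp (-(a * t))) (Real.exp (-(a * t)) * (-a)) t := by
    have := (((hasDerivAt_id t).const_mul a).neg).exp
    simpa using this
  have h2 : HasDerivAt (fun t : ℝ => t ^ (j + 1) / ((j + 1).factorial : ℝ))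
      (((j + 1 : ℕ) : ℝ) * t ^ j / ((j + 1).factorial : ℝ)) t := by
    have := (hasDerivAt_pow (j + 1) t).div_const ((j + 1).factorial : ℝ)
    simpa using this
  refine (h1.mul h2).congr_deriv ?_
  have h3 : ((j + 1 : ℕ) : ℝ) * t ^ j / ((j + 1).factorial : ℝ) = t ^ j / j.factorial := by
    rw [Nat.factorial_succ, Nat.cast_mul]
    have : ((j + 1 : ℕ) : ℝ) ≠ 0 := by positivity
    have : (j.factorial : ℝ) ≠ 0 := by positivity
    field_simp
  rw [h3]
  ring

theorem poissonWeight_zero_add {a t : ℝ} (ha : 0 ≤ a) (ht : 0 ≤ t) :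
    ENNReal.ofReal (poissonWeight a t 0) +
      ENNReal.ofReal a * ∫⁻ s in Set.Icc 0 t, ENNReal.ofReal (poissonWeight a s 0) = 1 := by
  rw [lintegral_Icc_ofReal ht (poissonWeight_continuous a 0).continuousOn
    fun s hs => poissonWeight_nonneg a hs.1 0, ← ENNReal.ofReal_mul ha, ← ENNReal.ofReal_add
    (poissonWeight_nonneg a ht 0) (mul_nonneg ha (intervalIntegral.integral_nonneg ht
      fun s hs => poissonWeight_nonneg a hs.1 0)), ← intervalIntegral.integral_const_mul]
  have hd : ∀ s : ℝ, HasDerivAt (fun t => -poissonWeight a t 0) (a * poissonWeight a s 0) s := by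
    intro s
    have h1 : HasDerivAt (fun t : ℝ => Real.exp (-(a * t))) (Real.exp (-(a * s)) * (-a)) s := by
      have := (((hasDerivAt_id s).const_mul a).neg).exp
      simpa using this
    unfold poissonWeight
    simp only [pow_zero, Nat.factorial_zero, Nat.cast_one, div_one, mul_one]
    exact h1.neg.congr_deriv (by ring)
  rw [intervalIntegral.integral_eq_sub_of_hasDerivAt (fun s _ => hd s)
    ((continuous_const.mul (poissonWeight_continuous a 0)).intervalIntegrable _ _)]
  simp [poissonWeight]

/-- The differential equation of the Poisson weights in integrated form, with the loss term moved to
the left so that it makes sense in `ℝ≥0∞`. -/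
theorem poissonWeight_succ_add {a t : ℝ} (ha : 0 ≤ a) (ht : 0 ≤ t) (j : ℕ) :
    ENNReal.ofReal (poissonWeight a t (j + 1)) +
      ENNReal.ofReal a * ∫⁻ s in Set.Icc 0 t, ENNReal.ofReal (poissonWeight a s (j + 1)) =
      ∫⁻ s in Set.Icc 0 t, ENNReal.ofReal (poissonWeight a s j) := by
  rw [lintegral_Icc_ofReal ht (poissonWeight_continuous a _).continuousOn
    fun s hs => poissonWeight_nonneg a hs.1 _, lintegral_Icc_ofReal ht
    (poissonWeight_continuous a _).continuousOn fun s hs => poissonWeight_nonneg a hs.1 _,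
    ← ENNReal.ofReal_mul ha, ← ENNReal.ofReal_add
    (poissonWeight_nonneg a ht _) (mul_nonneg ha (intervalIntegral.integral_nonneg ht
      fun s hs => poissonWeight_nonneg a hs.1 _))]
  congr 1
  have hc : Continuous fun s => a * poissonWeight a s (j + 1) :=
    continuous_const.mul (poissonWeight_continuous a (j + 1))
  have h := intervalIntegral.integral_eq_sub_of_hasDerivAt (a := 0) (b := t)
    (fun s _ => hasDerivAt_poissonWeight_succ a s j)
    (((poissonWeight_continuous a j).sub hc).intervalIntegrable _ _)
  rw [intervalIntegral.integral_sub ((poissonWeight_continuous a j).intervalIntegrable _ _)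
    (hc.intervalIntegrable _ _), intervalIntegral.integral_const_mul] at h
  have h0 : poissonWeight a 0 (j + 1) = 0 := by simp [poissonWeight]
  rw [h0] at h
  linarith

/-! ### Semigroups with an invariant exponential rate -/

namespace Ker

variable {X : Type*}

/-- The semigroup `e^{-r t} e^{t k}`, for a rate function `r` that is invariant under `k`. -/
def flow (k : Ker X) (r : X → ℝ) (t : ℝ) : Ker X :=
  fun x y => if t < 0 then 0 else
    ENNReal.ofReal (Real.exp (-(r x * t))) * exp (ENNReal.ofReal t • k) x y

theorem flow_causal (k : Ker X) (r : X → ℝ) : Causal (flow k r) := by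
  intro t ht
  ext x y
  rw [flow, if_pos ht, zero_apply]

theorem flow_of_nonneg (k : Ker X) (r : X → ℝ) {t : ℝ} (ht : 0 ≤ t) (x y : X) :
    flow k r t x y = ENNReal.ofReal (Real.exp (-(r x * t))) * exp (ENNReal.ofReal t • k) x y := by
  rw [flow, if_neg (not_lt.mpr ht)]

theorem act_flow' (k : Ker X) (r : X → ℝ) {t : ℝ} (ht : 0 ≤ t) (g : X → ℝ≥0∞) (x : X) :
    act (flow k r t) g x =
      ENNReal.ofReal (Real.exp (-(r x * t))) * act (exp (ENNReal.ofReal t • k)) g x := by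
  simp only [act, flow_of_nonneg k r ht, mul_assoc, ENNReal.tsum_mul_left]

theorem act_flow (k : Ker X) (r : X → ℝ) {t : ℝ} (ht : 0 ≤ t) (g : X → ℝ≥0∞) (x : X) :
    act (flow k r t) g x =
      ∑' j, ENNReal.ofReal (poissonWeight (r x) t j) * act (k ^ j) g x := by
  rw [act_flow' k r ht, act_exp, ← ENNReal.tsum_mul_left]
  refine tsum_congr fun j => ?_
  rw [smul_pow, act_smul_left, poissonWeight, ENNReal.ofReal_mul (Real.exp_pos _).le,
    div_eq_inv_mul, ENNReal.ofReal_mul (by positivity), ENNReal.ofReal_inv_of_pos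
    (by exact_mod_cast j.factorial_pos), ENNReal.ofReal_natCast, ENNReal.ofReal_pow ht]
  ring

theorem flow_meas (k : Ker X) (r : X → ℝ) : TMeas (flow k r) := by
  classical
  intro x y
  have : (fun t => flow k r t x y) = fun t => (Set.Iio (0 : ℝ)).piecewise (fun _ => 0)
      (fun t => ∑' j, ENNReal.ofReal (poissonWeight (r x) t j) * (k ^ j) x y) t := by
    funext t
    by_cases ht : t < 0
    · rw [Set.piecewise_eq_of_mem _ _ _ (by simpa using ht), flow_causal k r t ht, zero_apply]
    · rw [Set.piecewise_eq_of_notMem _ _ _ (by simpa using ht), ← act_indicator (flow k r t),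
        act_flow k r (not_lt.mp ht)]
      simp only [act_indicator]
  rw [this]
  refine Measurable.piecewise measurableSet_Iio measurable_const ?_
  exact Measurable.tsum fun j =>
    ((poissonWeight_continuous _ _).measurable.ennreal_ofReal).mul_const _

variable {k : Ker X} {r : X → ℝ}

theorem act_congr_of_pos {a : Ker X} {x : X} {f g : X → ℝ≥0∞}
    (h : ∀ y, a x y ≠ 0 → f y = g y) : act a f x = act a g x := by
  refine tsum_congr fun y => ?_
  by_cases hy : a x y = 0
  · rw [hy, zero_mul, zero_mul]
  · rw [h y hy]

theorem pow_invariant (h : ∀ x y, k x y ≠ 0 → r y = r x) (n : ℕ) (x y : X)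
    (hxy : (k ^ n) x y ≠ 0) : r y = r x := by
  induction n generalizing x with
  | zero =>
    rw [pow_zero] at hxy
    by_contra hne
    exact hxy (one_apply_of_ne (by rintro rfl; exact hne rfl))
  | succ n ih =>
    rw [pow_succ', mul_apply] at hxy
    have : ∃ z, k x z * (k ^ n) z y ≠ 0 := by
      by_contra! hall
      exact hxy (by simp [hall])
    obtain ⟨z, hz⟩ := this
    rw [ih z (right_ne_zero_of_mul hz), h x z (left_ne_zero_of_mul hz)]

theorem exp_invariant (h : ∀ x y, k x y ≠ 0 → r y = r x) (c : ℝ≥0∞) (x y : X)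
    (hxy : exp (c • k) x y ≠ 0) : r y = r x := by
  have : ∃ n : ℕ, (n.factorial : ℝ≥0∞)⁻¹ * ((c • k) ^ n) x y ≠ 0 := by
    by_contra! hall
    exact hxy (by simp [exp, hall])
  obtain ⟨n, hn⟩ := this
  have := right_ne_zero_of_mul hn
  rw [smul_pow, smul_apply] at this
  exact pow_invariant h n x y (right_ne_zero_of_mul this)

theorem flow_add (h : ∀ x y, k x y ≠ 0 → r y = r x) (s t : ℝ) (hs : 0 ≤ s) (ht : 0 ≤ t) :
    flow k r (s + t) = flow k r s * flow k r t := by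
  refine ext_act fun g x => ?_
  rw [act_mul, act_flow' k r (add_nonneg hs ht), act_flow' k r hs,
    ENNReal.ofReal_add hs ht, exp_smul_add, act_mul]
  have h1 : act (exp (ENNReal.ofReal s • k)) (act (flow k r t) g) x =
      act (exp (ENNReal.ofReal s • k)) (fun y => ENNReal.ofReal (Real.exp (-(r x * t))) *
        act (exp (ENNReal.ofReal t • k)) g y) x := by
    refine act_congr_of_pos fun y hy => ?_
    rw [act_flow' k r ht, exp_invariant h _ x y hy]
  rw [h1, act_const_mul, ← mul_assoc, ← ENNReal.ofReal_mul (Real.exp_pos _).le, ← Real.exp_add]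
  congr 4
  ring

/-- Integrated Kolmogorov equation. Both sides are series in the powers of `k`, whose coefficients
agree by the equations for Poisson weights; the invariance of `r` keeps the weights unchanged when
`k` is applied. -/
theorem flow_first_jump [Countable X] (h : ∀ x y, k x y ≠ 0 → r y = r x) (hr : ∀ x, 0 ≤ r x)
    {t : ℝ} (ht : 0 ≤ t) (g : X → ℝ≥0∞) (x : X) :
    act (flow k r t) g x + ENNReal.ofReal (r x) * ∫⁻ s in Set.Icc 0 t, act (flow k r s) g x =
      g x + ∫⁻ s in Set.Icc 0 t, act k (act (flow k r s) g) x := by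
  have h1 : ∫⁻ s in Set.Icc 0 t, act (flow k r s) g x = ∑' j, (∫⁻ s in Set.Icc 0 t,
      ENNReal.ofReal (poissonWeight (r x) s j)) * act (k ^ j) g x := by
    rw [setLIntegral_congr_fun measurableSet_Icc fun s hs => act_flow k r hs.1 g x,
      lintegral_tsum fun j => ((poissonWeight_continuous _ _).measurable.ennreal_ofReal.mul_const
        _).aemeasurable]
    exact tsum_congr fun j => lintegral_mul_const _
      (poissonWeight_continuous _ _).measurable.ennreal_ofReal
  have h2 : ∫⁻ s in Set.Icc 0 t, act k (act (flow k r s) g) x = ∑' j, (∫⁻ s in Set.Icc 0 t,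
      ENNReal.ofReal (poissonWeight (r x) s j)) * act (k ^ (j + 1)) g x := by
    have h3 : ∀ s ∈ Set.Icc 0 t, act k (act (flow k r s) g) x =
        ∑' j, ENNReal.ofReal (poissonWeight (r x) s j) * act (k ^ (j + 1)) g x := by
      intro s hs
      have h4 : act k (act (flow k r s) g) x = act k (fun y =>
          ∑' j, ENNReal.ofReal (poissonWeight (r x) s j) * act (k ^ j) g y) x := by
        refine act_congr_of_pos fun y hy => ?_
        rw [act_flow k r hs.1, h x y hy]
      rw [h4, act_tsum]
      refine tsum_congr fun j => ?_
      rw [act_const_mul, pow_succ', act_mul]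
    rw [setLIntegral_congr_fun measurableSet_Icc h3,
      lintegral_tsum fun j => ((poissonWeight_continuous _ _).measurable.ennreal_ofReal.mul_const
        _).aemeasurable]
    exact tsum_congr fun j => lintegral_mul_const _
      (poissonWeight_continuous _ _).measurable.ennreal_ofReal
  rw [h1, h2, act_flow k r ht, ← ENNReal.tsum_mul_left, ← ENNReal.tsum_add,
    tsum_eq_zero_add' ENNReal.summable]
  congr 1
  · rw [← mul_assoc, ← add_mul, poissonWeight_zero_add (hr x) ht, pow_zero, act_one, one_mul]
  · refine tsum_congr fun j => ?_
    rw [← mul_assoc, ← add_mul, poissonWeight_succ_add (hr x) ht]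

theorem flow_const_add (k : Ker X) (r : X → ℝ) (c t : ℝ) :
    flow k (fun x => r x + c) t = ENNReal.ofReal (Real.exp (-(c * t))) • flow k r t := by
  by_cases ht : t < 0
  · rw [flow_causal _ _ t ht, flow_causal _ _ t ht, smul_zero]
  · ext x y
    rw [smul_apply, flow_of_nonneg _ _ (not_lt.mp ht), flow_of_nonneg _ _ (not_lt.mp ht),
      ← mul_assoc, ← ENNReal.ofReal_mul (Real.exp_pos _).le, ← Real.exp_add]
    congr 3
    ring_nf

theorem act_flow_one (hr : ∀ x, 0 ≤ r x) (h : ∀ x, act k (fun _ => 1) x = ENNReal.ofReal (r x))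
    (hinv : ∀ x y, k x y ≠ 0 → r y = r x) {t : ℝ} (ht : 0 ≤ t) (x : X) :
    act (flow k r t) (fun _ => 1) x = 1 := by
  rw [act_flow' k r ht, act_exp]
  have h1 : ∀ n, act ((ENNReal.ofReal t • k) ^ n) (fun _ => 1) x = ENNReal.ofReal (r x * t) ^ n := by
    intro n
    rw [smul_pow, act_smul_left]
    have h2 : act (k ^ n) (fun _ => 1) x = ENNReal.ofReal (r x) ^ n := by
      induction n with
      | zero => simp [act_one]
      | succ n ih =>
        rw [pow_succ, act_mul]
        have h3 : act (k ^ n) (act k fun _ => 1) x =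
            act (k ^ n) (fun _ => ENNReal.ofReal (r x) * 1) x := by
          refine act_congr_of_pos fun y hy => ?_
          rw [h, pow_invariant hinv n x y hy, mul_one]
        rw [h3, act_const_mul, ih, pow_succ, mul_comm]
    rw [h2, ENNReal.ofReal_mul (hr x), mul_pow, mul_comm]
  simp only [h1]
  rw [← ofReal_exp_eq_tsum (mul_nonneg (hr x) ht), ← ENNReal.ofReal_mul (Real.exp_pos _).le,
    ← Real.exp_add]
  simp

end Ker

end

end SCBRW

namespace SCBRW

noncomputable section

open Ker

variable {d : ℕ}

/-! ### Recurrence -/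

/-- The translation invariant kernel with increments `k`. -/
def transKer (k : Site d → ℝ≥0∞) : Ker (Site d) := fun x y => k (y - x)

theorem transKer_pow_zero (k : Site d → ℝ≥0∞) (n : ℕ) (x : Site d) :
    (transKer k ^ n) 0 x = stepProb k n x := by
  induction n generalizing x with
  | zero =>
    rw [pow_zero, one_apply, stepProb]
    simp only [eq_comm]
  | succ n ih =>
    rw [pow_succ, mul_apply, stepProb]
    simp only [ih, transKer]

theorem act_transKer (k : Site d → ℝ≥0∞) (g : Site d → ℝ≥0∞) (x : Site d) :
    act (transKer k) g x = ∑' z, k z * g (x + z) := by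
  rw [act, ← (Equiv.addLeft x).tsum_eq]
  simp [transKer]

theorem act_transKer_add (k : Site d → ℝ≥0∞) (v : Site d) (g : Site d → ℝ≥0∞) (x : Site d) :
    act (transKer k) g (x + v) = act (transKer k) (g ∘ (· + v)) x := by
  simp only [act_transKer, Function.comp]
  refine tsum_congr fun z => ?_
  rw [add_right_comm]

theorem ker_eq_of_comp {X Y : Type*} {a : Ker X} {b : Ker Y} (u : Y → X) (hu : u.Injective)
    (h : ∀ (g : X → ℝ≥0∞) y, act a g (u y) = act b (g ∘ u) y) (x y : Y) :
    a (u x) (u y) = b x y := by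
  classical
  rw [← act_indicator a, h, ← act_indicator b]
  congr 1
  funext z
  simp [hu.eq_iff]

/-- Decomposition at the first return to the origin, which happens at time `p.1 + 1`. The last term
accounts for paths that have not returned by time `n + 1`. -/
theorem stepProb_succ_eq (k : Site d → ℝ≥0∞) (n : ℕ) (x : Site d) :
    stepProb k (n + 1) x = (∑ p ∈ Finset.HasAntidiagonal.antidiagonal n,
      tabooProb k p.1 0 * stepProb k p.2 x) + if x = 0 then 0 else tabooProb k n x := by
  induction n generalizing x with
  | zero =>
    have h : stepProb k 1 x = k x := by
      rw [stepProb, tsum_eq_single 0] <;> simp +contextual [stepProb]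
    rw [h]
    by_cases hx : x = 0 <;> simp [hx, stepProb, tabooProb]
  | succ n ih =>
    rw [stepProb]
    simp only [ih, add_mul, ENNReal.tsum_add, Finset.sum_mul]
    rw [Summable.tsum_finsetSum fun _ _ => ENNReal.summable, Finset.Nat.sum_antidiagonal_succ',
      add_comm (tabooProb k (n + 1, 0).1 0 * _), add_assoc]
    congr 1
    · refine Finset.sum_congr rfl fun p _ => ?_
      rw [stepProb, ← ENNReal.tsum_mul_left]
      simp only [mul_assoc]
    · have h : ∑' y, (if y = 0 then 0 else tabooProb k n y) * k (x - y) =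
          tabooProb k (n + 1) x := by
        rw [tabooProb]
        refine tsum_congr fun y => ?_
        split_ifs <;> simp
      rw [h]
      by_cases hx : x = 0 <;> simp [hx, stepProb]

/-- Renewal equation: the Green function `G` satisfies `G = 1 + F * G`, where `F` is the return
probability. With `F = 1` this excludes a finite `G`. -/
theorem tsum_stepProb_eq_top {k : Site d → ℝ≥0∞} (h : IsRecurrent k) :
    ∑' n, stepProb k n 0 = ∞ := by
  have h1 : ∑' n, stepProb k n 0 = 1 + ∑' n, stepProb k n 0 := by
    conv_lhs => rw [tsum_eq_zero_add' ENNReal.summable]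
    have h2 : stepProb k 0 0 = 1 := by simp [stepProb]
    rw [h2]
    congr 1
    simp only [stepProb_succ_eq, if_true, add_zero]
    rw [← tsum_tsum_eq_tsum_antidiagonal fun i j => tabooProb k i 0 * stepProb k j 0]
    simp only [ENNReal.tsum_mul_left, ENNReal.tsum_mul_right]
    rw [h, one_mul]
  by_contra hne
  have h3 : (1 : ℝ≥0∞) + ∑' n, stepProb k n 0 = 0 + ∑' n, stepProb k n 0 := by
    rw [zero_add]; exact h1.symm
  exact one_ne_zero ((ENNReal.add_left_inj hne).mp h3)

/-! ### The random walk in continuous time -/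

/-- Transition probabilities of the rate one continuous time walk with jump kernel `p`. -/
def walk (p : PMF (Site d)) : ℝ → Ker (Site d) := flow (transKer fun x => p x) fun _ => 1

variable (p : PMF (Site d))

theorem act_transKer_one (x : Site d) : act (transKer fun x => p x) (fun _ => 1) x = 1 := by
  rw [act_transKer]
  simp [p.tsum_coe]

theorem act_walk_one {t : ℝ} (ht : 0 ≤ t) (x : Site d) : act (walk p t) (fun _ => 1) x = 1 :=
  act_flow_one (fun _ => zero_le_one) (fun x => by rw [act_transKer_one, ENNReal.ofReal_one])
    (fun _ _ _ => rfl) ht x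

theorem walk_row_sum {t : ℝ} (ht : 0 ≤ t) (x : Site d) : ∑' y, walk p t x y = 1 := by
  have := act_walk_one p ht x
  simpa [act] using this

theorem walk_add {s t : ℝ} (hs : 0 ≤ s) (ht : 0 ≤ t) : walk p (s + t) = walk p s * walk p t :=
  flow_add (fun _ _ _ => rfl) s t hs ht

theorem walk_meas : TMeas (walk p) := flow_meas _ _

theorem walk_causal : Causal (walk p) := flow_causal _ _

theorem exp_smul_translate (k : Site d → ℝ≥0∞) (c : ℝ≥0∞) (v x y : Site d) :
    exp (c • transKer k) (x + v) (y + v) = exp (c • transKer k) x y := by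
  refine ker_eq_of_comp (fun x => x + v) (add_left_injective v) (fun g y => ?_) x y
  refine act_exp_comp _ _ (fun x => x + v) (fun g y => ?_) g y
  rw [act_smul_left, act_smul_left, act_transKer_add]

theorem walk_translate (t : ℝ) (v x y : Site d) : walk p t (x + v) (y + v) = walk p t x y := by
  by_cases ht : t < 0
  · simp [walk, flow, ht]
  · rw [walk, flow_of_nonneg _ _ (not_lt.mp ht), flow_of_nonneg _ _ (not_lt.mp ht),
      exp_smul_translate]

theorem walk_eq_zero_sub (t : ℝ) (x y : Site d) : walk p t x y = walk p t 0 (y - x) := by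
  rw [← walk_translate p t x 0 (y - x), zero_add, sub_add_cancel]

theorem walk_col_sum {t : ℝ} (ht : 0 ≤ t) (y : Site d) : ∑' x, walk p t x y = 1 := by
  rw [← walk_row_sum p ht 0, ← (Equiv.subLeft y).tsum_eq]
  refine tsum_congr fun x => ?_
  rw [walk_eq_zero_sub]
  simp

theorem walk_self_ge {t : ℝ} (ht : 0 ≤ t) (x : Site d) :
    ENNReal.ofReal (Real.exp (-t)) ≤ walk p t x x := by
  classical
  rw [← act_indicator (walk p t), walk, act_flow _ _ ht]
  refine le_trans ?_ (ENNReal.le_tsum 0)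
  simp [act_one, poissonWeight]

/-- The transposed walk. -/
theorem walk_transpose {t : ℝ} (ht : 0 ≤ t) (x : Site d) :
    walk p t x 0 = ENNReal.ofReal (Real.exp (-t)) *
      exp (ENNReal.ofReal t • transKer fun x => p (-x)) 0 x := by
  have h1 : walk p t x 0 = walk p t (-0) (-x) := by
    rw [walk_eq_zero_sub, zero_sub, neg_zero]
  rw [h1, walk, flow_of_nonneg _ _ ht, one_mul]
  congr 1
  refine ker_eq_of_comp (fun x => -x) neg_injective (fun g y => ?_) 0 x
  refine act_exp_comp _ _ (fun x => -x) (fun g y => ?_) g y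
  rw [act_smul_left, act_smul_left, act_transKer, act_transKer, ← (Equiv.neg _).tsum_eq]
  congr 1
  refine tsum_congr fun z => ?_
  simp [add_comm]

theorem commute_transKer (k l : Site d → ℝ≥0∞) : Commute (transKer k) (transKer l) := by
  refine commute_of_act fun g x => ?_
  simp only [act_transKer, ← ENNReal.tsum_mul_left]
  rw [ENNReal.tsum_comm]
  refine tsum_congr fun z => tsum_congr fun y => ?_
  rw [add_right_comm]
  ring

/-- This is where the symmetrised kernel enters. Read one factor as a reflected walk from `0` to `x`
and the other as a walk from `x` back to `0`. Translation invariant kernels commute, so the product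
of the two exponentials is the exponential of twice the symmetrised kernel. -/
theorem tsum_walk_sq {t : ℝ} (ht : 0 ≤ t) : ∑' x, walk p t x 0 * walk p t x 0 =
    ∑' n, ENNReal.ofReal (poissonWeight 2 t n) * (2 ^ n * stepProb (symmetrised p) n 0) := by
  have h1 : ∀ x, walk p t x 0 * walk p t x 0 = ENNReal.ofReal (Real.exp (-(2 * t))) *
      (exp (ENNReal.ofReal t • transKer fun x => p (-x)) 0 x *
        exp (ENNReal.ofReal t • transKer fun x => p x) x 0) := by
    intro x
    conv_lhs => enter [1]; rw [walk_transpose p ht]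
    rw [walk, flow_of_nonneg _ _ ht, one_mul, mul_mul_mul_comm,
      ← ENNReal.ofReal_mul (Real.exp_pos _).le, ← Real.exp_add]
    congr 3
    ring
  simp only [h1]
  rw [ENNReal.tsum_mul_left, ← mul_apply, ← exp_add (commute_smul_smul (commute_transKer _ _) _ _),
    ← smul_add]
  have h2 : (transKer fun x => p (-x)) + (transKer fun x => p x) =
      (2 : ℝ≥0∞) • transKer (symmetrised p) := by
    ext x y
    rw [add_apply, smul_apply]
    simp only [transKer, symmetrised]
    rw [ENNReal.mul_div_cancel two_ne_zero ENNReal.ofNat_ne_top, add_comm]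
  rw [h2]
  classical
  rw [← act_indicator (exp _), ← act_flow' _ (fun _ => 2) ht, act_flow _ _ ht]
  refine tsum_congr fun n => ?_
  rw [smul_pow, act_smul_left, act_indicator, transKer_pow_zero]

/-- The Gamma integral of `e^{-2s} s^n / n!`, obtained by recursion from the equations of the
Poisson weights. -/
theorem tendsto_lintegral_poissonWeight (n : ℕ) :
    Tendsto (fun t => ∫⁻ s in Set.Icc 0 t, ENNReal.ofReal (poissonWeight 2 s n)) atTop
      (𝓝 ((2 ^ (n + 1))⁻¹)) := by
  have hlim : ∀ n, Tendsto (fun t => ENNReal.ofReal (poissonWeight 2 t n)) atTop (𝓝 0) := by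
    intro n
    rw [← ENNReal.ofReal_zero]
    refine (ENNReal.continuous_ofReal.tendsto 0).comp ?_
    have h := (Real.tendsto_pow_mul_exp_neg_atTop_nhds_zero n).comp
      (tendsto_id.const_mul_atTop (zero_lt_two (α := ℝ)))
    have h' := h.div_const ((2 : ℝ) ^ n * n.factorial)
    rw [zero_div] at h'
    refine h'.congr fun t => ?_
    simp only [Function.comp, id, poissonWeight, mul_pow]
    field_simp
  have h2 : ENNReal.ofReal 2 = 2 := by simp
  induction n with
  | zero =>
    have h : Tendsto (fun t : ℝ => (2 : ℝ≥0∞)⁻¹ * (1 - ENNReal.ofReal (poissonWeight 2 t 0))) atTop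
        (𝓝 ((2 : ℝ≥0∞)⁻¹ * (1 - 0))) :=
      ENNReal.Tendsto.const_mul (ENNReal.Tendsto.sub tendsto_const_nhds (hlim 0)
        (Or.inl ENNReal.one_ne_top)) (Or.inr (by simp))
    rw [tsub_zero, mul_one] at h
    rw [zero_add, pow_one]
    refine h.congr' ?_
    filter_upwards [eventually_ge_atTop 0] with t ht
    have h3 := poissonWeight_zero_add (a := 2) (by norm_num) ht
    rw [h2] at h3
    rw [← h3, ENNReal.add_sub_cancel_left ENNReal.ofReal_ne_top, ← mul_assoc,
      ENNReal.inv_mul_cancel two_ne_zero ENNReal.ofNat_ne_top, one_mul]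
  | succ n ih =>
    have h : Tendsto (fun t : ℝ => (2 : ℝ≥0∞)⁻¹ * ((∫⁻ s in Set.Icc 0 t,
        ENNReal.ofReal (poissonWeight 2 s n)) - ENNReal.ofReal (poissonWeight 2 t (n + 1)))) atTop
        (𝓝 ((2 : ℝ≥0∞)⁻¹ * ((2 ^ (n + 1))⁻¹ - 0))) :=
      ENNReal.Tendsto.const_mul (ENNReal.Tendsto.sub ih (hlim (n + 1))
        (Or.inr (by simp))) (Or.inr (by simp))
    rw [tsub_zero, ← ENNReal.mul_inv (Or.inl two_ne_zero) (Or.inl ENNReal.ofNat_ne_top),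
      ← pow_succ'] at h
    refine h.congr' ?_
    filter_upwards [eventually_ge_atTop 0] with t ht
    have h3 := poissonWeight_succ_add (a := 2) (by norm_num) ht n
    rw [h2] at h3
    rw [← h3, ENNReal.add_sub_cancel_left ENNReal.ofReal_ne_top, ← mul_assoc,
      ENNReal.inv_mul_cancel two_ne_zero ENNReal.ofNat_ne_top, one_mul]

/-- As `t → ∞`, the `n`-th term of the series in `tsum_walk_sq` integrates to half of the `n`-th
term of the Green function of the symmetrised walk, whose sum is infinite by recurrence. -/
theorem exists_lintegral_walk_sq_ge (hrec : IsRecurrent (symmetrised p)) {C : ℝ≥0∞} (hC : C ≠ ∞) :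
    ∃ t, 0 ≤ t ∧ C ≤ ∫⁻ s in Set.Icc 0 t, ∑' x, walk p s x 0 * walk p s x 0 := by
  by_contra! hcon
  have h1 : ∀ N, ∑ n ∈ Finset.range N, 2⁻¹ * stepProb (symmetrised p) n 0 ≤ C := by
    intro N
    have hlim : Tendsto (fun t => ∑ n ∈ Finset.range N,
        (∫⁻ s in Set.Icc 0 t, ENNReal.ofReal (poissonWeight 2 s n)) *
          (2 ^ n * stepProb (symmetrised p) n 0)) atTop
        (𝓝 (∑ n ∈ Finset.range N, (2 ^ (n + 1))⁻¹ * (2 ^ n * stepProb (symmetrised p) n 0))) := by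
      refine tendsto_finsetSum _ fun n _ => ?_
      refine ENNReal.Tendsto.mul_const (tendsto_lintegral_poissonWeight n) (Or.inl ?_)
      simp
    have h2 : ∀ n, ((2 : ℝ≥0∞) ^ (n + 1))⁻¹ * (2 ^ n * stepProb (symmetrised p) n 0) =
        2⁻¹ * stepProb (symmetrised p) n 0 := by
      intro n
      rw [pow_succ', ENNReal.mul_inv (Or.inl two_ne_zero) (Or.inl ENNReal.ofNat_ne_top), mul_assoc,
        ← mul_assoc (_ ^ n)⁻¹, ENNReal.inv_mul_cancel (by simp) (by simp), one_mul]
    simp only [h2] at hlim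
    refine le_of_tendsto hlim ?_
    filter_upwards [eventually_ge_atTop 0] with t ht
    refine le_trans ?_ (hcon t ht).le
    rw [setLIntegral_congr_fun measurableSet_Icc fun s hs => tsum_walk_sq p hs.1,
      lintegral_tsum fun n => ((poissonWeight_continuous _ _).measurable.ennreal_ofReal.mul_const
        _).aemeasurable]
    refine le_trans (le_of_eq ?_) (ENNReal.sum_le_tsum (Finset.range N))
    refine Finset.sum_congr rfl fun n _ => ?_
    rw [lintegral_mul_const _ (poissonWeight_continuous _ _).measurable.ennreal_ofReal]
  have h3 : ∑' n, 2⁻¹ * stepProb (symmetrised p) n 0 ≤ C := by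
    rw [ENNReal.tsum_eq_iSup_nat]
    exact iSup_le h1
  rw [ENNReal.tsum_mul_left, tsum_stepProb_eq_top hrec] at h3
  simp at h3
  exact hC h3

end

end SCBRW

namespace SCBRW

noncomputable section

open Ker

variable {d : ℕ}

/-! ### Merging of the walk -/

theorem poissonWeight_succ_mul (l : ℝ) (k : ℕ) :
    poissonWeight 1 l (k + 1) * ((k + 1 : ℕ) : ℝ) = l * poissonWeight 1 l k := by
  unfold poissonWeight
  rw [Nat.factorial_succ, Nat.cast_mul]
  have h1 : ((k + 1 : ℕ) : ℝ) ≠ 0 := by positivity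
  have h2 : (k.factorial : ℝ) ≠ 0 := by positivity
  field_simp
  ring

theorem ofReal_poissonWeight (a : ℝ) {t : ℝ} (ht : 0 ≤ t) (k : ℕ) :
    ENNReal.ofReal (poissonWeight a t k) =
      ENNReal.ofReal (Real.exp (-(a * t))) * ((k.factorial : ℝ≥0∞)⁻¹ * ENNReal.ofReal t ^ k) := by
  rw [poissonWeight, ENNReal.ofReal_mul (Real.exp_pos _).le, div_eq_inv_mul,
    ENNReal.ofReal_mul (by positivity), ENNReal.ofReal_inv_of_pos
    (by exact_mod_cast k.factorial_pos), ENNReal.ofReal_natCast, ENNReal.ofReal_pow ht]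

theorem hasSum_poissonWeight (l : ℝ) : HasSum (poissonWeight 1 l) 1 := by
  have h : HasSum (fun n : ℕ => l ^ n / n.factorial) (Real.exp l) := by
    rw [Real.exp_eq_exp_ℝ]
    exact NormedSpace.expSeries_div_hasSum_exp l
  have h' := h.mul_left (Real.exp (-(1 * l)))
  rw [← Real.exp_add] at h'
  unfold poissonWeight
  simpa using h'

theorem hasSum_poissonWeight_mul (l : ℝ) : HasSum (fun k => poissonWeight 1 l k * k) l := by
  rw [← hasSum_nat_add_iff' 1]
  simp only [poissonWeight_succ_mul]
  simpa using (hasSum_poissonWeight l).mul_left l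

theorem hasSum_poissonWeight_mul_sub (l : ℝ) :
    HasSum (fun k : ℕ => poissonWeight 1 l k * k * (k - 1)) (l ^ 2) := by
  rw [← hasSum_nat_add_iff' 1]
  simp only [poissonWeight_succ_mul]
  have h := (hasSum_poissonWeight_mul l).mul_left l
  simpa [mul_assoc, sq] using h

/-- Here `q'` is the Poisson law of mean `l` shifted by one, and its ratio to the unshifted law is
`k / l`. The bound `u ≤ δ/2 + u²/(2δ)` with `u = 1 - k/l` leaves the variance of `k / l`, which is
`1 / l`. -/
theorem tsum_poissonWeight_sub_le {l δ : ℝ} (hl : 0 < l) (hδ : 0 < δ) (q' : ℕ → ℝ≥0∞)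
    (hq0 : q' 0 = 0) (hq : ∀ k, q' (k + 1) = ENNReal.ofReal (poissonWeight 1 l k)) :
    ∑' k, (ENNReal.ofReal (poissonWeight 1 l k) - q' k) ≤
      ENNReal.ofReal (δ / 2 + 1 / (2 * δ * l)) := by
  have h1 : ∀ k, q' k = ENNReal.ofReal (poissonWeight 1 l k * k / l) := by
    intro k
    cases k with
    | zero => simp [hq0]
    | succ k =>
      rw [hq, poissonWeight_succ_mul, mul_div_cancel_left₀ _ hl.ne']
  have h2 : HasSum (fun k : ℕ => poissonWeight 1 l k * (δ / 2 + (1 - k / l) ^ 2 / (2 * δ)))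
      (δ / 2 + 1 / (2 * δ * l)) := by
    have h := (((hasSum_poissonWeight l).mul_left (δ / 2 + 1 / (2 * δ))).add
      ((hasSum_poissonWeight_mul l).mul_left ((1 / l ^ 2 - 2 / l) / (2 * δ)))).add
      ((hasSum_poissonWeight_mul_sub l).mul_left (1 / l ^ 2 / (2 * δ)))
    have he : (δ / 2 + 1 / (2 * δ)) * 1 + (1 / l ^ 2 - 2 / l) / (2 * δ) * l +
        1 / l ^ 2 / (2 * δ) * l ^ 2 = δ / 2 + 1 / (2 * δ * l) := by
      field_simp
      ring
    rw [he] at h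
    refine h.congr_fun fun k => ?_
    field_simp
    ring
  rw [← h2.tsum_eq, ENNReal.ofReal_tsum_of_nonneg
    (fun k => mul_nonneg (poissonWeight_nonneg 1 hl.le k) (by positivity)) h2.summable]
  refine ENNReal.tsum_le_tsum fun k => ?_
  rw [h1, ← ENNReal.ofReal_sub _ (div_nonneg (mul_nonneg (poissonWeight_nonneg 1 hl.le k)
    (Nat.cast_nonneg k)) hl.le)]
  refine ENNReal.ofReal_le_ofReal ?_
  rw [mul_div_assoc, ← mul_one_sub]
  refine mul_le_mul_of_nonneg_left ?_ (poissonWeight_nonneg 1 hl.le k)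
  have h3 : 0 ≤ (δ - (1 - k / l)) ^ 2 / (2 * δ) := by positivity
  have h4 : (δ - (1 - k / l)) ^ 2 / (2 * δ) = δ / 2 + (1 - k / l) ^ 2 / (2 * δ) - (1 - k / l) := by
    field_simp
    ring
  linarith

variable (p : PMF (Site d))

/-- Total variation type distance between the walk and its translate by `v`. -/
def walkDiff (t : ℝ) (v : Site d) : ℝ≥0∞ := ∑' u, (walk p t 0 u - walk p t 0 (u - v))

theorem act_shift_pow (v : Site d) (n : ℕ) (g : Site d → ℝ≥0∞) (x : Site d) :
    act (transKer (fun y => if y = v then 1 else 0) ^ n) g x = g (x + n • v) := by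
  induction n generalizing x with
  | zero => simp [act_one]
  | succ n ih =>
    rw [pow_succ', act_mul, act_transKer, tsum_eq_single v]
    · simp only [if_true, one_mul, ih]
      congr 1
      rw [succ_nsmul]
      abel
    · intro y hy
      simp [hy]

/-- The number of jumps equal to `v` is Poisson and independent of all other jumps; `H` is the law
of the displacement by the others. -/
theorem exists_walk_mixture {v : Site d} {t : ℝ} (ht : 0 ≤ t) :
    ∃ H : Site d → Site d → ℝ≥0∞, (∀ x, ∑' y, H x y = 1) ∧
      (∀ x y w, H (x + w) (y + w) = H x y) ∧ ∀ u, walk p t 0 u =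
        ∑' k : ℕ, ENNReal.ofReal (poissonWeight 1 ((p v).toReal * t) k) * H (k • v) u := by
  classical
  set a : ℝ := (p v).toReal with ha
  have ha0 : 0 ≤ a := ENNReal.toReal_nonneg
  have hpv : p v = ENNReal.ofReal a := (ENNReal.ofReal_toReal (p.apply_ne_top v)).symm
  have ha1 : a ≤ 1 := by
    have := ENNReal.toReal_mono ENNReal.one_ne_top (p.coe_le_one v)
    simpa using this
  set r : Site d → ℝ≥0∞ := fun x => if x = v then 0 else p x with hr
  set e : Site d → ℝ≥0∞ := fun x => if x = v then 1 else 0 with he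
  have hp : (transKer fun x => p x) = p v • transKer e + transKer r := by
    ext x y
    rw [add_apply, smul_apply]
    simp only [transKer, he, hr]
    by_cases h : y - x = v <;> simp [h]
  have hsum : ∑' x, r x = ENNReal.ofReal (1 - a) := by
    have h1 := p.tsum_coe
    rw [ENNReal.tsum_eq_add_tsum_ite v] at h1
    have h2 : p v ≠ ∞ := p.apply_ne_top v
    have h3 : ∑' x, r x = 1 - p v := by
      rw [← h1, ENNReal.add_sub_cancel_left h2]
      exact tsum_congr fun x => by simp only [hr]; split_ifs <;> rfl
    rw [h3, ENNReal.ofReal_sub _ ha0, ENNReal.ofReal_one, hpv]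
  have hR : ∀ x, act (ENNReal.ofReal t • transKer r) (fun _ => 1) x =
      ENNReal.ofReal ((1 - a) * t) := by
    intro x
    rw [act_smul_left, act_transKer]
    simp only [mul_one]
    rw [hsum, ← ENNReal.ofReal_mul ht, mul_comm]
  refine ⟨fun x y => ENNReal.ofReal (Real.exp (-((1 - a) * t))) *
    exp (ENNReal.ofReal t • transKer r) x y, fun x => ?_, fun x y w => ?_, fun u => ?_⟩
  · have h1 := act_exp_const (mul_nonneg (by linarith) ht) hR x
    rw [act] at h1
    simp only [mul_one] at h1
    rw [ENNReal.tsum_mul_left, h1, ← ENNReal.ofReal_mul (Real.exp_pos _).le, ← Real.exp_add]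
    simp
  · simp only [exp_smul_translate]
  · rw [walk, flow_of_nonneg _ _ ht, hp, smul_add, exp_add (commute_smul_smul
      ((commute_transKer _ _).smul_left _) _ _), mul_apply]
    change _ * act (exp (ENNReal.ofReal t • p v • transKer e))
      (fun y => exp (ENNReal.ofReal t • transKer r) y u) 0 = _
    rw [act_exp, ← ENNReal.tsum_mul_left]
    refine tsum_congr fun k => ?_
    rw [smul_smul, smul_pow, act_smul_left, act_shift_pow, zero_add, hpv,
      ← ENNReal.ofReal_mul ht, ofReal_poissonWeight _ (mul_nonneg ha0 ht), mul_comm t a]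
    have h1 : ENNReal.ofReal (Real.exp (-(1 * t))) =
        ENNReal.ofReal (Real.exp (-(1 * (a * t)))) * ENNReal.ofReal (Real.exp (-((1 - a) * t))) := by
      rw [← ENNReal.ofReal_mul (Real.exp_pos _).le, ← Real.exp_add]
      congr 2
      ring
    rw [h1]
    ring

/-- Translating the walk by `v` amounts to one more jump `v`, that is, to shifting the Poisson
number of such jumps by one. -/
theorem walkDiff_le {v : Site d} {t δ : ℝ} (hv : p v ≠ 0) (ht : 0 < t) (hδ : 0 < δ) :
    walkDiff p t v ≤ ENNReal.ofReal (δ / 2 + 1 / (2 * δ * ((p v).toReal * t))) := by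
  obtain ⟨H, hH1, hH2, hH3⟩ := exists_walk_mixture p (v := v) ht.le
  have hl : 0 < (p v).toReal * t := mul_pos (ENNReal.toReal_pos hv (p.apply_ne_top v)) ht
  set l := (p v).toReal * t with hldef
  set q' : ℕ → ℝ≥0∞ := fun k => Nat.casesOn k 0 fun k => ENNReal.ofReal (poissonWeight 1 l k)
    with hq'
  refine le_trans ?_ (tsum_poissonWeight_sub_le hl hδ q' rfl fun k => rfl)
  have h1 : ∀ u, walk p t 0 u - walk p t 0 (u - v) ≤
      ∑' k : ℕ, (ENNReal.ofReal (poissonWeight 1 l k) - q' k) * H (k • v) u := by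
    intro u
    rw [tsub_le_iff_right]
    have h2 : walk p t 0 (u - v) = ∑' k : ℕ, q' k * H (k • v) u := by
      rw [hH3, tsum_eq_zero_add' (f := fun k : ℕ => q' k * H (k • v) u) ENNReal.summable]
      have h3 : q' 0 * H (0 • v) u = 0 := zero_mul _
      rw [h3, zero_add]
      refine tsum_congr fun k => ?_
      rw [← hH2 _ (u - v) v, sub_add_cancel, succ_nsmul]
    rw [h2, hH3, ← ENNReal.tsum_add]
    refine ENNReal.tsum_le_tsum fun k => ?_
    rw [← add_mul]
    exact mul_le_mul_left le_tsub_add _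
  refine (ENNReal.tsum_le_tsum h1).trans ?_
  rw [ENNReal.tsum_comm]
  simp only [ENNReal.tsum_mul_left, hH1, mul_one, le_refl]

theorem walkDiff_add_le (t : ℝ) (v w : Site d) :
    walkDiff p t (v + w) ≤ walkDiff p t v + walkDiff p t w := by
  have h : walkDiff p t w = ∑' u, (walk p t 0 (u - v) - walk p t 0 (u - v - w)) :=
    ((Equiv.subRight v).tsum_eq fun u => walk p t 0 u - walk p t 0 (u - w)).symm
  rw [h, walkDiff, walkDiff, ← ENNReal.tsum_add]
  refine ENNReal.tsum_le_tsum fun u => ?_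
  rw [← sub_sub]
  exact tsub_le_tsub_add_tsub

theorem tendsto_walkDiff_of_pos {v : Site d} (hv : p v ≠ 0) :
    Tendsto (fun t => walkDiff p t v) atTop (𝓝 0) := by
  have ha : 0 < (p v).toReal := ENNReal.toReal_pos hv (p.apply_ne_top v)
  have hlim : Tendsto (fun t : ℝ => ENNReal.ofReal ((Real.sqrt ((p v).toReal * t))⁻¹)) atTop
      (𝓝 0) := by
    rw [← ENNReal.ofReal_zero]
    exact (ENNReal.continuous_ofReal.tendsto 0).comp (tendsto_inv_atTop_zero.comp
      (Real.tendsto_sqrt_atTop.comp (tendsto_id.const_mul_atTop ha)))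
  refine tendsto_of_tendsto_of_tendsto_of_le_of_le' tendsto_const_nhds hlim
    (Eventually.of_forall fun _ => zero_le) ?_
  filter_upwards [eventually_gt_atTop 0] with t ht
  have hl : 0 < (p v).toReal * t := mul_pos ha ht
  -- The choice `δ = l^{-1/2}`, with `l` the mean number of jumps `v`, balances the two terms and
  -- gives exactly `l^{-1/2}`.
  refine (walkDiff_le p hv ht (inv_pos.mpr (Real.sqrt_pos.mpr hl))).trans
    (ENNReal.ofReal_le_ofReal (le_of_eq ?_))
  have h1 := Real.sqrt_pos.mpr hl
  have h2 := Real.mul_self_sqrt hl.le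
  nth_rewrite 3 [← h2]
  field_simp
  ring

/-- By irreducibility `v` is a sum of steps of positive probability; each is handled by
`tendsto_walkDiff_of_pos`, and the triangle inequality adds them up. -/
theorem tendsto_walkDiff (hirr : IsIrreducible fun x => p x) (v : Site d) :
    Tendsto (fun t => walkDiff p t v) atTop (𝓝 0) := by
  obtain ⟨n, hn⟩ := hirr 0 v
  rw [sub_zero] at hn
  induction n generalizing v with
  | zero =>
    have hv : v = 0 := by
      by_contra h
      simp [stepProb, h] at hn
    subst hv
    simp [walkDiff]
  | succ n ih =>
    rw [stepProb] at hn
    have : ∃ y, stepProb (fun x => p x) n y * p (v - y) ≠ 0 := by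
      by_contra! hall
      simp [hall] at hn
    obtain ⟨y, hy⟩ := this
    have h1 := ih y (pos_iff_ne_zero.mpr (left_ne_zero_of_mul hy))
    have h2 := tendsto_walkDiff_of_pos p (right_ne_zero_of_mul hy)
    have h3 := h1.add h2
    rw [add_zero] at h3
    refine tendsto_of_tendsto_of_tendsto_of_le_of_le tendsto_const_nhds h3 (fun _ => zero_le) ?_
    intro t
    have := walkDiff_add_le p t y (v - y)
    rwa [add_sub_cancel] at this

theorem walk_le_add_walkDiff (t : ℝ) (u v : Site d) :
    walk p t 0 u ≤ walk p t 0 (u - v) + walkDiff p t v := by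
  rw [← tsub_le_iff_left]
  exact ENNReal.le_tsum (f := fun u => walk p t 0 u - walk p t 0 (u - v)) u

/-- The walk spreads out. -/
theorem eventually_walk_le (hd : 1 ≤ d) (hirr : IsIrreducible fun x => p x) {ε : ℝ≥0∞}
    (hε : ε ≠ 0) : ∀ᶠ t in atTop, ∀ x y, walk p t x y ≤ ε := by
  obtain ⟨N, hN⟩ := ENNReal.exists_inv_nat_lt (ENNReal.half_pos hε).ne'
  have hN0 : N ≠ 0 := by
    rintro rfl
    simp at hN
  -- The multiples of `e` are distinct because `d ≥ 1`. The probabilities of `N` distinct translates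
  -- of a point sum to at most one and differ little from each other at late times, so each is at
  -- most about `1 / N`.
  set e : Site d := fun _ => 1 with he
  have hinj : Function.Injective fun j : ℕ => j • e := by
    intro i j hij
    have := congrFun hij ⟨0, hd⟩
    simpa [he] using this
  have h1 : ∀ᶠ t in atTop, ∀ j ∈ Finset.range N, walkDiff p t (j • e) ≤ ε / 2 := by
    rw [Filter.eventually_all_finset]
    intro j _
    exact (tendsto_walkDiff p hirr (j • e)).eventually (ge_mem_nhds (ENNReal.half_pos hε))
  filter_upwards [h1, eventually_ge_atTop 0] with t ht ht0 x y
  rw [walk_eq_zero_sub]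
  generalize y - x = u
  have h2 : (N : ℝ≥0∞) * walk p t 0 u ≤ 1 + N * (ε / 2) := by
    calc (N : ℝ≥0∞) * walk p t 0 u = ∑ j ∈ Finset.range N, walk p t 0 u := by simp
      _ ≤ ∑ j ∈ Finset.range N, (walk p t 0 (u - j • e) + ε / 2) := by
        refine Finset.sum_le_sum fun j hj => ?_
        exact (walk_le_add_walkDiff p t u (j • e)).trans (add_le_add le_rfl (ht j hj))
      _ = ∑ j ∈ Finset.range N, walk p t 0 (u - j • e) + N * (ε / 2) := by
        rw [Finset.sum_add_distrib]; simp
      _ ≤ 1 + N * (ε / 2) := by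
        refine add_le_add ?_ le_rfl
        rw [← walk_row_sum p ht0 0]
        have hinj' : Function.Injective fun j : ℕ => u - j • e := fun i j hij =>
          hinj (sub_right_injective hij)
        have := ENNReal.tsum_comp_le_tsum_of_injective hinj' (walk p t 0)
        exact (ENNReal.sum_le_tsum _).trans this
  have hNtop : (N : ℝ≥0∞) ≠ ∞ := ENNReal.natCast_ne_top N
  have hN0' : (N : ℝ≥0∞) ≠ 0 := by exact_mod_cast hN0
  calc walk p t 0 u = (N : ℝ≥0∞)⁻¹ * (N * walk p t 0 u) := by
        rw [← mul_assoc, ENNReal.inv_mul_cancel hN0' hNtop, one_mul]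
    _ ≤ (N : ℝ≥0∞)⁻¹ * (1 + N * (ε / 2)) := mul_le_mul_right h2 _
    _ = (N : ℝ≥0∞)⁻¹ + ε / 2 := by
        rw [mul_add, mul_one, ← mul_assoc, ENNReal.inv_mul_cancel hN0' hNtop, one_mul]
    _ ≤ ε / 2 + ε / 2 := add_le_add hN.le le_rfl
    _ = ε := ENNReal.add_halves ε

end

end SCBRW

namespace SCBRW

noncomputable section

/-! ### Kernels acting on one coordinate of a product -/

namespace Ker

variable {X Y : Type*}

open Classical in
/-- The kernel that acts on the first coordinate. -/
def onFst (k : Ker X) : Ker (X × Y) := fun a b => if a.2 = b.2 then k a.1 b.1 else 0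

open Classical in
/-- The kernel that acts on the second coordinate. -/
def onSnd (k : Ker Y) : Ker (X × Y) := fun a b => if a.1 = b.1 then k a.2 b.2 else 0

theorem act_onFst (k : Ker X) (g : X × Y → ℝ≥0∞) (a : X × Y) :
    act (onFst k) g a = act k (fun x => g (x, a.2)) a.1 := by
  rw [act, ENNReal.tsum_prod', act]
  refine tsum_congr fun x => ?_
  rw [tsum_eq_single a.2]
  · simp [onFst]
  · intro y hy
    simp [onFst, hy.symm]

theorem act_onSnd (k : Ker Y) (g : X × Y → ℝ≥0∞) (a : X × Y) :
    act (onSnd k) g a = act k (fun y => g (a.1, y)) a.2 := by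
  rw [act, ENNReal.tsum_prod', ENNReal.tsum_comm, act]
  refine tsum_congr fun y => ?_
  rw [tsum_eq_single a.1]
  · simp [onSnd]
  · intro x hx
    simp [onSnd, hx.symm]

theorem act_act_swap (k : Ker X) (l : Ker Y) (g : X → Y → ℝ≥0∞) (x : X) (y : Y) :
    act k (fun x => act l (g x) y) x = act l (fun y => act k (fun x => g x y) x) y := by
  simp only [act, ← ENNReal.tsum_mul_left]
  rw [ENNReal.tsum_comm]
  exact tsum_congr fun _ => tsum_congr fun _ => by ring

theorem commute_onFst_onSnd (k : Ker X) (l : Ker Y) : Commute (onFst k) (onSnd l) := by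
  refine commute_of_act fun g a => ?_
  have h1 : act (onSnd l) g = fun a : X × Y => act l (fun y => g (a.1, y)) a.2 := by
    funext a; exact act_onSnd l g a
  have h2 : act (onFst k) g = fun a : X × Y => act k (fun x => g (x, a.2)) a.1 := by
    funext a; exact act_onFst k g a
  rw [h1, h2, act_onFst, act_onSnd]
  exact act_act_swap k l (fun x y => g (x, y)) a.1 a.2

theorem act_exp_onFst (k : Ker X) (c : ℝ≥0∞) (g : X × Y → ℝ≥0∞) (a : X × Y) :
    act (exp (c • onFst k)) g a = act (exp (c • k)) (fun x => g (x, a.2)) a.1 := by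
  refine act_exp_comp (c • onFst k) (c • k) (fun x => (x, a.2)) (fun g x => ?_) g a.1
  rw [act_smul_left, act_smul_left, act_onFst]
  rfl

theorem act_exp_onSnd (k : Ker Y) (c : ℝ≥0∞) (g : X × Y → ℝ≥0∞) (a : X × Y) :
    act (exp (c • onSnd k)) g a = act (exp (c • k)) (fun y => g (a.1, y)) a.2 := by
  refine act_exp_comp (c • onSnd k) (c • k) (fun y => (a.1, y)) (fun g x => ?_) g a.2
  rw [act_smul_left, act_smul_left, act_onSnd]
  rfl

end Ker

open Ker

/-! ### Independent motion of the particles -/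

variable {d : ℕ} (p : PMF (Site d))

/-- The rates of the independent motion of the particles. -/
def jumpKer : Ker (FinConfig d) := fun ξ ζ =>
  ∑ x ∈ ξ.support, (ξ x : ℝ≥0∞) * ∑' y, if move ξ x y = ζ then p (y - x) else 0

theorem act_jumpKer (g : FinConfig d → ℝ≥0∞) (ξ : FinConfig d) :
    act (jumpKer p) g ξ =
      ∑ x ∈ ξ.support, (ξ x : ℝ≥0∞) * ∑' y, p (y - x) * g (move ξ x y) := by
  classical
  simp only [act, jumpKer, Finset.sum_mul]
  rw [Summable.tsum_finsetSum fun _ _ => ENNReal.summable]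
  refine Finset.sum_congr rfl fun x _ => ?_
  simp only [mul_assoc, ENNReal.tsum_mul_left]
  congr 1
  simp only [← ENNReal.tsum_mul_right]
  rw [ENNReal.tsum_comm]
  refine tsum_congr fun y => ?_
  rw [tsum_eq_single (move ξ x y)]
  · simp
  · intro ζ hζ
    simp [hζ.symm]

theorem addAt_apply (ξ : FinConfig d) (x z : Site d) :
    addAt ξ x z = ξ z + if x = z then 1 else 0 := by
  simp [addAt, Finsupp.single_apply]

theorem removeAt_apply (ξ : FinConfig d) (x z : Site d) :
    removeAt ξ x z = ξ z - if x = z then 1 else 0 := by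
  simp [removeAt, Finsupp.single_apply, Finsupp.tsub_apply]

theorem move_apply (ξ : FinConfig d) (x y z : Site d) :
    move ξ x y z = ξ z + (if y = z then 1 else 0) - if x = z then 1 else 0 := by
  simp [move, Finsupp.single_apply, Finsupp.tsub_apply]

theorem addAt_comm (ξ : FinConfig d) (x y : Site d) :
    addAt (addAt ξ x) y = addAt (addAt ξ y) x := by
  simp only [addAt, add_right_comm]

theorem removeAt_addAt (ξ : FinConfig d) (x : Site d) : removeAt (addAt ξ x) x = ξ := by
  simp [addAt, removeAt]

theorem addAt_removeAt {ξ : FinConfig d} {x : Site d} (h : ξ x ≠ 0) :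
    addAt (removeAt ξ x) x = ξ := by
  ext z
  rw [addAt_apply, removeAt_apply]
  split_ifs with hz
  · subst hz; omega
  · simp

theorem move_addAt_self (ξ : FinConfig d) (x y : Site d) : move (addAt ξ x) x y = addAt ξ y := by
  ext z
  simp only [move_apply, addAt_apply]
  omega

theorem move_addAt {ξ : FinConfig d} {z : Site d} (hz : ξ z ≠ 0) (x y : Site d) :
    move (addAt ξ x) z y = addAt (move ξ z y) x := by
  ext w
  simp only [move_apply, addAt_apply]
  by_cases h : z = w
  · subst h; simp only [if_true]; omega
  · simp only [h, if_false]; omega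

theorem move_eq_addAt_removeAt {ξ : FinConfig d} {x : Site d} (hx : ξ x ≠ 0) (y : Site d) :
    move ξ x y = addAt (removeAt ξ x) y := by
  conv_lhs => rw [← addAt_removeAt hx]
  rw [move_addAt_self]

/-- The jump rates are linear in the configuration, so an extra particle contributes its own
generator and leaves that of the others unchanged. -/
theorem act_jumpKer_addAt (g : FinConfig d → ℝ≥0∞) (ξ : FinConfig d) (x : Site d) :
    act (jumpKer p) g (addAt ξ x) =
      ∑' y, p (y - x) * g (addAt ξ y) + act (jumpKer p) (fun ζ => g (addAt ζ x)) ξ := by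
  classical
  rw [act_jumpKer, act_jumpKer]
  set h : Site d → ℝ≥0∞ := fun z => ∑' y, p (y - z) * g (move (addAt ξ x) z y) with hh
  have h1 : ∑ z ∈ (addAt ξ x).support, (addAt ξ x z : ℝ≥0∞) * h z =
      (addAt ξ x).sum fun z n => (n : ℝ≥0∞) * h z := rfl
  rw [h1, addAt, Finsupp.sum_add_index' (by simp) (by intros; push_cast; ring),
    Finsupp.sum_single_index (by simp), add_comm]
  congr 1
  · simp only [Nat.cast_one, one_mul, hh, move_addAt_self]
  · refine Finset.sum_congr rfl fun z hz => ?_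
    simp only [hh]
    congr 1
    refine tsum_congr fun y => ?_
    rw [move_addAt (Finsupp.mem_support_iff.mp hz)]

theorem degree_addAt (ξ : FinConfig d) (x : Site d) : (addAt ξ x).degree = ξ.degree + 1 := by
  simp [addAt]

theorem jumpKer_degree (ξ ζ : FinConfig d) (h : jumpKer p ξ ζ ≠ 0) : ζ.degree = ξ.degree := by
  classical
  obtain ⟨x, hx, h1⟩ := Finset.exists_ne_zero_of_sum_ne_zero h
  have h2 : ∃ y, (if move ξ x y = ζ then p (y - x) else 0) ≠ 0 := by
    by_contra! hall
    simp [hall] at h1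
  obtain ⟨y, hy⟩ := h2
  have h3 : move ξ x y = ζ := by
    by_contra hne
    simp [hne] at hy
  have hx' := Finsupp.mem_support_iff.mp hx
  rw [← h3, move_eq_addAt_removeAt hx', degree_addAt]
  conv_rhs => rw [← addAt_removeAt hx', degree_addAt]

/-- The semigroup of independent motion, with all rates killed at rate `c`. -/
def motion (c : ℝ) : ℝ → Ker (FinConfig d) := flow (jumpKer p) fun ξ => (ξ.degree : ℝ) + c

theorem jumpKer_invariant (c : ℝ) (ξ ζ : FinConfig d) (h : jumpKer p ξ ζ ≠ 0) :
    (ζ.degree : ℝ) + c = (ξ.degree : ℝ) + c := by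
  rw [jumpKer_degree p ξ ζ h]

theorem motion_meas (c : ℝ) : TMeas (motion p c) := flow_meas _ _

theorem motion_causal (c : ℝ) : Causal (motion p c) := flow_causal _ _

theorem motion_add (c : ℝ) (s t : ℝ) (hs : 0 ≤ s) (ht : 0 ≤ t) :
    motion p c (s + t) = motion p c s * motion p c t :=
  flow_add (jumpKer_invariant p c) s t hs ht

theorem motion_eq_smul (c t : ℝ) :
    motion p c t = ENNReal.ofReal (Real.exp (-(c * t))) • motion p 0 t := by
  rw [motion, flow_const_add, motion]
  simp only [add_zero]

/-- Independence of the particles. Insertion of a particle intertwines the motion with a pair of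
commuting motions, so the exponential factorises. Together with `finConfig_induction` this reduces
statements about motion to one particle at a time. -/
theorem act_motion_addAt {c t : ℝ} (ht : 0 ≤ t) (g : FinConfig d → ℝ≥0∞) (ξ : FinConfig d)
    (x : Site d) : act (motion p c t) g (addAt ξ x) =
      act (walk p t) (fun y => act (motion p c t) (fun ζ => g (addAt ζ y)) ξ) x := by
  rw [motion, act_flow' _ _ ht, walk, act_flow' _ _ ht]
  have h1 : act (exp (ENNReal.ofReal t • jumpKer p)) g (addAt ξ x) =
      act (exp (ENNReal.ofReal t • (onFst (transKer fun x => p x) + onSnd (jumpKer p))))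
        (g ∘ fun a : Site d × FinConfig d => addAt a.2 a.1) (x, ξ) := by
    refine act_exp_comp _ _ (fun a : Site d × FinConfig d => addAt a.2 a.1) (fun g a => ?_) g (x, ξ)
    rw [act_smul_left, act_smul_left, act_jumpKer_addAt, act_add_left, Pi.add_apply, act_onFst,
      act_onSnd]
    rfl
  rw [h1, smul_add, exp_add (commute_smul_smul (commute_onFst_onSnd _ _) _ _), act_mul,
    act_exp_onFst]
  simp only [act_exp_onSnd]
  simp only [act_flow' _ _ ht, act_const_mul, degree_addAt]
  rw [← mul_assoc, ← ENNReal.ofReal_mul (Real.exp_pos _).le, ← Real.exp_add]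
  congr 3
  push_cast
  ring

theorem act_motion_zero {c t : ℝ} (ht : 0 ≤ t) (g : FinConfig d → ℝ≥0∞) :
    act (motion p c t) g 0 = ENNReal.ofReal (Real.exp (-(c * t))) * g 0 := by
  rw [motion, act_flow _ _ ht, tsum_eq_single 0]
  · simp [act_one, poissonWeight]
  · intro j hj
    obtain ⟨j, rfl⟩ := Nat.exists_eq_succ_of_ne_zero hj
    rw [pow_succ', act_mul, act_jumpKer]
    simp

theorem act_jumpKer_one (ξ : FinConfig d) : act (jumpKer p) (fun _ => 1) ξ = ξ.degree := by
  rw [act_jumpKer, Finsupp.degree_apply, Nat.cast_sum]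
  refine Finset.sum_congr rfl fun x _ => ?_
  have h := act_transKer_one p x
  rw [act] at h
  simp only [transKer] at h
  rw [h, mul_one]

theorem act_motion_one {t : ℝ} (ht : 0 ≤ t) (ξ : FinConfig d) :
    act (motion p 0 t) (fun _ => 1) ξ = 1 :=
  act_flow_one (fun _ => by positivity) (fun ξ => by rw [act_jumpKer_one]; simp)
    (jumpKer_invariant p 0) ht ξ

theorem finConfig_induction {P : FinConfig d → Prop} (h0 : P 0)
    (h1 : ∀ ξ x, P ξ → P (addAt ξ x)) (ξ : FinConfig d) : P ξ := by
  induction hn : ξ.degree generalizing ξ with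
  | zero =>
    have : ξ = 0 := by rwa [Finsupp.degree_eq_zero_iff] at hn
    rw [this]; exact h0
  | succ n ih =>
    have : ∃ x, ξ x ≠ 0 := by
      by_contra! hall
      have : ξ = 0 := Finsupp.ext hall
      rw [this] at hn
      simp at hn
    obtain ⟨x, hx⟩ := this
    rw [← addAt_removeAt hx]
    refine h1 _ _ (ih _ ?_)
    have := degree_addAt (removeAt ξ x) x
    rw [addAt_removeAt hx] at this
    omega

end

end SCBRW

namespace SCBRW

noncomputable section

open Ker

variable {d : ℕ} (p : PMF (Site d))

/-! ### Increasing functions with decreasing increments -/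

/-- Increasing functions of the configuration that have decreasing increments, and for which a
particle at `x` contributes at most `φ x`. -/
structure Conc (φ : Site d → ℝ≥0∞) (g : FinConfig d → ℝ≥0∞) : Prop where
  mono : ∀ ξ x, g ξ ≤ g (addAt ξ x)
  lip : ∀ ξ x, g (addAt ξ x) ≤ g ξ + φ x
  sub : ∀ ξ x y, g (addAt (addAt ξ x) y) + g ξ ≤ g (addAt ξ x) + g (addAt ξ y)

variable {φ ψ : Site d → ℝ≥0∞} {g h : FinConfig d → ℝ≥0∞}

theorem Conc.add (hg : Conc φ g) (hh : Conc ψ h) :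
    Conc (fun x => φ x + ψ x) (fun ξ => g ξ + h ξ) where
  mono ξ x := add_le_add (hg.mono ξ x) (hh.mono ξ x)
  lip ξ x := (add_le_add (hg.lip ξ x) (hh.lip ξ x)).trans (le_of_eq (by ring))
  sub ξ x y := by
    calc _ = (g (addAt (addAt ξ x) y) + g ξ) + (h (addAt (addAt ξ x) y) + h ξ) := by ring
      _ ≤ (g (addAt ξ x) + g (addAt ξ y)) + (h (addAt ξ x) + h (addAt ξ y)) :=
        add_le_add (hg.sub ξ x y) (hh.sub ξ x y)
      _ = _ := by ring

theorem Conc.const_mul (hg : Conc φ g) (c : ℝ≥0∞) :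
    Conc (fun x => c * φ x) (fun ξ => c * g ξ) where
  mono ξ x := mul_le_mul_right (hg.mono ξ x) c
  lip ξ x := by rw [← mul_add]; exact mul_le_mul_right (hg.lip ξ x) c
  sub ξ x y := by rw [← mul_add, ← mul_add]; exact mul_le_mul_right (hg.sub ξ x y) c

theorem Conc.zero : Conc (0 : Site d → ℝ≥0∞) 0 where
  mono ξ x := le_rfl
  lip ξ x := by simp
  sub ξ x y := le_rfl

theorem Conc.sum {ι : Type*} (s : Finset ι) {φ : ι → Site d → ℝ≥0∞}
    {g : ι → FinConfig d → ℝ≥0∞} (hg : ∀ i ∈ s, Conc (φ i) (g i)) :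
    Conc (fun x => ∑ i ∈ s, φ i x) (fun ξ => ∑ i ∈ s, g i ξ) := by
  classical
  induction s using Finset.cons_induction with
  | empty =>
    simp only [Finset.sum_empty]
    exact Conc.zero
  | cons a s ha ih =>
    simp only [Finset.sum_cons]
    exact (hg a (Finset.mem_cons_self _ _)).add
      (ih fun i hi => hg i (Finset.mem_cons_of_mem hi))

theorem Conc.mono_bound (hg : Conc φ g) (h : ∀ x, φ x ≤ ψ x) : Conc ψ g where
  mono := hg.mono
  lip ξ x := (hg.lip ξ x).trans (add_le_add le_rfl (h x))
  sub := hg.sub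

theorem Conc.lintegral {μ : Measure ℝ} {φ : ℝ → Site d → ℝ≥0∞} {g : ℝ → FinConfig d → ℝ≥0∞}
    (hgm : ∀ ξ, Measurable fun s => g s ξ) (hg : ∀ᵐ s ∂μ, Conc (φ s) (g s)) :
    Conc (fun x => ∫⁻ s, φ s x ∂μ) (fun ξ => ∫⁻ s, g s ξ ∂μ) where
  mono ξ x := lintegral_mono_ae (hg.mono fun s hs => hs.mono ξ x)
  lip ξ x := by
    rw [← lintegral_add_left (hgm ξ)]
    exact lintegral_mono_ae (hg.mono fun s hs => hs.lip ξ x)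
  sub ξ x y := by
    rw [← lintegral_add_left (hgm _), ← lintegral_add_left (hgm _)]
    exact lintegral_mono_ae (hg.mono fun s hs => hs.sub ξ x y)

theorem Conc.of_tendsto {G : ℕ → FinConfig d → ℝ≥0∞} (hG : ∀ n, Conc φ (G n))
    (h : ∀ ξ, Tendsto (fun n => G n ξ) atTop (𝓝 (g ξ))) : Conc φ g where
  mono ξ x := le_of_tendsto_of_tendsto' (h ξ) (h _) fun n => (hG n).mono ξ x
  lip ξ x := le_of_tendsto_of_tendsto' (h _) ((h ξ).add tendsto_const_nhds) fun n => (hG n).lip ξ x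
  sub ξ x y := le_of_tendsto_of_tendsto' ((h _).add (h _)) ((h _).add (h _))
    fun n => (hG n).sub ξ x y

theorem act_const_of_one {X : Type*} {a : Ker X} {x : X} (h : act a (fun _ => 1) x = 1)
    (c : ℝ≥0∞) : act a (fun _ => c) x = c := by
  have := act_const_mul a c (fun _ => 1) x
  simpa [h] using this

/-- By `act_motion_addAt` the extra particles can be inserted after the motion, at displaced sites.
Each inequality is then an average of the same inequality for `g`, and the bound `φ` is averaged
over the walk. -/
theorem Conc.act_motion (hg : Conc φ g) {t : ℝ} (ht : 0 ≤ t) :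
    Conc (act (walk p t) φ) (act (motion p 0 t) g) where
  mono ξ x := by
    rw [act_motion_addAt p ht]
    conv_lhs => rw [← act_const_of_one (act_walk_one p ht x) (act (motion p 0 t) g ξ)]
    exact act_mono _ (fun y => act_mono _ (fun ζ => hg.mono ζ y) ξ) x
  lip ξ x := by
    rw [act_motion_addAt p ht]
    conv_rhs => rw [← act_const_of_one (act_walk_one p ht x) (act (motion p 0 t) g ξ),
      ← act_add_apply]
    refine act_mono _ (fun y => ?_) x
    conv_rhs => rw [← act_const_of_one (act_motion_one p ht ξ) (φ y), ← act_add_apply]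
    exact act_mono _ (fun ζ => hg.lip ζ y) ξ
  sub ξ x y := by
    have hone : ∀ (x : Site d) (c : ℝ≥0∞), act (walk p t) (fun _ => c) x = c :=
      fun x c => act_const_of_one (act_walk_one p ht x) c
    set R : (Site d → Site d → ℝ≥0∞) → ℝ≥0∞ :=
      fun F => act (walk p t) (fun y' => act (walk p t) (fun x' => F x' y') x) y with hR
    set M : (FinConfig d → ℝ≥0∞) → ℝ≥0∞ := fun g => act (motion p 0 t) g ξ with hM
    have e1 : act (motion p 0 t) g (addAt (addAt ξ x) y) =
        R fun x' y' => M fun ζ => g (addAt (addAt ζ x') y') := by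
      rw [act_motion_addAt p ht]
      simp only [act_motion_addAt p ht]
      rfl
    have e2 : act (motion p 0 t) g ξ = R fun x' y' => M g := by
      simp only [hR, hone, hM]
    have e3 : act (motion p 0 t) g (addAt ξ x) = R fun x' y' => M fun ζ => g (addAt ζ x') := by
      rw [act_motion_addAt p ht]
      simp only [hR, hone, hM]
    have e4 : act (motion p 0 t) g (addAt ξ y) = R fun x' y' => M fun ζ => g (addAt ζ y') := by
      rw [act_motion_addAt p ht]
      simp only [hR, hone, hM]
    have hadd : ∀ F G, R F + R G = R fun x' y' => F x' y' + G x' y' := by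
      intro F G
      simp only [hR, act_add_apply]
    have hMadd : ∀ f g, M f + M g = M fun ζ => f ζ + g ζ := by
      intro f g
      simp only [hM, act_add_apply]
    rw [e1, e2, e3, e4, hadd, hadd]
    simp only [hMadd]
    exact act_mono _ (fun y' => act_mono _ (fun x' => act_mono _
      (fun ζ => hg.sub ζ x' y') ξ) x) y

/-! ### Branching of single particles -/

open Classical in
/-- If there is exactly one particle at `x`, it splits or dies with equal probabilities. -/
def branchKer (x : Site d) : Ker (FinConfig d) := fun ξ ζ =>
  if ξ x = 1 then
    2⁻¹ * ((if ζ = addAt ξ x then 1 else 0) + if ζ = removeAt ξ x then 1 else 0)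
  else if ζ = ξ then 1 else 0

theorem tsum_ite_mul {X : Type*} (a : X) (g : X → ℝ≥0∞) [DecidableEq X] :
    ∑' y, (if y = a then 1 else 0) * g y = g a := by
  rw [tsum_eq_single a]
  · simp
  · intro y hy
    simp [hy]

theorem act_branchKer (x : Site d) (g : FinConfig d → ℝ≥0∞) (ξ : FinConfig d) :
    act (branchKer x) g ξ =
      if ξ x = 1 then 2⁻¹ * (g (addAt ξ x) + g (removeAt ξ x)) else g ξ := by
  classical
  unfold act branchKer
  split_ifs with h
  · simp only [mul_assoc, ENNReal.tsum_mul_left, add_mul, ENNReal.tsum_add]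
    rw [tsum_ite_mul, tsum_ite_mul]
  · exact tsum_ite_mul _ _

theorem addAt_apply_self (ξ : FinConfig d) (x : Site d) : addAt ξ x x = ξ x + 1 := by
  simp [addAt_apply]

theorem addAt_apply_ne (ξ : FinConfig d) {x z : Site d} (h : z ≠ x) : addAt ξ z x = ξ x := by
  simp [addAt_apply, h]

theorem exists_addAt_eq {ξ : FinConfig d} {x : Site d} (h : ξ x = 1) :
    ∃ ζ, ξ = addAt ζ x ∧ ζ x = 0 := by
  refine ⟨removeAt ξ x, (addAt_removeAt (by omega)).symm, ?_⟩
  simp [removeAt_apply, h]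

/-- As a function of the number of particles at `x`, the value at `1` is replaced by the mean of the
values at `0` and `2`, a chord of a concave sequence; the increments stay decreasing. Everything is
doubled to avoid halves. -/
theorem Conc.branch2 (hg : Conc φ g) (hfin : ∀ ξ, g ξ ≠ ∞) (x : Site d) :
    Conc (fun z => 2 * φ z)
      (fun ξ => if ξ x = 1 then g (addAt ξ x) + g (removeAt ξ x) else g ξ + g ξ) where
  mono ξ z := by
    by_cases h1 : ξ x = 1
    · obtain ⟨ζ, rfl, h0⟩ := exists_addAt_eq h1
      by_cases hz : z = x
      · subst hz
        simp only [addAt_apply_self, h0, removeAt_addAt]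
        norm_num
        exact add_le_add le_rfl ((hg.mono _ _).trans (hg.mono _ _))
      · rw [addAt_comm ζ x z]
        simp only [addAt_apply_self, addAt_apply_ne ζ hz, h0, removeAt_addAt]
        norm_num
        refine add_le_add ?_ (hg.mono _ _)
        rw [addAt_comm ζ z, addAt_comm _ z]
        exact hg.mono _ _
    · by_cases hz : z = x
      · subst hz
        by_cases h0 : ξ z = 0
        · simp only [addAt_apply_self, h0, removeAt_addAt]
          norm_num
          exact add_le_add ((hg.mono _ _).trans (hg.mono _ _)) le_rfl
        · simp only [addAt_apply_self, h1, add_eq_right, h0, if_false]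
          exact add_le_add (hg.mono _ _) (hg.mono _ _)
      · simp only [addAt_apply_ne ξ hz, h1, if_false]
        exact add_le_add (hg.mono _ _) (hg.mono _ _)
  lip ξ z := by
    rw [two_mul]
    by_cases h1 : ξ x = 1
    · obtain ⟨ζ, rfl, h0⟩ := exists_addAt_eq h1
      by_cases hz : z = x
      · subst hz
        simp only [addAt_apply_self, h0, removeAt_addAt]
        norm_num
        rw [add_assoc]
        refine add_le_add le_rfl ?_
        rw [← add_assoc]
        exact (hg.lip _ _).trans (add_le_add (hg.lip _ _) le_rfl)
      · rw [addAt_comm ζ x z]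
        simp only [addAt_apply_self, addAt_apply_ne ζ hz, h0, removeAt_addAt]
        norm_num
        rw [add_add_add_comm]
        refine add_le_add ?_ (hg.lip _ _)
        rw [addAt_comm ζ z, addAt_comm _ z]
        exact hg.lip _ _
    · by_cases hz : z = x
      · subst hz
        by_cases h0 : ξ z = 0
        · simp only [addAt_apply_self, h0, removeAt_addAt]
          norm_num
          rw [add_comm, add_assoc]
          refine add_le_add le_rfl ?_
          rw [← add_assoc]
          exact (hg.lip _ _).trans (add_le_add (hg.lip _ _) le_rfl)
        · simp only [addAt_apply_self, h1, add_eq_right, h0, if_false]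
          rw [add_add_add_comm]
          exact add_le_add (hg.lip _ _) (hg.lip _ _)
      · simp only [addAt_apply_ne ξ hz, h1, if_false]
        rw [add_add_add_comm]
        exact add_le_add (hg.lip _ _) (hg.lip _ _)
  sub ξ y z := by
    -- Two inequalities for a single extra particle at `x` are telescoped. Cancelling the middle
    -- terms is what requires `g` to be finite.
    have hsub2 : ∀ ζ w, g (addAt (addAt (addAt ζ x) x) w) + g ζ ≤
        g (addAt (addAt ζ x) x) + g (addAt ζ w) := by
      intro ζ w
      have h1 := hg.sub (addAt ζ x) x w
      have h2 := hg.sub ζ x w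
      have h3 : g (addAt ζ x) + g (addAt (addAt ζ x) w) ≠ ∞ :=
        ENNReal.add_ne_top.mpr ⟨hfin _, hfin _⟩
      refine (ENNReal.add_le_add_iff_left h3).mp ?_
      calc _ = (g (addAt (addAt (addAt ζ x) x) w) + g (addAt ζ x)) +
          (g (addAt (addAt ζ x) w) + g ζ) := by ring
        _ ≤ _ := add_le_add h1 h2
        _ = _ := by ring
    -- The mixed case of one insertion at `x` and one elsewhere; only whether `ξ x` is `0`, `1` or
    -- larger matters.
    have hmix : ∀ ξ z, z ≠ x → (if addAt (addAt ξ x) z x = 1 then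
          g (addAt (addAt (addAt ξ x) z) x) + g (removeAt (addAt (addAt ξ x) z) x)
          else g (addAt (addAt ξ x) z) + g (addAt (addAt ξ x) z)) +
        (if ξ x = 1 then g (addAt ξ x) + g (removeAt ξ x) else g ξ + g ξ) ≤
        (if addAt ξ x x = 1 then g (addAt (addAt ξ x) x) + g (removeAt (addAt ξ x) x)
          else g (addAt ξ x) + g (addAt ξ x)) +
        (if addAt ξ z x = 1 then g (addAt (addAt ξ z) x) + g (removeAt (addAt ξ z) x)
          else g (addAt ξ z) + g (addAt ξ z)) := by
      intro ξ z hz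
      by_cases h1 : ξ x = 1
      · obtain ⟨ζ, rfl, h0⟩ := exists_addAt_eq h1
        rw [addAt_comm ζ x z]
        simp only [addAt_apply_self, addAt_apply_ne _ hz, h0, removeAt_addAt]
        norm_num
        have h2 := hg.sub (addAt ζ x) x z
        have h3 := hsub2 ζ z
        rw [addAt_comm ζ z x]
        rw [addAt_comm (addAt ζ x) z x]
        calc _ = (g (addAt (addAt (addAt ζ x) x) z) + g ζ) +
            (g (addAt (addAt (addAt ζ x) x) z) + g (addAt (addAt ζ x) x)) := by ring
          _ ≤ (g (addAt (addAt ζ x) x) + g (addAt ζ z)) +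
            (g (addAt (addAt (addAt ζ x) x) z) + g (addAt (addAt ζ x) x)) := add_le_add h3 le_rfl
          _ = _ := by ring
      · by_cases h0 : ξ x = 0
        · rw [addAt_comm ξ x z]
          simp only [addAt_apply_self, addAt_apply_ne _ hz, h0, removeAt_addAt]
          norm_num
          have h3 := hsub2 ξ z
          rw [addAt_comm ξ z x, addAt_comm (addAt ξ x) z x]
          calc _ = (g (addAt (addAt (addAt ξ x) x) z) + g ξ) + (g (addAt ξ z) + g ξ) := by ring
            _ ≤ (g (addAt (addAt ξ x) x) + g (addAt ξ z)) + (g (addAt ξ z) + g ξ) :=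
              add_le_add h3 le_rfl
            _ = _ := by ring
        · simp only [addAt_apply_self, addAt_apply_ne _ hz, add_eq_right, h0, h1, if_false]
          have h2 := hg.sub ξ x z
          rw [add_add_add_comm, add_add_add_comm (g (addAt ξ x))]
          exact add_le_add h2 h2
    by_cases hy : y = x
    · by_cases hz : z = x
      · subst hy; subst hz
        rcases Nat.lt_or_ge (ξ z) 2 with hlt | hge
        · interval_cases h0 : ξ z
          · simp only [addAt_apply_self, h0, removeAt_addAt]
            norm_num
            exact le_of_eq (by ring)
          · obtain ⟨ζ, rfl, h0'⟩ := exists_addAt_eq h0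
            simp only [addAt_apply_self, h0', removeAt_addAt]
            norm_num
            have h2 := hg.sub (addAt ζ z) z z
            have h3 := hsub2 ζ z
            calc _ = (g (addAt (addAt (addAt ζ z) z) z) + g ζ) +
                (g (addAt (addAt (addAt ζ z) z) z) + g (addAt (addAt ζ z) z)) := by ring
              _ ≤ (g (addAt (addAt ζ z) z) + g (addAt ζ z)) +
                (g (addAt (addAt (addAt ζ z) z) z) + g (addAt (addAt ζ z) z)) :=
                add_le_add h3 le_rfl
              _ = (g (addAt (addAt (addAt ζ z) z) z) + g (addAt ζ z)) +
                (g (addAt (addAt ζ z) z) + g (addAt (addAt ζ z) z)) := by ring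
              _ ≤ _ := add_le_add h2 le_rfl
              _ = _ := by ring
        · have h1 : ξ z ≠ 1 := by omega
          have h0 : ξ z ≠ 0 := by omega
          have h3 : ξ z + 1 + 1 ≠ 1 := by omega
          simp only [addAt_apply_self, add_eq_right, h0, h1, h3, if_false]
          have h2 := hg.sub ξ z z
          rw [add_add_add_comm, add_add_add_comm (g (addAt ξ z))]
          exact add_le_add h2 h2
      · rw [hy]; exact hmix ξ z hz
    · by_cases hz : z = x
      · have h2 := hmix ξ y hy
        rw [addAt_comm ξ x y] at h2
        rw [hz, add_comm (ite (addAt ξ y x = 1) _ _)]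
        exact h2
      · by_cases h1 : ξ x = 1
        · obtain ⟨ζ, rfl, h0⟩ := exists_addAt_eq h1
          have h2 := hg.sub (addAt (addAt ζ x) x) y z
          have h3 := hg.sub ζ y z
          have e1 : addAt (addAt (addAt ζ x) y) z = addAt (addAt (addAt ζ y) z) x := by
            rw [addAt_comm ζ x y, addAt_comm (addAt ζ y) x z]
          rw [e1, addAt_comm ζ x y, addAt_comm ζ x z]
          simp only [addAt_apply_self, addAt_apply_ne _ hy, addAt_apply_ne _ hz, h0, removeAt_addAt]
          norm_num
          rw [← e1, addAt_comm _ z x, addAt_comm _ y x, addAt_comm ζ y x, addAt_comm _ y x,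
            addAt_comm ζ z x, addAt_comm _ z x]
          rw [add_add_add_comm, add_add_add_comm (g (addAt (addAt (addAt ζ x) x) y))]
          exact add_le_add h2 h3
        · simp only [addAt_apply_ne _ hy, addAt_apply_ne _ hz, h1, if_false]
          have h2 := hg.sub ξ y z
          rw [add_add_add_comm, add_add_add_comm (g (addAt ξ y))]
          exact add_le_add h2 h2

theorem Conc.branch (hg : Conc φ g) (hfin : ∀ ξ, g ξ ≠ ∞) (x : Site d) :
    Conc φ (act (branchKer x) g) := by
  have h := (hg.branch2 hfin x).const_mul 2⁻¹
  have h1 : act (branchKer x) g = fun ξ => 2⁻¹ *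
      (if ξ x = 1 then g (addAt ξ x) + g (removeAt ξ x) else g ξ + g ξ) := by
    funext ξ
    rw [act_branchKer]
    split_ifs
    · rfl
    · rw [← two_mul, ← mul_assoc, ENNReal.inv_mul_cancel two_ne_zero ENNReal.ofNat_ne_top, one_mul]
  have h2 : φ = fun z => 2⁻¹ * (2 * φ z) := by
    funext z
    rw [← mul_assoc, ENNReal.inv_mul_cancel two_ne_zero ENNReal.ofNat_ne_top, one_mul]
  rw [h1, h2]
  exact h

theorem Conc.act_branch_le (hg : Conc φ g) (x : Site d) (ξ : FinConfig d) :
    act (branchKer x) g ξ ≤ g ξ := by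
  rw [act_branchKer]
  split_ifs with h1
  · obtain ⟨ζ, rfl, h0⟩ := exists_addAt_eq h1
    rw [removeAt_addAt]
    calc _ ≤ 2⁻¹ * (g (addAt ζ x) + g (addAt ζ x)) := mul_le_mul_right (hg.sub ζ x x) _
      _ = _ := by
        rw [← two_mul, ← mul_assoc, ENNReal.inv_mul_cancel two_ne_zero ENNReal.ofNat_ne_top,
          one_mul]
  · exact le_rfl

theorem act_branch_one (x : Site d) (ξ : FinConfig d) : act (branchKer x) (fun _ => 1) ξ = 1 := by
  rw [act_branchKer]
  split_ifs
  · rw [one_add_one_eq_two, ENNReal.inv_mul_cancel two_ne_zero ENNReal.ofNat_ne_top]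
  · rfl

end

end SCBRW

namespace SCBRW

noncomputable section

open Ker

/-! ### Random walks that branch only when they are alone at their site -/

theorem Ker.act_sum_left {X ι : Type*} (s : Finset ι) (a : ι → Ker X) (g : X → ℝ≥0∞) (x : X) :
    act (∑ i ∈ s, a i) g x = ∑ i ∈ s, act (a i) g x := by
  classical
  induction s using Finset.induction_on with
  | empty => simp [act_zero_left]
  | insert i s hi ih => rw [Finset.sum_insert hi, Finset.sum_insert hi, act_add_left, Pi.add_apply, ih]

variable {d : ℕ} (p : PMF (Site d)) (β : ℝ≥0) (Λ : Finset (Site d))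

/-- The branching of single particles at rate `β`, in a finite set of sites. -/
def branchSum : Ker (FinConfig d) := (β : ℝ≥0∞) • ∑ x ∈ Λ, branchKer x

theorem act_branchSum (g : FinConfig d → ℝ≥0∞) (ξ : FinConfig d) :
    act (branchSum β Λ) g ξ = ∑ x ∈ Λ, (β : ℝ≥0∞) * act (branchKer x) g ξ := by
  rw [branchSum, act_smul_left, Ker.act_sum_left, Finset.mul_sum]

/-- The total rate at which the branching clocks in `Λ` ring. -/
def clockRate : ℝ := β * Λ.card

theorem clockRate_nonneg : 0 ≤ clockRate β Λ := by unfold clockRate; positivity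

theorem ofReal_clockRate : ENNReal.ofReal (clockRate β Λ) = ∑ _x ∈ Λ, (β : ℝ≥0∞) := by
  rw [clockRate, ENNReal.ofReal_mul (by positivity)]
  simp [mul_comm]

/-- Transition kernels of the system in which the particles perform independent walks, and a
particle that is alone at a site of `Λ` branches at rate `β`. -/
def lonely : ℝ → Ker (FinConfig d) := dyson (motion p (clockRate β Λ)) (branchSum β Λ)

theorem lonely_meas : TMeas (lonely p β Λ) := dyson_meas (motion_meas p _)

theorem lonely_causal : Causal (lonely p β Λ) := dyson_causal (motion_causal p _)

theorem lonely_add {s t : ℝ} (hs : 0 ≤ s) (ht : 0 ≤ t) :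
    lonely p β Λ (t + s) = lonely p β Λ t * lonely p β Λ s :=
  dyson_add (motion_meas p _) (motion_causal p _) (motion_add p _) hs ht

theorem lonely_empty (t : ℝ) : lonely p β ∅ t = motion p 0 t := by
  have h : branchSum β (∅ : Finset (Site d)) = 0 := by simp [branchSum]
  have hc : clockRate β (∅ : Finset (Site d)) = 0 := by simp [clockRate]
  rw [lonely, dyson_left (motion_meas p _), h, hc]
  have h2 : conv (fun s => motion p 0 s * 0) (dyson (motion p 0) (0 : Ker (FinConfig d))) t = 0 := by
    ext x z
    simp [conv, lint_apply, zero_apply]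
  rw [h2, add_zero]

/-- A clock of rate `c` either stays silent up to time `t` or rings first at some `s ≤ t`. In this
form a quantity independent of the clock can be spread over the two terms of a perturbation
equation. -/
theorem exp_add_lintegral {c t : ℝ} (hc : 0 ≤ c) (ht : 0 ≤ t) (a : ℝ≥0∞) :
    ENNReal.ofReal (Real.exp (-(c * t))) * a +
      ∫⁻ s in Set.Icc 0 t, ENNReal.ofReal (Real.exp (-(c * s))) * (ENNReal.ofReal c * a) = a := by
  have h := poissonWeight_zero_add hc ht
  simp only [poissonWeight, pow_zero, Nat.factorial_zero, Nat.cast_one, div_one, mul_one] at h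
  rw [lintegral_mul_const _ (by fun_prop)]
  conv_rhs => rw [← one_mul a, ← h]
  ring

variable {φ ψ : Site d → ℝ≥0∞} {f g h : FinConfig d → ℝ≥0∞}

theorem act_motion_const_eq (c t : ℝ) (g : FinConfig d → ℝ≥0∞) (ξ : FinConfig d) :
    act (motion p c t) g ξ = ENNReal.ofReal (Real.exp (-(c * t))) * act (motion p 0 t) g ξ := by
  rw [motion_eq_smul, act_smul_left]

/-- If branching does not raise the means of `w` under pure motion, these means are a supersolution
of the perturbation equation, of which `lonely` gives the smallest solution. Concavity is not
required, so that constants and unbounded linear functions are covered. -/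
theorem act_lonely_le_motion {w : FinConfig d → ℝ≥0∞} {t : ℝ} (ht : 0 ≤ t)
    (hw : ∀ x ∈ Λ, ∀ v, 0 ≤ v → ∀ ξ,
      act (branchKer x) (act (motion p 0 v) w) ξ ≤ act (motion p 0 v) w ξ)
    (ξ : FinConfig d) : act (lonely p β Λ t) w ξ ≤ act (motion p 0 t) w ξ := by
  refine act_dyson_le (motion_meas p _) (motion_causal p _) (w := fun t => act (motion p 0 t) w)
    (fun t ht ξ => ?_) ht ξ
  rw [act_motion_const_eq]
  conv_rhs => rw [← exp_add_lintegral (clockRate_nonneg β Λ) ht (act (motion p 0 t) w ξ)]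
  refine add_le_add le_rfl (setLIntegral_mono' measurableSet_Icc fun s hs => ?_)
  rw [act_motion_const_eq]
  refine mul_le_mul_right ?_ _
  have e : act (motion p 0 t) w ξ = act (motion p 0 s) (act (motion p 0 (t - s)) w) ξ := by
    rw [← act_mul, ← motion_add p 0 _ _ hs.1 (sub_nonneg.mpr hs.2), add_sub_cancel]
  rw [e, ← act_const_mul]
  refine act_mono _ (fun ζ => ?_) ξ
  rw [act_branchSum, ofReal_clockRate, Finset.sum_mul]
  exact Finset.sum_le_sum fun x hx => mul_le_mul_right (hw x hx _ (sub_nonneg.mpr hs.2) ζ) _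

theorem act_lonely_const_le {t : ℝ} (ht : 0 ≤ t) (C : ℝ≥0∞) (ξ : FinConfig d) :
    act (lonely p β Λ t) (fun _ => C) ξ ≤ C := by
  have hM : ∀ v, 0 ≤ v → act (motion p 0 v) (fun _ => C) = fun _ => C := fun v hv => by
    funext ξ
    exact act_const_of_one (act_motion_one p hv ξ) C
  refine (act_lonely_le_motion p β Λ ht (fun x _ v hv ξ => ?_) ξ).trans (by rw [hM t ht])
  rw [hM v hv]
  exact (act_const_of_one (act_branch_one x ξ) C).le

theorem act_lonely_le {C : ℝ≥0∞} (hf : ∀ ξ, f ξ ≤ C) {t : ℝ} (ht : 0 ≤ t) (ξ : FinConfig d) :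
    act (lonely p β Λ t) f ξ ≤ C :=
  (act_mono _ hf ξ).trans (act_lonely_const_le p β Λ ht C ξ)

theorem act_walk_act_walk {s t : ℝ} (hs : 0 ≤ s) (ht : s ≤ t) (φ : Site d → ℝ≥0∞) :
    act (walk p s) (act (walk p (t - s)) φ) = act (walk p t) φ := by
  rw [← act_mul, ← walk_add p hs (sub_nonneg.mpr ht), add_sub_cancel]

theorem Conc.act_branchSum (hg : Conc φ g) (hfin : ∀ ξ, g ξ ≠ ∞) :
    Conc (fun x => ENNReal.ofReal (clockRate β Λ) * φ x) (act (branchSum β Λ) g) := by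
  have h := Conc.sum Λ fun x _ => (hg.branch hfin x).const_mul (β : ℝ≥0∞)
  have e : act (branchSum β Λ) g = fun ξ => ∑ x ∈ Λ, (β : ℝ≥0∞) * act (branchKer x) g ξ :=
    funext fun ξ => SCBRW.act_branchSum β Λ g ξ
  rw [e, ofReal_clockRate]
  simpa only [Finset.sum_mul] using h

/-- The class is stable under motion, under single branchings and under mixtures, so every Picard
iterate is concave, and the limit inherits this. Boundedness of `f` provides the finiteness needed
at each branching. -/
theorem Conc.act_lonely (hf : Conc φ f) {C : ℝ≥0∞} (hC : C ≠ ∞) (hfC : ∀ ξ, f ξ ≤ C) {t : ℝ}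
    (ht : 0 ≤ t) : Conc (act (walk p t) φ) (act (lonely p β Λ t) f) := by
  set c := clockRate β Λ
  set D := dysonTerm (motion p c) (branchSum β Λ) with hD
  have hDm : ∀ n, TMeas (D n) := fun n => dysonTerm_meas (motion_meas p _) n
  have hle : ∀ n t, 0 ≤ t → ∀ ξ, ∑ i ∈ Finset.range n, act (D i t) f ξ ≤ C := by
    intro n t ht ξ
    refine (ENNReal.sum_le_tsum _).trans ?_
    rw [hD, ← act_dyson]
    exact act_lonely_le p β Λ hfC ht ξ
  have key : ∀ n t, 0 ≤ t →
      Conc (act (walk p t) φ) fun ξ => ∑ i ∈ Finset.range n, act (D i t) f ξ := by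
    intro n
    induction n with
    | zero =>
      intro t ht
      simp only [Finset.range_zero, Finset.sum_empty]
      exact Conc.zero.mono_bound fun x => zero_le
    | succ n ih =>
      intro t ht
      have e1 : (fun ξ => ∑ i ∈ Finset.range (n + 1), act (D i t) f ξ) = fun ξ =>
          ENNReal.ofReal (Real.exp (-(c * t))) * act (motion p 0 t) f ξ +
          ∫⁻ s in Set.Icc 0 t, ENNReal.ofReal (Real.exp (-(c * s))) * act (motion p 0 s)
            (act (branchSum β Λ) fun y => ∑ i ∈ Finset.range n, act (D i (t - s)) f y) ξ := by
        funext ξ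
        rw [hD, sum_act_dysonTerm_succ (motion_meas p _) (motion_causal p _), act_motion_const_eq]
        simp only [act_motion_const_eq p c]
      have e2 : act (walk p t) φ = fun x =>
          ENNReal.ofReal (Real.exp (-(c * t))) * act (walk p t) φ x +
          ∫⁻ s in Set.Icc 0 t, ENNReal.ofReal (Real.exp (-(c * s))) *
            (ENNReal.ofReal c * act (walk p t) φ x) := by
        funext x
        exact (exp_add_lintegral (clockRate_nonneg β Λ) ht _).symm
      rw [e1, e2]
      refine ((hf.act_motion p ht).const_mul _).add (Conc.lintegral (fun ξ => ?_) ?_)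
      · refine Measurable.mul (by fun_prop) ((motion_meas p 0).act_act (fun ζ => ?_) ξ)
        refine (TMeas.const _).act_act (fun χ => ?_) ζ
        exact Finset.measurable_sum _ fun i _ =>
          ((hDm i).comp (u := fun s => t - s) (by fun_prop)).act f χ
      · refine ae_restrict_of_forall_mem measurableSet_Icc fun s hs => ?_
        have h1 := ((ih (t - s) (sub_nonneg.mpr hs.2)).act_branchSum β Λ fun ξ =>
          ((hle n _ (sub_nonneg.mpr hs.2) ξ).trans_lt hC.lt_top).ne).act_motion p hs.1
        have h2 : act (walk p s) (fun x => ENNReal.ofReal c * act (walk p (t - s)) φ x) =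
            fun x => ENNReal.ofReal c * act (walk p t) φ x := by
          funext x
          rw [act_const_mul, act_walk_act_walk p hs.1 hs.2]
        rw [h2] at h1
        exact h1.const_mul _
  refine Conc.of_tendsto (fun n => key n t ht) fun ξ => ?_
  rw [lonely, act_dyson]
  exact ENNReal.tendsto_nat_tsum _

/-! ### Comparison of different branching regions -/

theorem conv_congr_left {X : Type*} {F F' G : ℝ → Ker X} (h : ∀ s, F s = F' s) (t : ℝ) :
    conv F G t = conv F' G t := by
  rw [funext h]

theorem motion_resolvent {c c' : ℝ} (hc : c ≤ c') (t : ℝ) :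
    motion p c t = motion p c' t +
      ENNReal.ofReal (c' - c) • conv (motion p c') (motion p c) t := by
  refine ext_act fun g ξ => ?_
  rcases lt_or_ge t 0 with ht | ht
  · rw [motion_causal p c t ht, motion_causal p c' t ht, Causal.conv (motion_causal p c')
      (motion_causal p c) t ht]
    simp
  rw [act_add_left, Pi.add_apply, act_smul_left, act_conv_Icc (motion_meas p _) (motion_meas p _)
    (motion_causal p _) (motion_causal p _)]
  have h1 : ∫⁻ s in Set.Icc 0 t, act (motion p c' s) (act (motion p c (t - s)) g) ξ =
      ∫⁻ s in Set.Icc 0 t, ENNReal.ofReal (Real.exp (-((c' - c) * s))) * act (motion p c t) g ξ := by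
    refine setLIntegral_congr_fun measurableSet_Icc fun s hs => ?_
    have e : motion p c' s = ENNReal.ofReal (Real.exp (-((c' - c) * s))) • motion p c s := by
      rw [motion_eq_smul p c', motion_eq_smul p c, smul_smul, ← ENNReal.ofReal_mul (by positivity),
        ← Real.exp_add]
      congr 3; ring
    change act (motion p c' s) (act (motion p c (t - s)) g) ξ = _
    rw [e, act_smul_left, ← act_mul, ← motion_add p c _ _ hs.1 (sub_nonneg.mpr hs.2),
      add_sub_cancel]
  have e : motion p c' t = ENNReal.ofReal (Real.exp (-((c' - c) * t))) • motion p c t := by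
    rw [motion_eq_smul p c', motion_eq_smul p c, smul_smul, ← ENNReal.ofReal_mul (by positivity),
      ← Real.exp_add]
    congr 3; ring
  rw [h1, e, act_smul_left, ← lintegral_const_mul _ (by fun_prop)]
  conv_lhs => rw [← exp_add_lintegral (sub_nonneg.mpr hc) ht (act (motion p c t) g ξ)]
  congr 1
  refine lintegral_congr fun s => ?_
  ring

variable {Λ}

theorem clockRate_mono {Λ' : Finset (Site d)} (h : Λ ⊆ Λ') : clockRate β Λ ≤ clockRate β Λ' := by
  unfold clockRate
  have := Finset.card_le_card h
  gcongr

/-- The system on `Λ` run with the clocks of the larger set `Λ'`: the additional clocks ring without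
effect, which is the multiple of the identity. -/
theorem lonely_resolvent {Λ' : Finset (Site d)} (h : Λ ⊆ Λ') (t : ℝ) :
    lonely p β Λ t = motion p (clockRate β Λ') t + conv (motion p (clockRate β Λ'))
      (fun s => (ENNReal.ofReal (clockRate β Λ' - clockRate β Λ) • 1 + branchSum β Λ) *
        lonely p β Λ s) t := by
  set c := clockRate β Λ
  set c' := clockRate β Λ'
  set γ := ENNReal.ofReal (c' - c)
  set N := motion p c
  set N' := motion p c'
  set S := lonely p β Λ
  set K := branchSum β Λ
  have mN : TMeas N := motion_meas p _
  have mN' : TMeas N' := motion_meas p _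
  have mS : TMeas S := lonely_meas p β Λ
  have mKS : TMeas fun s => K * S s := (TMeas.const _).mul mS
  have hN : ∀ t, N t = N' t + γ • conv N' N t := motion_resolvent p (clockRate_mono β h)
  have hS : ∀ t, S t = N t + conv N (fun s => K * S s) t := fun t => by
    rw [← mul_mid_conv]; exact dyson_left (motion_meas p _) t
  have e1 : conv N (fun s => K * S s) t =
      conv N' (fun s => K * S s) t + γ • conv N' (conv N fun s => K * S s) t := by
    rw [conv_congr_left hN, add_conv mN' mKS, smul_conv (mN'.conv mN) mKS, conv_assoc mN' mN mKS]
  have e2 : conv N' (fun s => (γ • 1 + K) * S s) t =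
      γ • conv N' S t + conv N' (fun s => K * S s) t := by
    simp only [add_mul, smul_mul_assoc, one_mul]
    rw [conv_add mN' (mS.smul measurable_const)]
    congr 1
    ext x z
    rw [smul_apply, conv, conv, ← smul_apply, ← lint_smul (mN'.conv_aux mS t)]
    simp only [mul_smul_comm]
  have e3 : conv N' S t = conv N' N t + conv N' (conv N fun s => K * S s) t := by
    rw [← conv_add mN' mN]
    congr 1
    funext s
    exact hS s
  rw [e2, e3, hS t, e1, hN t, smul_add]
  abel

/-- Duhamel's formula for two perturbations of the same killed motion, with the negative terms moved
across because kernels cannot be subtracted. -/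
theorem lonely_duhamel {Λ' : Finset (Site d)} (h : Λ ⊆ Λ') (t : ℝ) :
    lonely p β Λ t + conv (lonely p β Λ') (fun s => branchSum β Λ' * lonely p β Λ s) t =
      lonely p β Λ' t + conv (lonely p β Λ')
      (fun s => (ENNReal.ofReal (clockRate β Λ' - clockRate β Λ) • 1 + branchSum β Λ) *
        lonely p β Λ s) t := by
  set A := ENNReal.ofReal (clockRate β Λ' - clockRate β Λ) • (1 : Ker (FinConfig d)) +
    branchSum β Λ
  set N := motion p (clockRate β Λ')
  set S := lonely p β Λ
  set S' := lonely p β Λ'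
  set K := branchSum β Λ'
  have mN : TMeas N := motion_meas p _
  have mS : TMeas S := lonely_meas p β Λ
  have mS' : TMeas S' := lonely_meas p β Λ'
  have mAS : TMeas fun s => A * S s := (TMeas.const _).mul mS
  have mKN : TMeas fun s => K * N s := (TMeas.const _).mul mN
  have hS : ∀ t, S t = N t + conv N (fun s => A * S s) t := lonely_resolvent p β h
  have hS' : ∀ t, S' t = N t + conv S' (fun s => K * N s) t := dyson_right mN
  have e1 : conv S' (fun s => K * S s) t = conv S' (fun s => K * N s) t +
      conv S' (fun s => K * conv N (fun s => A * S s) s) t := by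
    rw [← conv_add mS' mKN]
    congr 1
    funext s
    rw [← mul_add, ← hS]
  have e2 : conv S' (fun s => A * S s) t = conv N (fun s => A * S s) t +
      conv S' (fun s => K * conv N (fun s => A * S s) s) t := by
    rw [conv_congr_left hS', add_conv mN mAS, conv_assoc mS' mKN mAS]
    congr 2
    funext s
    exact mul_conv mN mAS K s
  rw [e1, e2, hS t, hS' t]
  abel

/-- The rate at which the mean of `g` decreases by the branching in `D`. -/
def dissipation (D : Finset (Site d)) (g : FinConfig d → ℝ≥0∞) (ξ : FinConfig d) : ℝ≥0∞ :=
  ∑ x ∈ D, (β : ℝ≥0∞) * (g ξ - act (branchKer x) g ξ)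

/-- In Duhamel's formula the two perturbations differ by `β (1 - branchKer x)` over `x ∈ Λ' \ Λ`,
which is nonnegative on concave functions. The exact balance gives monotonicity in the region and,
later, both upper and lower estimates of the loss. -/
theorem lonely_add_dissipation {Λ' : Finset (Site d)} (h : Λ ⊆ Λ') (hf : Conc φ f) {C : ℝ≥0∞}
    (hC : C ≠ ∞) (hfC : ∀ ξ, f ξ ≤ C) (t : ℝ) (ξ : FinConfig d) :
    act (lonely p β Λ' t) f ξ + ∫⁻ s in Set.Icc 0 t, act (lonely p β Λ' s)
      (dissipation β (Λ' \ Λ) (act (lonely p β Λ (t - s)) f)) ξ = act (lonely p β Λ t) f ξ := by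
  set S := lonely p β Λ with hS
  set S' := lonely p β Λ' with hS'
  have mS : TMeas S := lonely_meas p β Λ
  have mS' : TMeas S' := lonely_meas p β Λ'
  have hgC : ∀ v, 0 ≤ v → ∀ ζ, act (S v) f ζ ≤ C := fun v hv => act_lonely_le p β Λ hfC hv
  have hγ : ENNReal.ofReal (clockRate β Λ' - clockRate β Λ) = ∑ _x ∈ Λ' \ Λ, (β : ℝ≥0∞) := by
    rw [← ofReal_clockRate]
    congr 1
    simp only [clockRate, Finset.card_sdiff_of_subset h, Nat.cast_sub (Finset.card_le_card h)]
    ring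
  set γ := ENNReal.ofReal (clockRate β Λ' - clockRate β Λ) with hγdef
  set K := branchSum β Λ
  set K' := branchSum β Λ'
  have hmeas : ∀ k : Ker (FinConfig d), Measurable fun s => act (S' s) (act k (act (S (t - s)) f)) ξ :=
    fun k => mS'.act_act (fun ζ => (TMeas.const k).act_act
      (fun χ => (mS.comp (u := fun s => t - s) (by fun_prop)).act f χ) ζ) ξ
  have hD := congrArg (fun k => act k f ξ) (lonely_duhamel p β h t)
  simp only [act_add_left, Pi.add_apply] at hD
  rw [act_conv_Icc mS' ((TMeas.const _).mul mS) (lonely_causal p β Λ')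
      (fun s hs => by rw [hS, lonely_causal p β Λ s hs, mul_zero]),
    act_conv_Icc mS' ((TMeas.const _).mul mS) (lonely_causal p β Λ')
      (fun s hs => by rw [hS, lonely_causal p β Λ s hs, mul_zero])] at hD
  set q : ℝ → FinConfig d → ℝ≥0∞ := fun v => dissipation β (Λ' \ Λ) (act (S v) f) with hq
  have hK' : ∀ v, 0 ≤ v → ∀ ζ, act (γ • 1 + K) (act (S v) f) ζ =
      act K' (act (S v) f) ζ + q v ζ := by
    intro v hv ζ
    have hg := hf.act_lonely p β Λ hC hfC hv
    rw [act_add_left, Pi.add_apply, act_smul_left, act_one, hγ, SCBRW.act_branchSum,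
      SCBRW.act_branchSum, ← Finset.sum_sdiff h, Finset.sum_mul]
    simp only [hq, dissipation]
    rw [add_right_comm, ← Finset.sum_add_distrib]
    congr 1
    refine Finset.sum_congr rfl fun x _ => ?_
    rw [← mul_add, add_tsub_cancel_of_le (hg.act_branch_le x ζ)]
  have e : ∫⁻ s in Set.Icc 0 t, act (S' s) (act ((γ • 1 + K) * S (t - s)) f) ξ =
      (∫⁻ s in Set.Icc 0 t, act (S' s) (act (K' * S (t - s)) f) ξ) +
      ∫⁻ s in Set.Icc 0 t, act (S' s) (q (t - s)) ξ := by
    simp only [act_mul]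
    rw [← lintegral_add_left (hmeas K')]
    refine setLIntegral_congr_fun measurableSet_Icc fun s hs => ?_
    rw [← act_add_apply]
    congr 1
    funext ζ
    exact hK' _ (sub_nonneg.mpr hs.2) ζ
  rw [e] at hD
  have hfin : ∫⁻ s in Set.Icc 0 t, act (S' s) (act (K' * S (t - s)) f) ξ ≠ ∞ := by
    have hb : ∀ s ∈ Set.Icc 0 t, act (S' s) (act (K' * S (t - s)) f) ξ ≤
        ENNReal.ofReal (clockRate β Λ') * C := by
      intro s hs
      refine act_lonely_le p β Λ' (fun ζ => ?_) hs.1 ξ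
      rw [act_mul, SCBRW.act_branchSum, ofReal_clockRate, Finset.sum_mul]
      refine Finset.sum_le_sum fun x _ => mul_le_mul_right ?_ _
      exact ((hf.act_lonely p β Λ hC hfC (sub_nonneg.mpr hs.2)).act_branch_le x ζ).trans
        (hgC _ (sub_nonneg.mpr hs.2) ζ)
    refine ((setLIntegral_mono' measurableSet_Icc hb).trans_lt ?_).ne
    rw [setLIntegral_const]
    exact ENNReal.mul_lt_top (ENNReal.mul_lt_top ENNReal.ofReal_lt_top hC.lt_top)
      (by rw [Real.volume_Icc]; exact ENNReal.ofReal_lt_top)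
  rw [add_comm (act (S t) f ξ), ← add_assoc, add_comm (act (S' t) f ξ), add_assoc] at hD
  exact ((ENNReal.add_right_inj hfin).mp hD).symm

theorem lonely_antitone {Λ' : Finset (Site d)} (h : Λ ⊆ Λ') (hf : Conc φ f) {C : ℝ≥0∞}
    (hC : C ≠ ∞) (hfC : ∀ ξ, f ξ ≤ C) (t : ℝ) (ξ : FinConfig d) :
    act (lonely p β Λ' t) f ξ ≤ act (lonely p β Λ t) f ξ := by
  rw [← lonely_add_dissipation p β h hf hC hfC t ξ]
  exact le_self_add

theorem lonely_le_motion (Λ : Finset (Site d)) (hf : Conc φ f) {C : ℝ≥0∞}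
    (hC : C ≠ ∞) (hfC : ∀ ξ, f ξ ≤ C) (t : ℝ) (ξ : FinConfig d) :
    act (lonely p β Λ t) f ξ ≤ act (motion p 0 t) f ξ := by
  rw [← lonely_empty p β]
  exact lonely_antitone p β (Finset.empty_subset Λ) hf hC hfC t ξ

theorem lonely_add_dissipation_motion (Λ : Finset (Site d)) (hf : Conc φ f) {C : ℝ≥0∞}
    (hC : C ≠ ∞) (hfC : ∀ ξ, f ξ ≤ C) (t : ℝ) (ξ : FinConfig d) :
    act (lonely p β Λ t) f ξ + ∫⁻ s in Set.Icc 0 t, act (lonely p β Λ s)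
      (dissipation β Λ (act (motion p 0 (t - s)) f)) ξ = act (motion p 0 t) f ξ := by
  have h := lonely_add_dissipation p β (Finset.empty_subset Λ) hf hC hfC t ξ
  simpa only [lonely_empty, Finset.sdiff_empty] using h

end

end SCBRW

namespace SCBRW

noncomputable section

open Ker

/-! ### The first jump of a perturbed flow -/

section FirstJump

variable {X : Type*}

/-- The identity kernel, from time zero on. -/
def unitStep (t : ℝ) : Ker X := if t < 0 then 0 else 1

theorem unitStep_causal : Causal (unitStep : ℝ → Ker X) := fun t ht => by
  rw [unitStep, if_pos ht]

theorem unitStep_meas : TMeas (unitStep : ℝ → Ker X) := fun x y => by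
  have : (fun t => (unitStep t : Ker X) x y) = fun t => if t < 0 then 0 else (1 : Ker X) x y := by
    funext t
    unfold unitStep
    split_ifs <;> rfl
  rw [this]
  exact Measurable.ite measurableSet_Iio measurable_const measurable_const

theorem act_conv_unitStep [Countable X] {G : ℝ → Ker X} (hG : TMeas G) (hG' : Causal G)
    (g : X → ℝ≥0∞) (t : ℝ) (x : X) :
    act (conv unitStep G t) g x = ∫⁻ s in Set.Icc 0 t, act (G s) g x := by
  rw [act_conv_Icc unitStep_meas hG unitStep_causal hG', ← lintegral_Icc_sub (fun s => act (G s) g x)]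
  refine setLIntegral_congr_fun measurableSet_Icc fun s hs => ?_
  simp only [unitStep, if_neg (not_lt.mpr hs.1), act_one]

open Classical in
/-- The kernel that multiplies by `r`. -/
def diag (r : X → ℝ≥0∞) : Ker X := fun x y => if y = x then r x else 0

theorem act_diag (r : X → ℝ≥0∞) (g : X → ℝ≥0∞) (x : X) : act (diag r) g x = r x * g x := by
  unfold act diag
  rw [tsum_eq_single x]
  · simp
  · intro y hy
    simp [hy]

variable [Countable X] {k l : Ker X} {r : X → ℝ}

theorem flow_add_conv (h : ∀ x y, k x y ≠ 0 → r y = r x) (hr : ∀ x, 0 ≤ r x) (t : ℝ) :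
    flow k r t + conv unitStep (fun s => diag (fun x => ENNReal.ofReal (r x)) * flow k r s) t =
      unitStep t + conv unitStep (fun s => k * flow k r s) t := by
  have mF := flow_meas k r
  have cF := flow_causal k r
  have cG : ∀ k' : Ker X, Causal fun s => k' * flow k r s := fun k' s hs => by
    simp only [cF s hs, mul_zero]
  rcases lt_or_ge t 0 with ht | ht
  · rw [cF t ht, unitStep_causal t ht, Causal.conv unitStep_causal (cG _) t ht,
      Causal.conv unitStep_causal (cG _) t ht]
  refine ext_act fun g x => ?_
  rw [act_add_left, act_add_left, Pi.add_apply, Pi.add_apply,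
    act_conv_unitStep ((TMeas.const _).mul mF) (cG _),
    act_conv_unitStep ((TMeas.const _).mul mF) (cG _), unitStep, if_neg (not_lt.mpr ht), act_one]
  simp only [act_mul, act_diag]
  rw [lintegral_const_mul _ (mF.act g x), flow_first_jump h hr ht]

/-- The backward equation of the perturbed semigroup in integrated form, obtained by inserting the
perturbation equation into the one for the flow. It permits a comparison with a chain whose exit
rates are different. -/
theorem act_dyson_flow_add (h : ∀ x y, k x y ≠ 0 → r y = r x) (hr : ∀ x, 0 ≤ r x) {t : ℝ}
    (ht : 0 ≤ t) (g : X → ℝ≥0∞) (x : X) :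
    act (dyson (flow k r) l t) g x +
      ENNReal.ofReal (r x) * ∫⁻ s in Set.Icc 0 t, act (dyson (flow k r) l s) g x =
      g x + ∫⁻ s in Set.Icc 0 t,
        (act k (act (dyson (flow k r) l s) g) x + act l (act (dyson (flow k r) l s) g) x) := by
  set N := flow k r
  set S := dyson N l with hSdef
  set D := diag fun x => ENNReal.ofReal (r x)
  set J : ℝ → Ker X := unitStep
  have mN : TMeas N := flow_meas k r
  have mJ : TMeas J := unitStep_meas
  have mS : TMeas S := dyson_meas mN
  have cS : Causal S := dyson_causal (flow_causal k r)
  have mlS : TMeas fun s => l * S s := (TMeas.const _).mul mS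
  have mk : ∀ (k' : Ker X) {F : ℝ → Ker X}, TMeas F → TMeas fun s => k' * F s :=
    fun k' F hF => (TMeas.const k').mul hF
  have cG : ∀ k' : Ker X, Causal fun s => k' * S s := fun k' s hs => by
    simp only [cS s hs, mul_zero]
  have hS : ∀ t, S t = N t + conv N (fun s => l * S s) t := fun t => by
    rw [← mul_mid_conv]; exact dyson_left mN t
  have hN : ∀ t, N t + conv J (fun s => D * N s) t = J t + conv J (fun s => k * N s) t :=
    flow_add_conv h hr
  have e1 : ∀ k' : Ker X, conv J (fun s => k' * S s) t =
      conv J (fun s => k' * N s) t + conv (conv J fun s => k' * N s) (fun s => l * S s) t := by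
    intro k'
    rw [conv_assoc mJ (mk k' mN) mlS, ← conv_add mJ (mk k' mN)]
    congr 1
    funext s
    rw [mul_conv mN mlS, ← mul_add, ← hS]
  have key : S t + conv J (fun s => D * S s) t =
      J t + (conv J (fun s => k * S s) t + conv J (fun s => l * S s) t) := by
    have h2 : conv N (fun s => l * S s) t + conv (conv J fun s => D * N s) (fun s => l * S s) t =
        conv J (fun s => l * S s) t + conv (conv J fun s => k * N s) (fun s => l * S s) t := by
      rw [← add_conv mN mlS, ← add_conv mJ mlS, funext hN]
    calc _ = (N t + conv J (fun s => D * N s) t) +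
        (conv N (fun s => l * S s) t + conv (conv J fun s => D * N s) (fun s => l * S s) t) := by
          rw [e1, hS t]; abel
      _ = _ := by rw [hN, h2, e1 k]; abel
  have key2 := congrArg (fun k => act k g x) key
  simp only [act_add_left, Pi.add_apply] at key2
  rw [act_conv_unitStep (mk _ mS) (cG _), act_conv_unitStep (mk _ mS) (cG _),
    act_conv_unitStep (mk _ mS) (cG _)] at key2
  simp only [act_mul, D, act_diag, J, unitStep, if_neg (not_lt.mpr ht), act_one] at key2
  rw [lintegral_const_mul _ (mS.act g x), ← lintegral_add_left] at key2
  · exact key2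
  · exact (TMeas.const k).act_act (fun y => mS.act g y) x

end FirstJump

/-! ### Exponential waiting times -/

/-- Tonelli on the triangle `s + v ≤ t`, with inner integral `1 - e^{-q(t - v)}`. -/
theorem exp_conv_lintegral {q t : ℝ} (hq : 0 ≤ q) {G : ℝ → ℝ≥0∞} (hG : Measurable G) :
    ENNReal.ofReal q * (∫⁻ s in Set.Icc 0 t, ENNReal.ofReal (Real.exp (-(q * s))) *
        ∫⁻ v in Set.Icc 0 (t - s), G v) +
      ∫⁻ s in Set.Icc 0 t, ENNReal.ofReal (Real.exp (-(q * s))) * G (t - s) =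
      ∫⁻ v in Set.Icc 0 t, G v := by
  set E : ℝ → ℝ≥0∞ := fun s => ENNReal.ofReal (Real.exp (-(q * s))) with hE
  have mE : Measurable E := by rw [hE]; fun_prop
  have h1 : ∫⁻ s in Set.Icc 0 t, E s * ∫⁻ v in Set.Icc 0 (t - s), G v =
      ∫⁻ v in Set.Icc 0 t, (∫⁻ s in Set.Icc 0 (t - v), E s) * G v := by
    have e1 : ∀ s, E s * ∫⁻ v in Set.Icc 0 (t - s), G v =
        ∫⁻ v, (Set.Icc 0 (t - s)).indicator (fun v => E s * G v) v := by
      intro s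
      rw [lintegral_indicator measurableSet_Icc, lintegral_const_mul _ hG]
    have e2 : ∀ v, (∫⁻ s in Set.Icc 0 (t - v), E s) * G v =
        ∫⁻ s, (Set.Icc 0 (t - v)).indicator (fun s => E s * G v) s := by
      intro v
      rw [lintegral_indicator measurableSet_Icc, lintegral_mul_const _ mE]
    simp only [e1, e2]
    rw [← lintegral_indicator measurableSet_Icc, ← lintegral_indicator measurableSet_Icc]
    have e3 : ∀ s, (Set.Icc 0 t).indicator (fun s => ∫⁻ v, (Set.Icc 0 (t - s)).indicator
        (fun v => E s * G v) v) s =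
        ∫⁻ v, {a : ℝ × ℝ | 0 ≤ a.1 ∧ 0 ≤ a.2 ∧ a.1 + a.2 ≤ t}.indicator
          (fun a => E a.1 * G a.2) (s, v) := by
      intro s
      by_cases hs : s ∈ Set.Icc 0 t
      · rw [Set.indicator_of_mem hs]
        refine lintegral_congr fun v => ?_
        simp only [Set.indicator_apply, Set.mem_Icc, Set.mem_ofPred_eq]
        refine if_congr ?_ rfl rfl
        exact ⟨fun h => ⟨hs.1, h.1, by linarith [h.2]⟩, fun h => ⟨h.2.1, by linarith [h.2.2]⟩⟩
      · rw [Set.indicator_of_notMem hs]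
        rw [← lintegral_zero (μ := (volume : Measure ℝ))]
        refine lintegral_congr fun v => ?_
        rw [Set.indicator_of_notMem]
        rintro ⟨h1, h2, h3⟩
        exact hs ⟨h1, by simp only at h2 h3; linarith⟩
    have e4 : ∀ v, (Set.Icc 0 t).indicator (fun v => ∫⁻ s, (Set.Icc 0 (t - v)).indicator
        (fun s => E s * G v) s) v =
        ∫⁻ s, {a : ℝ × ℝ | 0 ≤ a.1 ∧ 0 ≤ a.2 ∧ a.1 + a.2 ≤ t}.indicator
          (fun a => E a.1 * G a.2) (s, v) := by
      intro v
      by_cases hv : v ∈ Set.Icc 0 t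
      · rw [Set.indicator_of_mem hv]
        refine lintegral_congr fun s => ?_
        simp only [Set.indicator_apply, Set.mem_Icc, Set.mem_ofPred_eq]
        refine if_congr ?_ rfl rfl
        exact ⟨fun h => ⟨h.1, hv.1, by linarith [h.2]⟩, fun h => ⟨h.1, by linarith [h.2.2]⟩⟩
      · rw [Set.indicator_of_notMem hv]
        rw [← lintegral_zero (μ := (volume : Measure ℝ))]
        refine lintegral_congr fun s => ?_
        rw [Set.indicator_of_notMem]
        rintro ⟨h1, h2, h3⟩
        exact hv ⟨h2, by simp only at h1 h3; linarith⟩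
    simp only [e3, e4]
    refine lintegral_lintegral_swap (Measurable.aemeasurable ?_)
    refine Measurable.indicator (by fun_prop) ?_
    exact ((measurableSet_le measurable_const measurable_fst).inter
      ((measurableSet_le measurable_const measurable_snd).inter
      (measurableSet_le (measurable_fst.add measurable_snd) measurable_const)))
  have mI : Measurable fun v => (∫⁻ s in Set.Icc 0 (t - v), E s) * G v := by
    refine Measurable.mul (Antitone.measurable fun v w hvw => ?_) hG
    exact lintegral_mono_set (Set.Icc_subset_Icc_right (by linarith))
  rw [h1, ← lintegral_Icc_sub (fun s => E s * G (t - s)) t, ← lintegral_const_mul _ mI,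
    ← lintegral_add_left (mI.const_mul _)]
  refine setLIntegral_congr_fun measurableSet_Icc fun v hv => ?_
  have h2 := exp_add_lintegral hq (sub_nonneg.mpr hv.2) 1
  simp only [mul_one] at h2
  have h3 : ∫⁻ s in Set.Icc 0 (t - v), E s * ENNReal.ofReal q =
      (∫⁻ s in Set.Icc 0 (t - v), E s) * ENNReal.ofReal q := lintegral_mul_const _ mE
  rw [h3, mul_comm (lintegral _ _)] at h2
  simp only [sub_sub_cancel]
  rw [← mul_assoc, ← add_mul, add_comm, h2, one_mul]

/-- Variation of constants without derivatives: `hWH` says `W' = H - m W` with `W 0 = f`, and `hRH`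
says `W' ≥ R - q W`. The bound `C` makes the integrals finite, so that terms can be cancelled. -/
theorem le_of_generator_le {q m t : ℝ} {f C : ℝ≥0∞} (hq : 0 ≤ q) (ht : 0 ≤ t)
    {W H R : ℝ → ℝ≥0∞} (hW : Measurable W) (hH : Measurable H)
    (hR : Measurable R) (hC : C ≠ ∞) (hWC : ∀ v, 0 ≤ v → W v ≤ C)
    (hHC : ∀ v, 0 ≤ v → H v ≤ C)
    (hWH : ∀ t, 0 ≤ t → W t + ENNReal.ofReal m * ∫⁻ s in Set.Icc 0 t, W s =
      f + ∫⁻ s in Set.Icc 0 t, H s)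
    (hRH : ∀ v, 0 ≤ v → R v + ENNReal.ofReal m * W v ≤ H v + ENNReal.ofReal q * W v) :
    ENNReal.ofReal (Real.exp (-(q * t))) * f +
      ∫⁻ s in Set.Icc 0 t, ENNReal.ofReal (Real.exp (-(q * s))) * R (t - s) ≤ W t := by
  set E : ℝ → ℝ≥0∞ := fun s => ENNReal.ofReal (Real.exp (-(q * s))) with hE
  have mE : Measurable E := by rw [hE]; fun_prop
  set Q := ENNReal.ofReal q
  set m' := ENNReal.ofReal m
  have mI : ∀ {G : ℝ → ℝ≥0∞}, Measurable fun s => ∫⁻ v in Set.Icc 0 (t - s), G v := by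
    intro G
    refine Antitone.measurable fun v w hvw => ?_
    exact lintegral_mono_set (Set.Icc_subset_Icc_right (by linarith))
  have mEW : Measurable fun s => E s * W (t - s) := mE.mul (hW.comp (by fun_prop))
  have mEH : Measurable fun s => E s * H (t - s) := mE.mul (hH.comp (by fun_prop))
  have mER : Measurable fun s => E s * R (t - s) := mE.mul (hR.comp (by fun_prop))
  set EW := ∫⁻ s in Set.Icc 0 t, E s * W (t - s) with hEW
  set EH := ∫⁻ s in Set.Icc 0 t, E s * H (t - s) with hEH
  set ER := ∫⁻ s in Set.Icc 0 t, E s * R (t - s) with hER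
  set IW := ∫⁻ s in Set.Icc 0 t, E s * ∫⁻ v in Set.Icc 0 (t - s), W v with hIW
  set IH := ∫⁻ s in Set.Icc 0 t, E s * ∫⁻ v in Set.Icc 0 (t - s), H v with hIH
  have cW : Q * IW + EW = ∫⁻ v in Set.Icc 0 t, W v := exp_conv_lintegral hq hW
  have cH : Q * IH + EH = ∫⁻ v in Set.Icc 0 t, H v := exp_conv_lintegral hq hH
  have fin : ∀ {G : ℝ → ℝ≥0∞}, (∀ v, 0 ≤ v → G v ≤ C) → ∫⁻ v in Set.Icc 0 t, G v ≠ ∞ := by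
    intro G hG
    refine ((setLIntegral_mono' measurableSet_Icc fun v hv => hG v hv.1).trans_lt ?_).ne
    rw [setLIntegral_const, Real.volume_Icc]
    exact ENNReal.mul_lt_top hC.lt_top ENNReal.ofReal_lt_top
  have fW := fin hWC
  have fH := fin hHC
  have fEW : EW ≠ ∞ := ne_top_of_le_ne_top fW (cW ▸ le_add_self)
  have fQIH : Q * IH ≠ ∞ := ne_top_of_le_ne_top fH (cH ▸ le_self_add)
  have fQIW : Q * IW ≠ ∞ := ne_top_of_le_ne_top fW (cW ▸ le_self_add)
  have hE0 : E t * f + Q * ((∫⁻ s in Set.Icc 0 t, E s) * f) = f := by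
    have h3 : ∫⁻ s in Set.Icc 0 t, E s * (Q * f) = (∫⁻ s in Set.Icc 0 t, E s) * (Q * f) :=
      lintegral_mul_const _ mE
    rw [mul_left_comm, ← h3]
    exact exp_add_lintegral hq ht f
  have hc : EW + m' * IW = (∫⁻ s in Set.Icc 0 t, E s) * f + IH := by
    have h3 : ∫⁻ s in Set.Icc 0 t, E s * f = (∫⁻ s in Set.Icc 0 t, E s) * f :=
      lintegral_mul_const _ mE
    have h4 : ∫⁻ s in Set.Icc 0 t, m' * (E s * ∫⁻ v in Set.Icc 0 (t - s), W v) = m' * IW :=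
      lintegral_const_mul _ (mE.mul mI)
    have mEf : Measurable fun s => E s * f := mE.mul_const _
    rw [← h3, ← h4, hEW, ← lintegral_add_left mEW, hIH, ← lintegral_add_left mEf]
    refine setLIntegral_congr_fun measurableSet_Icc fun s hs => ?_
    have := hWH (t - s) (sub_nonneg.mpr hs.2)
    rw [← mul_add, ← this]
    ring
  have h1 : W t + m' * EW = E t * f + EH + Q * EW := by
    have h2 := hWH t ht
    rw [← cW, ← cH] at h2
    have h3 : W t + m' * EW + (Q * (m' * IW)) = E t * f + EH + Q * EW + (Q * (m' * IW)) := by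
      calc _ = W t + m' * (Q * IW + EW) := by ring
        _ = f + (Q * IH + EH) := h2
        _ = (E t * f + Q * ((∫⁻ s in Set.Icc 0 t, E s) * f)) + (Q * IH + EH) := by rw [hE0]
        _ = E t * f + EH + Q * ((∫⁻ s in Set.Icc 0 t, E s) * f + IH) := by ring
        _ = E t * f + EH + Q * (EW + m' * IW) := by rw [hc]
        _ = _ := by ring
    have hfin : Q * (m' * IW) ≠ ∞ := by
      rw [mul_left_comm]
      exact ENNReal.mul_ne_top ENNReal.ofReal_ne_top fQIW
    exact (ENNReal.add_left_inj hfin).mp h3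
  have h4 : ER + m' * EW ≤ EH + Q * EW := by
    rw [hER, hEW, ← lintegral_const_mul _ mEW, ← lintegral_const_mul _ mEW,
      ← lintegral_add_left mER, hEH, ← lintegral_add_left mEH]
    refine setLIntegral_mono' measurableSet_Icc fun s hs => ?_
    calc _ = E s * (R (t - s) + m' * W (t - s)) := by ring
      _ ≤ E s * (H (t - s) + Q * W (t - s)) :=
        mul_le_mul_right (hRH _ (sub_nonneg.mpr hs.2)) _
      _ = _ := by ring
  have hfin2 : m' * EW ≠ ∞ := ENNReal.mul_ne_top ENNReal.ofReal_ne_top fEW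
  refine (ENNReal.add_le_add_iff_right hfin2).mp ?_
  rw [h1, add_assoc, add_assoc]
  exact add_le_add le_rfl h4

end

end SCBRW

namespace SCBRW

noncomputable section

open Ker

/-! ### The self-catalytic system is dominated by the lonely branching system -/

variable {d : ℕ} (p : PMF (Site d)) (b : ℕ → ℝ≥0) (Λ : Finset (Site d))

open Classical in
/-- The branching part of the jump rates. -/
def splitKer : Ker (FinConfig d) := fun ξ ζ =>
  ∑ x ∈ ξ.support, ((b (ξ x) : ℝ≥0∞) / 2) *
    ((if addAt ξ x = ζ then 1 else 0) + (if removeAt ξ x = ζ then 1 else 0))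

theorem act_splitKer (g : FinConfig d → ℝ≥0∞) (ξ : FinConfig d) :
    act (splitKer b) g ξ = ∑ x ∈ ξ.support,
      (b (ξ x) : ℝ≥0∞) * (2⁻¹ * (g (addAt ξ x) + g (removeAt ξ x))) := by
  classical
  unfold act splitKer
  simp only [Finset.sum_mul]
  rw [Summable.tsum_finsetSum fun _ _ => ENNReal.summable]
  refine Finset.sum_congr rfl fun x _ => ?_
  simp only [mul_assoc, ENNReal.tsum_mul_left, add_mul, ENNReal.tsum_add, div_eq_mul_inv]
  have h : ∀ a : FinConfig d, ∑' ζ, (if a = ζ then 1 else 0) * g ζ = g a := by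
    intro a
    simp only [eq_comm (a := a)]
    exact tsum_ite_mul a g
  rw [← h, ← h]

/-- The jump rates, including those of the jumps that do not change the configuration. -/
def fullKer : Ker (FinConfig d) := jumpKer p + splitKer b

theorem rate_eq (ξ ζ : FinConfig d) :
    rate p b ξ ζ = if ζ = ξ then 0 else fullKer p b ξ ζ := by
  unfold rate
  split_ifs
  · rfl
  · rw [fullKer, Ker.add_apply]
    congr 1

/-- `rate` omits jumps that leave the configuration unchanged, which occur if `p 0 > 0`. Adding them
to both the gain and the exit rate has no effect on the generator and makes the sums explicit. -/
theorem act_rate_add (g : FinConfig d → ℝ≥0∞) (ξ : FinConfig d) :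
    ∑' ζ, rate p b ξ ζ * g ζ + fullKer p b ξ ξ * g ξ =
      act (jumpKer p) g ξ + act (splitKer b) g ξ := by
  classical
  have h : act (jumpKer p) g ξ + act (splitKer b) g ξ = act (fullKer p b) g ξ := by
    rw [fullKer, act_add_left, Pi.add_apply]
  have h2 : fullKer p b ξ ξ * g ξ =
      ∑' ζ, (if ζ = ξ then 1 else 0) * (fullKer p b ξ ζ * g ζ) :=
    (tsum_ite_mul ξ fun ζ => fullKer p b ξ ζ * g ζ).symm
  rw [h, h2, ← ENNReal.tsum_add, act]
  refine tsum_congr fun ζ => ?_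
  rw [rate_eq]
  split_ifs <;> simp

theorem exitRate_add (ξ : FinConfig d) :
    exitRate p b ξ + fullKer p b ξ ξ =
      ξ.degree + ∑ x ∈ ξ.support, (b (ξ x) : ℝ≥0∞) := by
  have h := act_rate_add p b (fun _ => 1) ξ
  simp only [mul_one] at h
  rw [exitRate, h, act_jumpKer_one, act_splitKer]
  congr 1
  refine Finset.sum_congr rfl fun x _ => ?_
  rw [one_add_one_eq_two, ENNReal.inv_mul_cancel two_ne_zero ENNReal.ofNat_ne_top, mul_one]

theorem exitRate_add_ne_top (ξ : FinConfig d) :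
    exitRate p b ξ + fullKer p b ξ ξ ≠ ∞ := by
  rw [exitRate_add]
  exact ENNReal.add_ne_top.mpr ⟨ENNReal.natCast_ne_top _,
    ENNReal.sum_ne_top.mpr fun x _ => ENNReal.coe_ne_top⟩

theorem ofReal_toReal_exitRate (ξ : FinConfig d) :
    ENNReal.ofReal (exitRate p b ξ).toReal = exitRate p b ξ :=
  ENNReal.ofReal_toReal (ENNReal.add_ne_top.mp (exitRate_add_ne_top p b ξ)).1

variable {φ : Site d → ℝ≥0∞} {f g : FinConfig d → ℝ≥0∞}

theorem Conc.split_le (hg : Conc φ g) {ξ : FinConfig d} {x : Site d} (hx : ξ x ≠ 0) :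
    2⁻¹ * (g (addAt ξ x) + g (removeAt ξ x)) ≤ g ξ := by
  have h := hg.sub (removeAt ξ x) x x
  rw [addAt_removeAt hx, ← two_mul] at h
  calc _ ≤ 2⁻¹ * (2 * g ξ) := mul_le_mul_right h _
    _ = _ := by
      rw [← mul_assoc, ENNReal.inv_mul_cancel two_ne_zero ENNReal.ofNat_ne_top, one_mul]

/-- Comparison of the branching generators. At sites of `Λ` with exactly one particle they coincide.
At other sites of `Λ` the lonely clock does nothing, and every remaining branching of the true
system lowers `g` on average. -/
theorem Conc.splitKer_le (hg : Conc φ g) (ξ : FinConfig d) :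
    act (splitKer b) g ξ + ENNReal.ofReal (clockRate (b 1) Λ) * g ξ ≤
      act (branchSum (b 1) Λ) g ξ + (∑ x ∈ ξ.support, (b (ξ x) : ℝ≥0∞)) * g ξ := by
  classical
  rw [act_splitKer, SCBRW.act_branchSum, ofReal_clockRate, Finset.sum_mul, Finset.sum_mul,
    ← Finset.sum_filter_add_sum_filter_not Λ (fun x => ξ x = 1),
    ← Finset.sum_filter_add_sum_filter_not Λ (fun x => ξ x = 1)]
  have hI : Λ.filter (fun x => ξ x = 1) ⊆ ξ.support := fun x hx => by
    rw [Finsupp.mem_support_iff, (Finset.mem_filter.mp hx).2]; exact one_ne_zero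
  rw [← Finset.sum_sdiff hI, ← Finset.sum_sdiff hI]
  have e1 : ∑ x ∈ Λ.filter (fun x => ξ x = 1),
      (b (ξ x) : ℝ≥0∞) * (2⁻¹ * (g (addAt ξ x) + g (removeAt ξ x))) =
      ∑ x ∈ Λ.filter (fun x => ξ x = 1), (b 1 : ℝ≥0∞) * act (branchKer x) g ξ := by
    refine Finset.sum_congr rfl fun x hx => ?_
    rw [act_branchKer, if_pos (Finset.mem_filter.mp hx).2, (Finset.mem_filter.mp hx).2]
  have e2 : ∑ x ∈ Λ.filter (fun x => ¬ ξ x = 1), (b 1 : ℝ≥0∞) * act (branchKer x) g ξ =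
      ∑ x ∈ Λ.filter (fun x => ¬ ξ x = 1), (b 1 : ℝ≥0∞) * g ξ := by
    refine Finset.sum_congr rfl fun x hx => ?_
    rw [act_branchKer, if_neg (Finset.mem_filter.mp hx).2]
  have e3 : ∑ x ∈ Λ.filter (fun x => ξ x = 1), (b (ξ x) : ℝ≥0∞) * g ξ =
      ∑ x ∈ Λ.filter (fun x => ξ x = 1), (b 1 : ℝ≥0∞) * g ξ := by
    refine Finset.sum_congr rfl fun x hx => ?_
    rw [(Finset.mem_filter.mp hx).2]
  have e4 : ∑ x ∈ ξ.support \ Λ.filter (fun x => ξ x = 1),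
      (b (ξ x) : ℝ≥0∞) * (2⁻¹ * (g (addAt ξ x) + g (removeAt ξ x))) ≤
      ∑ x ∈ ξ.support \ Λ.filter (fun x => ξ x = 1), (b (ξ x) : ℝ≥0∞) * g ξ :=
    Finset.sum_le_sum fun x hx => mul_le_mul_right
      (hg.split_le (Finsupp.mem_support_iff.mp (Finset.mem_sdiff.mp hx).1)) _
  rw [e1, e2, e3]
  refine (add_le_add (add_le_add e4 le_rfl) le_rfl).trans (le_of_eq ?_)
  abel

theorem Conc.rate_le (hg : Conc φ g) (hgfin : ∀ ξ, g ξ ≠ ∞) (ξ : FinConfig d) :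
    ∑' ζ, rate p b ξ ζ * g ζ + ENNReal.ofReal (ξ.degree + clockRate (b 1) Λ) * g ξ ≤
      act (jumpKer p) g ξ + act (branchSum (b 1) Λ) g ξ +
        ENNReal.ofReal (exitRate p b ξ).toReal * g ξ := by
  rw [ofReal_toReal_exitRate, ENNReal.ofReal_add (by positivity) (clockRate_nonneg _ _),
    ENNReal.ofReal_natCast]
  set s := fullKer p b ξ ξ
  have hs : s * g ξ ≠ ∞ := ENNReal.mul_ne_top
    (ENNReal.add_ne_top.mp (exitRate_add_ne_top p b ξ)).2 (hgfin ξ)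
  refine (ENNReal.add_le_add_iff_right hs).mp ?_
  calc _ = (∑' ζ, rate p b ξ ζ * g ζ + s * g ξ) +
        (ξ.degree + ENNReal.ofReal (clockRate (b 1) Λ)) * g ξ := by ring
    _ = act (jumpKer p) g ξ + ξ.degree * g ξ +
        (act (splitKer b) g ξ + ENNReal.ofReal (clockRate (b 1) Λ) * g ξ) := by
      rw [act_rate_add]; ring
    _ ≤ act (jumpKer p) g ξ + ξ.degree * g ξ +
        (act (branchSum (b 1) Λ) g ξ + (∑ x ∈ ξ.support, (b (ξ x) : ℝ≥0∞)) * g ξ) :=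
      add_le_add le_rfl (hg.splitKer_le b Λ ξ)
    _ = act (jumpKer p) g ξ + act (branchSum (b 1) Λ) g ξ +
        (ξ.degree + ∑ x ∈ ξ.support, (b (ξ x) : ℝ≥0∞)) * g ξ := by ring
    _ = act (jumpKer p) g ξ + act (branchSum (b 1) Λ) g ξ +
        (exitRate p b ξ + s) * g ξ := by rw [exitRate_add]
    _ = _ := by ring

/-- This direction needs no measurability, so none has to be proved for `transAux` or `finDimProb`.
-/
theorem tsum_lintegral_le {ι α : Type*} [MeasurableSpace α] {μ : Measure α}
    (F : ι → α → ℝ≥0∞) : ∑' i, ∫⁻ a, F i a ∂μ ≤ ∫⁻ a, ∑' i, F i a ∂μ := by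
  classical
  refine ENNReal.summable.tsum_le_of_sum_le fun s => ?_
  refine le_trans ?_ (lintegral_mono fun a => ENNReal.sum_le_tsum s)
  induction s using Finset.induction_on with
  | empty => simp
  | insert i s hi ih =>
    simp only [Finset.sum_insert hi]
    exact (add_le_add le_rfl ih).trans (le_lintegral_add _ _)

/-- Induction on the number of jumps. After the first jump the induction hypothesis bounds the mean
by that of the lonely system, a concave function of the configuration. `Conc.rate_le` and
`le_of_generator_le` then show that the lonely means are a supersolution of the first jump equation
of the chain. -/
theorem transAux_act_le (hf : Conc φ f) {C : ℝ≥0∞} (hC : C ≠ ∞) (hfC : ∀ ξ, f ξ ≤ C) (n : ℕ)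
    {t : ℝ} (ht : 0 ≤ t) (ξ : FinConfig d) :
    ∑' ζ, transAux p b n t ξ ζ * f ζ ≤ act (lonely p (b 1) Λ t) f ξ := by
  classical
  induction n generalizing t ξ with
  | zero => simp [transAux]
  | succ n ih =>
    set q := (exitRate p b ξ).toReal
    set S := lonely p (b 1) Λ with hS
    have mS : TMeas S := lonely_meas p (b 1) Λ
    have hSC : ∀ v, 0 ≤ v → ∀ ζ, act (S v) f ζ ≤ C := fun v hv => act_lonely_le p _ Λ hfC hv
    have hmain := le_of_generator_le (q := q) (m := ξ.degree + clockRate (b 1) Λ) (f := f ξ)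
      (C := C + (ξ.degree * C + ENNReal.ofReal (clockRate (b 1) Λ) * C))
      (W := fun v => act (S v) f ξ)
      (H := fun v => act (jumpKer p) (act (S v) f) ξ + act (branchSum (b 1) Λ) (act (S v) f) ξ)
      (R := fun v => ∑' ζ, rate p b ξ ζ * act (S v) f ζ) ENNReal.toReal_nonneg ht
      (mS.act f ξ) (((TMeas.const _).act_act (fun y => mS.act f y) ξ).add
        ((TMeas.const _).act_act (fun y => mS.act f y) ξ))
      (Measurable.tsum fun ζ => (mS.act f ζ).const_mul _)
      (ENNReal.add_ne_top.mpr ⟨hC, ENNReal.add_ne_top.mpr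
        ⟨ENNReal.mul_ne_top (ENNReal.natCast_ne_top _) hC,
          ENNReal.mul_ne_top ENNReal.ofReal_ne_top hC⟩⟩)
      (fun v hv => (hSC v hv ξ).trans le_self_add)
      (fun v hv => ?_)
      (fun v hv => act_dyson_flow_add (jumpKer_invariant p _)
        (fun ξ => add_nonneg (by positivity) (clockRate_nonneg _ _)) hv f ξ)
      (fun v hv => (hf.act_lonely p (b 1) Λ hC hfC hv).rate_le p b Λ
        (fun ζ => ((hSC v hv ζ).trans_lt hC.lt_top).ne) ξ)
    · refine le_trans ?_ hmain
      simp only [transAux, add_mul, ENNReal.tsum_add]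
      refine add_le_add (le_of_eq ?_) ?_
      · rw [tsum_eq_single ξ]
        · simp [q]
        · intro ζ hζ
          simp [Ne.symm hζ]
      · refine (ENNReal.tsum_le_tsum fun ζ => lintegral_mul_const_le _ _).trans ?_
        refine (tsum_lintegral_le _).trans (setLIntegral_mono' measurableSet_Icc fun s hs => ?_)
        simp only [mul_assoc, ENNReal.tsum_mul_left]
        refine mul_le_mul_right ?_ _
        simp only [← ENNReal.tsum_mul_right]
        rw [ENNReal.tsum_comm]
        refine ENNReal.tsum_le_tsum fun χ => ?_
        simp only [mul_assoc, ENNReal.tsum_mul_left]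
        exact mul_le_mul_right (ih (sub_nonneg.mpr hs.2) χ) _
    · refine le_trans (add_le_add ?_ ?_) le_add_self
      · refine (act_mono _ (hSC v hv) ξ).trans (le_of_eq ?_)
        have h := act_const_mul (jumpKer p) C (fun _ => 1) ξ
        rw [act_jumpKer_one] at h
        rw [mul_comm, ← h]
        simp
      · rw [act_branchSum, ofReal_clockRate, Finset.sum_mul]
        exact Finset.sum_le_sum fun x _ => mul_le_mul_right
          (((hf.act_lonely p (b 1) Λ hC hfC hv).act_branch_le x ξ).trans (hSC v hv ξ)) _

theorem transAux_mono (n : ℕ) (t : ℝ) (ξ ζ : FinConfig d) :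
    transAux p b n t ξ ζ ≤ transAux p b (n + 1) t ξ ζ := by
  induction n generalizing t ξ with
  | zero => simp [transAux]
  | succ n ih =>
    rw [transAux, transAux]
    refine add_le_add le_rfl (lintegral_mono fun s => mul_le_mul_right ?_ _)
    exact ENNReal.tsum_le_tsum fun χ => mul_le_mul_right (ih _ _) _

theorem trans_act_le (hf : Conc φ f) {C : ℝ≥0∞} (hC : C ≠ ∞) (hfC : ∀ ξ, f ξ ≤ C) (t : ℝ≥0)
    (ξ : FinConfig d) : ∑' ζ, trans p b t ξ ζ * f ζ ≤ act (lonely p (b 1) Λ t) f ξ := by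
  refine ENNReal.summable.tsum_le_of_sum_le fun s => ?_
  simp only [trans, ENNReal.iSup_mul]
  rw [ENNReal.finsetSum_iSup_of_monotone (f := fun ζ n => transAux p b n t ξ ζ * f ζ) fun ζ =>
    monotone_nat_of_le_succ fun n => mul_le_mul_left (transAux_mono p b n t ξ ζ) _]
  exact iSup_le fun n => (ENNReal.sum_le_tsum s).trans
    (transAux_act_le p b Λ hf hC hfC n t.coe_nonneg ξ)

end

end SCBRW

namespace SCBRW

noncomputable section

open Ker

/-! ### Superposition of a Poisson configuration -/

variable {d : ℕ} (p : PMF (Site d)) {μ ν : Site d → ℝ≥0∞}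
  {φ ψ : Site d → ℝ≥0∞} {f g h : FinConfig d → ℝ≥0∞}

open Classical in
/-- A particle is added at `x` at rate `μ x`. -/
def addKer (μ : Site d → ℝ≥0∞) : Ker (FinConfig d) := fun ξ ζ =>
  ∑' x, μ x * if ζ = addAt ξ x then 1 else 0

theorem act_addKer (μ : Site d → ℝ≥0∞) (g : FinConfig d → ℝ≥0∞) (ξ : FinConfig d) :
    act (addKer μ) g ξ = ∑' x, μ x * g (addAt ξ x) := by
  classical
  unfold act addKer
  simp only [← ENNReal.tsum_mul_right]
  rw [ENNReal.tsum_comm]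
  refine tsum_congr fun x => ?_
  simp only [mul_assoc, ENNReal.tsum_mul_left]
  rw [tsum_ite_mul]

theorem act_addKer_addAt (μ : Site d → ℝ≥0∞) (g : FinConfig d → ℝ≥0∞) (ξ : FinConfig d)
    (z : Site d) : act (addKer μ) g (addAt ξ z) = act (addKer μ) (fun ζ => g (addAt ζ z)) ξ := by
  rw [act_addKer, act_addKer]
  simp only [addAt_comm ξ z]

theorem addKer_add (μ ν : Site d → ℝ≥0∞) :
    addKer (fun x => μ x + ν x) = addKer μ + addKer ν := by
  refine ext_act fun g ξ => ?_
  rw [act_add_left, Pi.add_apply, act_addKer, act_addKer, act_addKer, ← ENNReal.tsum_add]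
  simp only [add_mul]

theorem commute_addKer (μ ν : Site d → ℝ≥0∞) : Commute (addKer μ) (addKer ν) := by
  refine commute_of_act fun g ξ => ?_
  simp only [act_addKer, ← ENNReal.tsum_mul_left]
  rw [ENNReal.tsum_comm]
  refine tsum_congr fun x => tsum_congr fun y => ?_
  rw [addAt_comm, mul_left_comm]

/-- The configuration is augmented by a Poisson configuration with intensity `μ`. -/
def poi (μ : Site d → ℝ≥0∞) : Ker (FinConfig d) :=
  ENNReal.ofReal (Real.exp (-(∑' x, μ x).toReal)) • exp (addKer μ)

theorem act_poi (μ : Site d → ℝ≥0∞) (g : FinConfig d → ℝ≥0∞) (ξ : FinConfig d) :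
    act (poi μ) g ξ =
      ENNReal.ofReal (Real.exp (-(∑' x, μ x).toReal)) * act (exp (addKer μ)) g ξ := by
  rw [poi, act_smul_left]

theorem ofReal_exp_neg_mul (r : ℝ) :
    ENNReal.ofReal (Real.exp (-r)) * ENNReal.ofReal (Real.exp r) = 1 := by
  rw [← ENNReal.ofReal_mul (by positivity), ← Real.exp_add]
  simp

theorem act_poi_const (hμ : ∑' x, μ x ≠ ∞) (C : ℝ≥0∞) (ξ : FinConfig d) :
    act (poi μ) (fun _ => C) ξ = C := by
  refine act_const_of_one ?_ C
  rw [act_poi, act_exp_const (r := (∑' x, μ x).toReal) ENNReal.toReal_nonneg, ofReal_exp_neg_mul]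
  intro ξ
  rw [act_addKer, ENNReal.ofReal_toReal hμ]
  simp

theorem poi_add (hμ : ∑' x, μ x ≠ ∞) (hν : ∑' x, ν x ≠ ∞) :
    poi (fun x => μ x + ν x) = poi μ * poi ν := by
  rw [poi, poi, poi, addKer_add, exp_add (commute_addKer μ ν), smul_mul_smul_comm,
    ← ENNReal.ofReal_mul (by positivity), ← Real.exp_add, ENNReal.tsum_add,
    ENNReal.toReal_add hμ hν, neg_add]

theorem act_poi_addAt (μ : Site d → ℝ≥0∞) (g : FinConfig d → ℝ≥0∞) (ξ : FinConfig d)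
    (z : Site d) : act (poi μ) g (addAt ξ z) = act (poi μ) (fun ζ => g (addAt ζ z)) ξ := by
  rw [act_poi, act_poi]
  congr 1
  exact act_exp_comp (addKer μ) (addKer μ) (fun ζ => addAt ζ z)
    (fun g ξ => act_addKer_addAt μ g ξ z) g ξ

theorem Conc.act_poi (hg : Conc φ g) (hμ : ∑' x, μ x ≠ ∞) : Conc φ (act (poi μ) g) where
  mono ξ x := by
    rw [act_poi_addAt]
    exact act_mono _ (fun ζ => hg.mono ζ x) ξ
  lip ξ x := by
    rw [act_poi_addAt]
    refine (act_mono _ (fun ζ => hg.lip ζ x) ξ).trans ?_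
    rw [act_add_apply, act_poi_const hμ]
  sub ξ x y := by
    rw [act_poi_addAt, act_poi_addAt, act_poi_addAt, act_poi_addAt, ← act_add_apply,
      ← act_add_apply]
    exact act_mono _ (fun ζ => hg.sub ζ x y) ξ

theorem Conc.pow_addKer_ge (hg : Conc φ g) (n : ℕ) (ξ : FinConfig d) :
    (∑' x, μ x) ^ n * g ξ ≤ act (addKer μ ^ n) g ξ := by
  induction n generalizing ξ with
  | zero => simp [act_one]
  | succ n ih =>
    rw [pow_succ', pow_succ', act_mul, act_addKer, mul_assoc, ← ENNReal.tsum_mul_right]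
    refine ENNReal.tsum_le_tsum fun x => mul_le_mul_right ?_ _
    exact (mul_le_mul_right (hg.mono ξ x) _).trans (ih _)

/-- Each of the `n` added particles costs at most `φ` at its site. The truncated exponent at `n = 0`
is harmless because of the factor `n`. -/
theorem Conc.pow_addKer_le (hg : Conc φ g) (n : ℕ) (ξ : FinConfig d) :
    act (addKer μ ^ n) g ξ ≤ (∑' x, μ x) ^ n * g ξ +
      n * (∑' x, μ x) ^ (n - 1) * ∑' x, μ x * φ x := by
  induction n generalizing ξ with
  | zero => simp [act_one]
  | succ n ih =>
    set m := ∑' x, μ x with hm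
    rw [pow_succ' (addKer μ), act_mul, act_addKer]
    calc _ ≤ ∑' x, μ x * (m ^ n * (g ξ + φ x) + n * m ^ (n - 1) * ∑' x, μ x * φ x) :=
          ENNReal.tsum_le_tsum fun x => mul_le_mul_right ((ih _).trans
            (add_le_add (mul_le_mul_right (hg.lip ξ x) _) le_rfl)) _
      _ = ∑' x, (μ x * (m ^ n * g ξ + n * m ^ (n - 1) * ∑' x, μ x * φ x) +
          m ^ n * (μ x * φ x)) := tsum_congr fun x => by ring
      _ = m * (m ^ n * g ξ + n * m ^ (n - 1) * ∑' x, μ x * φ x) + m ^ n * ∑' x, μ x * φ x := by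
        rw [ENNReal.tsum_add, ENNReal.tsum_mul_left, ENNReal.tsum_mul_right]
      _ = _ := by
        rcases n with _ | n
        · simp
        · simp only [Nat.add_sub_cancel, Nat.cast_add, Nat.cast_one]
          ring

theorem Conc.le_act_poi (hg : Conc φ g) (hμ : ∑' x, μ x ≠ ∞) (ξ : FinConfig d) :
    g ξ ≤ act (poi μ) g ξ := by
  rw [SCBRW.act_poi, act_exp]
  calc g ξ = ENNReal.ofReal (Real.exp (-(∑' x, μ x).toReal)) *
        (ENNReal.ofReal (Real.exp (∑' x, μ x).toReal) * g ξ) := by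
        rw [← mul_assoc, ofReal_exp_neg_mul, one_mul]
    _ ≤ _ := by
      refine mul_le_mul_right ?_ _
      rw [ofReal_exp_eq_tsum ENNReal.toReal_nonneg, ENNReal.ofReal_toReal hμ,
        ← ENNReal.tsum_mul_right]
      refine ENNReal.tsum_le_tsum fun n => ?_
      rw [mul_assoc]
      exact mul_le_mul_right (hg.pow_addKer_ge n ξ) _

theorem tsum_inv_factorial_mul_pred (m : ℝ≥0∞) :
    ∑' n : ℕ, (n.factorial : ℝ≥0∞)⁻¹ * (n * m ^ (n - 1)) =
      ∑' n : ℕ, (n.factorial : ℝ≥0∞)⁻¹ * m ^ n := by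
  rw [tsum_eq_zero_add' ENNReal.summable]
  simp only [Nat.cast_zero, zero_mul, mul_zero, zero_add, Nat.add_sub_cancel]
  refine tsum_congr fun n => ?_
  rw [← mul_assoc]
  congr 1
  rw [Nat.factorial_succ, Nat.cast_mul, ENNReal.mul_inv (by simp) (by simp), mul_right_comm,
    ENNReal.inv_mul_cancel (by simp) (by simp), one_mul]

theorem Conc.act_poi_le (hg : Conc φ g) (hμ : ∑' x, μ x ≠ ∞) (ξ : FinConfig d) :
    act (poi μ) g ξ ≤ g ξ + ∑' x, μ x * φ x := by
  set m := ∑' x, μ x with hm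
  have hE : ENNReal.ofReal (Real.exp m.toReal) = ∑' n : ℕ, (n.factorial : ℝ≥0∞)⁻¹ * m ^ n := by
    rw [ofReal_exp_eq_tsum ENNReal.toReal_nonneg, ENNReal.ofReal_toReal hμ]
  rw [SCBRW.act_poi, act_exp]
  calc _ ≤ ENNReal.ofReal (Real.exp (-m.toReal)) * ∑' n : ℕ, (n.factorial : ℝ≥0∞)⁻¹ *
        (m ^ n * g ξ + n * m ^ (n - 1) * ∑' x, μ x * φ x) :=
        mul_le_mul_right (ENNReal.tsum_le_tsum fun n =>
          mul_le_mul_right (hg.pow_addKer_le n ξ) _) _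
    _ = ENNReal.ofReal (Real.exp (-m.toReal)) *
        ((∑' n : ℕ, (n.factorial : ℝ≥0∞)⁻¹ * m ^ n) * g ξ +
        (∑' n : ℕ, (n.factorial : ℝ≥0∞)⁻¹ * (n * m ^ (n - 1))) * ∑' x, μ x * φ x) := by
      rw [← ENNReal.tsum_mul_right, ← ENNReal.tsum_mul_right, ← ENNReal.tsum_add]
      congr 1
      exact tsum_congr fun n => by ring
    _ = (ENNReal.ofReal (Real.exp (-m.toReal)) * ENNReal.ofReal (Real.exp m.toReal)) *
        (g ξ + ∑' x, μ x * φ x) := by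
      rw [tsum_inv_factorial_mul_pred, ← hE]; ring
    _ = _ := by rw [ofReal_exp_neg_mul, one_mul]

/-- The larger Poisson configuration is the smaller one with an independent one of intensity `ν - μ`
on top. -/
theorem Conc.act_poi_mono (hg : Conc φ g) (hν : ∑' x, ν x ≠ ∞) (h : ∀ x, μ x ≤ ν x)
    (ξ : FinConfig d) : act (poi μ) g ξ ≤ act (poi ν) g ξ := by
  have hμ : ∑' x, μ x ≠ ∞ := ne_top_of_le_ne_top hν (ENNReal.tsum_le_tsum h)
  have hd : ∑' x, (ν x - μ x) ≠ ∞ :=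
    ne_top_of_le_ne_top hν (ENNReal.tsum_le_tsum fun x => tsub_le_self)
  have e : ν = fun x => μ x + (ν x - μ x) := funext fun x => (add_tsub_cancel_of_le (h x)).symm
  rw [e, poi_add hμ hd, act_mul]
  exact act_mono _ (hg.le_act_poi hd) ξ

/-! ### Motion of a Poisson configuration -/

/-- The intensity `μ` after the particles have moved for a time `t`. -/
def pushWalk (μ : Site d → ℝ≥0∞) (t : ℝ) (y : Site d) : ℝ≥0∞ := ∑' x, μ x * walk p t x y

theorem tsum_pushWalk {t : ℝ} (ht : 0 ≤ t) (μ : Site d → ℝ≥0∞) :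
    ∑' y, pushWalk p μ t y = ∑' x, μ x := by
  unfold pushWalk
  rw [ENNReal.tsum_comm]
  simp only [ENNReal.tsum_mul_left, walk_row_sum p ht, mul_one]

theorem pushWalk_le {t : ℝ} (ht : 0 ≤ t) {M : ℝ≥0∞} (h : ∀ x, μ x ≤ M) (y : Site d) :
    pushWalk p μ t y ≤ M := by
  calc pushWalk p μ t y ≤ ∑' x, M * walk p t x y :=
        ENNReal.tsum_le_tsum fun x => mul_le_mul_left (h x) _
    _ = M := by rw [ENNReal.tsum_mul_left, walk_col_sum p ht, mul_one]

theorem act_addKer_motion {t : ℝ} (ht : 0 ≤ t) (μ : Site d → ℝ≥0∞) :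
    addKer μ * motion p 0 t = motion p 0 t * addKer (pushWalk p μ t) := by
  refine ext_act fun g ξ => ?_
  rw [act_mul, act_mul, act_addKer]
  simp only [act_motion_addAt p ht]
  have e : act (addKer (pushWalk p μ t)) g =
      fun ζ => ∑' y, pushWalk p μ t y * g (addAt ζ y) := funext fun ζ => act_addKer _ g ζ
  rw [e, act_tsum]
  have e2 : ∀ y, act (motion p 0 t) (fun ζ => pushWalk p μ t y * g (addAt ζ y)) ξ =
      ∑' x, μ x * walk p t x y * act (motion p 0 t) (fun ζ => g (addAt ζ y)) ξ := fun y => by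
    rw [act_const_mul, pushWalk, ENNReal.tsum_mul_right]
  simp only [e2]
  rw [ENNReal.tsum_comm]
  refine tsum_congr fun x => ?_
  rw [act, ← ENNReal.tsum_mul_left]
  exact tsum_congr fun y => by ring

/-- Displacement theorem: independent motion turns a Poisson configuration into a Poisson
configuration. On the level of kernels it is the commutation rule `act_addKer_motion`, extended to
the exponential series. -/
theorem poi_mul_motion {t : ℝ} (ht : 0 ≤ t) (μ : Site d → ℝ≥0∞) :
    poi μ * motion p 0 t = motion p 0 t * poi (pushWalk p μ t) := by
  have hpow : ∀ n, addKer μ ^ n * motion p 0 t = motion p 0 t * addKer (pushWalk p μ t) ^ n := by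
    intro n
    induction n with
    | zero => simp
    | succ n ih =>
      rw [pow_succ, pow_succ, mul_assoc, act_addKer_motion p ht, ← mul_assoc, ih, mul_assoc]
  refine ext_act fun g ξ => ?_
  rw [act_mul, act_mul, act_poi]
  have e : act (poi (pushWalk p μ t)) g = fun ζ =>
      ENNReal.ofReal (Real.exp (-(∑' x, μ x).toReal)) * ∑' n : ℕ, (n.factorial : ℝ≥0∞)⁻¹ *
        act (addKer (pushWalk p μ t) ^ n) g ζ := by
    funext ζ
    rw [act_poi, tsum_pushWalk p ht, act_exp]
  rw [e, act_const_mul, act_tsum, act_exp]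
  congr 1
  refine tsum_congr fun n => ?_
  rw [act_const_mul, ← act_mul, ← act_mul, hpow]

theorem act_poi_motion_zero {t : ℝ} (ht : 0 ≤ t) (μ : Site d → ℝ≥0∞) (g : FinConfig d → ℝ≥0∞) :
    act (poi μ) (act (motion p 0 t) g) 0 = act (poi (pushWalk p μ t)) g 0 := by
  rw [← act_mul, poi_mul_motion p ht, act_mul, act_motion_zero p ht]
  simp

/-! ### Linear functions -/

/-- The function to which every particle at `x` contributes `φ x`. -/
def linear (φ : Site d → ℝ≥0∞) (ξ : FinConfig d) : ℝ≥0∞ := ∑' x, (ξ x : ℝ≥0∞) * φ x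

theorem linear_addAt (φ : Site d → ℝ≥0∞) (ξ : FinConfig d) (x : Site d) :
    linear φ (addAt ξ x) = linear φ ξ + φ x := by
  classical
  have h : φ x = ∑' y, (if y = x then 1 else 0) * φ y := (tsum_ite_mul x φ).symm
  unfold linear
  rw [h, ← ENNReal.tsum_add]
  refine tsum_congr fun y => ?_
  rw [addAt_apply, Nat.cast_add, add_mul]
  congr 2
  by_cases hxy : x = y
  · simp [hxy]
  · simp [hxy, Ne.symm hxy]

theorem linear_zero (φ : Site d → ℝ≥0∞) : linear φ 0 = 0 := by simp [linear]

theorem Conc.linear (φ : Site d → ℝ≥0∞) : Conc φ (linear φ) where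
  mono ξ x := by rw [linear_addAt]; exact le_self_add
  lip ξ x := by rw [linear_addAt]
  sub ξ x y := by simp only [linear_addAt]; exact le_of_eq (by ring)

theorem act_branchKer_linear (φ : Site d → ℝ≥0∞) (x : Site d) (ξ : FinConfig d) :
    act (branchKer x) (SCBRW.linear φ) ξ = SCBRW.linear φ ξ := by
  rw [act_branchKer]
  split_ifs with h
  · obtain ⟨ζ, rfl, -⟩ := exists_addAt_eq h
    rw [removeAt_addAt, linear_addAt, linear_addAt]
    have : SCBRW.linear φ ζ + φ x + φ x + SCBRW.linear φ ζ = 2 * (SCBRW.linear φ ζ + φ x) := by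
      ring
    rw [this, ← mul_assoc, ENNReal.inv_mul_cancel two_ne_zero ENNReal.ofNat_ne_top, one_mul]
  · rfl

theorem act_motion_linear {t : ℝ} (ht : 0 ≤ t) (φ : Site d → ℝ≥0∞) (ξ : FinConfig d) :
    act (motion p 0 t) (SCBRW.linear φ) ξ = SCBRW.linear (act (walk p t) φ) ξ := by
  induction ξ using finConfig_induction with
  | h0 => rw [act_motion_zero p ht]; simp [linear_zero]
  | h1 ξ x ih =>
    rw [act_motion_addAt p ht, linear_addAt]
    have h : (fun y => act (motion p 0 t) (fun ζ => SCBRW.linear φ (addAt ζ y)) ξ) =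
        fun y => SCBRW.linear (act (walk p t) φ) ξ + φ y := by
      funext y
      simp only [linear_addAt]
      rw [act_add_apply, ih, act_const_of_one (act_motion_one p ht ξ)]
    rw [h, act_add_apply, act_const_of_one (act_walk_one p ht x)]

/-- Branching is critical, so it leaves linear functions unchanged on average. The inequality is all
that is needed. -/
theorem act_lonely_linear_le (β : ℝ≥0) (Λ : Finset (Site d)) {t : ℝ} (ht : 0 ≤ t)
    (φ : Site d → ℝ≥0∞) (ξ : FinConfig d) :
    act (lonely p β Λ t) (SCBRW.linear φ) ξ ≤ SCBRW.linear (act (walk p t) φ) ξ := by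
  rw [← act_motion_linear p ht]
  refine act_lonely_le_motion p β Λ ht (fun x _ v hv ξ => le_of_eq ?_) ξ
  have e : act (motion p 0 v) (SCBRW.linear φ) = SCBRW.linear (act (walk p v) φ) :=
    funext fun ζ => act_motion_linear p hv φ ζ
  rw [e, act_branchKer_linear]

/-! ### Translations -/

/-- The configuration translated by `z`. -/
def shift (z : Site d) (ξ : FinConfig d) : FinConfig d := ξ.equivMapDomain (Equiv.addRight z)

theorem shift_apply (z : Site d) (ξ : FinConfig d) (x : Site d) : shift z ξ x = ξ (x - z) := by
  simp [shift, Finsupp.equivMapDomain_apply, sub_eq_add_neg]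

theorem shift_addAt (z : Site d) (ξ : FinConfig d) (x : Site d) :
    shift z (addAt ξ x) = addAt (shift z ξ) (x + z) := by
  ext y
  simp only [shift_apply, addAt_apply, eq_sub_iff_add_eq]

theorem shift_removeAt (z : Site d) (ξ : FinConfig d) (x : Site d) :
    shift z (removeAt ξ x) = removeAt (shift z ξ) (x + z) := by
  ext y
  simp only [shift_apply, removeAt_apply, eq_sub_iff_add_eq]

theorem shift_zero (z : Site d) : shift z (0 : FinConfig d) = 0 := by
  ext y
  simp [shift_apply]

theorem act_motion_shift (c : ℝ) (z : Site d) (t : ℝ) (g : FinConfig d → ℝ≥0∞) (ξ : FinConfig d) :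
    act (motion p c t) g (shift z ξ) = act (motion p c t) (g ∘ shift z) ξ := by
  rcases lt_or_ge t 0 with ht | ht
  · rw [motion_causal p c t ht, act_zero_left, act_zero_left]; rfl
  induction ξ using finConfig_induction generalizing g with
  | h0 => rw [shift_zero, act_motion_zero p ht, act_motion_zero p ht, Function.comp, shift_zero]
  | h1 ξ x ih =>
    rw [shift_addAt, act_motion_addAt p ht, act_motion_addAt p ht]
    simp only [ih]
    rw [act, act, ← (Equiv.addRight z).tsum_eq]
    refine tsum_congr fun y => ?_
    simp only [Equiv.coe_addRight, walk_translate, Function.comp_def, shift_addAt]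

theorem act_branchKer_shift (x z : Site d) (g : FinConfig d → ℝ≥0∞) (ξ : FinConfig d) :
    act (branchKer (x + z)) g (shift z ξ) = act (branchKer x) (g ∘ shift z) ξ := by
  rw [act_branchKer, act_branchKer]
  simp only [shift_apply, add_sub_cancel_right, Function.comp_def, shift_addAt, shift_removeAt]

theorem act_dyson_comp {X Y : Type*} [Countable X] [Countable Y] {N : ℝ → Ker X} {k : Ker X}
    {N' : ℝ → Ker Y} {k' : Ker Y} (hN : TMeas N) (hN' : TMeas N') (u : Y → X)
    (h : ∀ t g y, act (N t) g (u y) = act (N' t) (g ∘ u) y)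
    (hk : ∀ g y, act k g (u y) = act k' (g ∘ u) y) (t : ℝ) (g : X → ℝ≥0∞) (y : Y) :
    act (dyson N k t) g (u y) = act (dyson N' k' t) (g ∘ u) y := by
  rw [act_dyson, act_dyson]
  refine tsum_congr fun n => ?_
  induction n generalizing t g y with
  | zero => exact h t g y
  | succ n ih =>
    rw [dysonTerm_succ, dysonTerm_succ,
      act_conv (hN.mul (TMeas.const _)) (dysonTerm_meas hN n),
      act_conv (hN'.mul (TMeas.const _)) (dysonTerm_meas hN' n)]
    refine lintegral_congr fun s => ?_
    rw [act_mul, act_mul, h]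
    congr 1
    funext y
    rw [Function.comp, hk]
    congr 1
    funext y
    exact ih _ _ _

theorem act_lonely_shift (β : ℝ≥0) (Λ : Finset (Site d)) (z : Site d) (t : ℝ)
    (g : FinConfig d → ℝ≥0∞) (ξ : FinConfig d) :
    act (lonely p β (Λ.map (addRightEmbedding z)) t) g (shift z ξ) =
      act (lonely p β Λ t) (g ∘ shift z) ξ := by
  have hc : clockRate β (Λ.map (addRightEmbedding z)) = clockRate β Λ := by
    simp [clockRate]
  rw [lonely, hc]
  refine act_dyson_comp (motion_meas p _) (motion_meas p _) (shift z)
    (fun t g ξ => act_motion_shift p _ z t g ξ) (fun g ξ => ?_) t g ξ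
  rw [act_branchSum, act_branchSum, Finset.sum_map]
  simp only [addRightEmbedding_apply, act_branchKer_shift]

theorem act_poi_shift (μ : Site d → ℝ≥0∞) (z : Site d) (g : FinConfig d → ℝ≥0∞) :
    act (poi μ) g 0 = act (poi fun x => μ (x + z)) (g ∘ shift z) 0 := by
  have hs : ∑' x, μ (x + z) = ∑' x, μ x := (Equiv.addRight z).tsum_eq μ
  rw [act_poi, act_poi, hs]
  congr 1
  conv_lhs => rw [← shift_zero z]
  refine act_exp_comp (addKer μ) (addKer fun x => μ (x + z)) (shift z) (fun g ξ => ?_) g 0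
  rw [act_addKer, act_addKer, ← (Equiv.addRight z).tsum_eq]
  simp only [Equiv.coe_addRight, Function.comp_def, shift_addAt]

end

end SCBRW

namespace SCBRW

noncomputable section

open Ker

/-! ### Suprema over Poisson initial configurations -/

variable {d : ℕ} (p : PMF (Site d)) {M : ℝ≥0∞} {μ ν : Site d → ℝ≥0∞}
  {φ ψ : Site d → ℝ≥0∞} {f g h : FinConfig d → ℝ≥0∞}

/-- Intensities bounded by `M` and of finite mass. -/
structure IsProfile (M : ℝ≥0∞) (μ : Site d → ℝ≥0∞) : Prop where
  le : ∀ x, μ x ≤ M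
  mass : ∑' x, μ x ≠ ∞

/-- The largest mean of `g` over the Poisson configurations with intensity at most `M`. -/
def topMean (M : ℝ≥0∞) (g : FinConfig d → ℝ≥0∞) : ℝ≥0∞ :=
  ⨆ (μ : Site d → ℝ≥0∞) (_ : IsProfile M μ), act (poi μ) g 0

theorem IsProfile.le_topMean (h : IsProfile M μ) (g : FinConfig d → ℝ≥0∞) :
    act (poi μ) g 0 ≤ topMean M g :=
  le_iSup₂_of_le μ h le_rfl

theorem topMean_mono (h : ∀ ξ, f ξ ≤ g ξ) : topMean M f ≤ topMean M g :=
  iSup₂_mono fun _ _ => act_mono _ h 0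

/-- The displaced intensity satisfies the same bound `M`, since counting measure is invariant for
the walk. -/
theorem topMean_motion_le {t : ℝ} (ht : 0 ≤ t) (g : FinConfig d → ℝ≥0∞) :
    topMean M (act (motion p 0 t) g) ≤ topMean M g := by
  refine iSup₂_le fun μ hμ => ?_
  rw [act_poi_motion_zero p ht]
  exact IsProfile.le_topMean ⟨pushWalk_le p ht hμ.le, by rw [tsum_pushWalk p ht]; exact hμ.mass⟩ g

theorem topMean_shift (z : Site d) (g : FinConfig d → ℝ≥0∞) :
    topMean M (g ∘ shift z) = topMean M g := by
  refine le_antisymm (iSup₂_le fun μ hμ => ?_) (iSup₂_le fun μ hμ => ?_)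
  · have h := act_poi_shift (fun y => μ (y - z)) z g
    simp only [add_sub_cancel_right] at h
    rw [← h]
    refine IsProfile.le_topMean ⟨fun x => hμ.le _, ?_⟩ g
    have : ∑' x, μ (x - z) = ∑' x, μ x := (Equiv.subRight z).tsum_eq μ
    rw [this]
    exact hμ.mass
  · rw [act_poi_shift μ z]
    refine IsProfile.le_topMean ⟨fun x => hμ.le _, ?_⟩ _
    have := (Equiv.addRight z).tsum_eq μ
    simp only [Equiv.coe_addRight] at this
    rw [this]
    exact hμ.mass

theorem topMean_le {C : ℝ≥0∞} (hg : ∀ ξ, g ξ ≤ C) : topMean M g ≤ C :=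
  iSup₂_le fun _ hμ => (act_mono _ hg 0).trans (act_poi_const hμ.mass C 0).le

/-- Intensity `M` in a large finite set. -/
def box (M : ℝ≥0∞) (n : ℕ) (x : Site d) : ℝ≥0∞ := if Encodable.encode x < n then M else 0

theorem finite_encode_lt (n : ℕ) : {x : Site d | Encodable.encode x < n}.Finite :=
  (Set.finite_Iio n).preimage Encodable.encode_injective.injOn

theorem isProfile_box (hM : M ≠ ∞) (n : ℕ) : IsProfile M (box (d := d) M n) where
  le x := by unfold box; split_ifs <;> simp
  mass := by
    rw [tsum_eq_sum (s := (finite_encode_lt n).toFinset)]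
    · exact ENNReal.sum_ne_top.mpr fun x _ => by unfold box; split_ifs <;> simp [hM]
    · intro x hx
      simp only [Set.Finite.mem_toFinset, Set.mem_ofPred_eq] at hx
      simp [box, hx]

theorem box_mono {m n : ℕ} (h : m ≤ n) (x : Site d) : box M m x ≤ box M n x := by
  unfold box
  split_ifs with h1 h2
  · exact le_rfl
  · exact absurd (h1.trans_le h) h2
  · exact zero_le
  · exact le_rfl

theorem Conc.monotone_box (hg : Conc φ g) (hM : M ≠ ∞) :
    Monotone fun n => act (poi (box M n)) g 0 := fun _ n h =>
  hg.act_poi_mono (isProfile_box hM n).mass (box_mono h) 0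

/-- A profile has finite mass, so cutting off its tail changes the mean by at most `ε`, and the
remainder lies below a box. A single increasing sequence of initial states is thus optimal for all
concave functions with `φ ≤ 1`. -/
theorem Conc.iSup_box (hg : Conc φ g) (hφ : ∀ x, φ x ≤ 1) (hM : M ≠ ∞) :
    ⨆ n, act (poi (box M n)) g 0 = topMean M g := by
  refine le_antisymm (iSup_le fun n => (isProfile_box hM n).le_topMean g)
    (iSup₂_le fun μ hμ => ?_)
  refine ENNReal.le_of_forall_pos_le_add fun ε hε _ => ?_
  have htail := (ENNReal.tendsto_tsum_compl_atTop_zero hμ.mass).eventually_lt_const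
    (ENNReal.coe_pos.mpr hε)
  obtain ⟨s, hs⟩ := htail.exists
  obtain ⟨n, hn⟩ : ∃ n, ∀ x ∈ s, Encodable.encode x < n :=
    ⟨(s.sup Encodable.encode) + 1, fun x hx =>
      Nat.lt_succ_of_le (Finset.le_sup (f := Encodable.encode) hx)⟩
  set μ₁ : Site d → ℝ≥0∞ := fun x => if Encodable.encode x < n then μ x else 0 with hμ₁
  set μ₂ : Site d → ℝ≥0∞ := fun x => if Encodable.encode x < n then 0 else μ x with hμ₂
  have h1 : ∀ x, μ₁ x ≤ box M n x := fun x => by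
    simp only [hμ₁, box]
    split_ifs
    · exact hμ.le x
    · exact le_rfl
  have hm1 : ∑' x, μ₁ x ≠ ∞ :=
    ne_top_of_le_ne_top (isProfile_box hM n).mass (ENNReal.tsum_le_tsum h1)
  have h2 : ∀ x, μ₂ x ≤ μ x := fun x => by
    simp only [hμ₂]
    split_ifs <;> simp
  have hm2 : ∑' x, μ₂ x ≠ ∞ := ne_top_of_le_ne_top hμ.mass (ENNReal.tsum_le_tsum h2)
  have e : μ = fun x => μ₁ x + μ₂ x := by
    funext x
    simp only [hμ₁, hμ₂]
    split_ifs <;> simp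
  have h3 : ∑' x, μ₂ x * φ x ≤ ε := by
    refine le_trans ?_ hs.le
    have h4 : ∑' x, μ₂ x * φ x = ∑' x : ({x | x ∉ s} : Set (Site d)), μ₂ x * φ x := by
      refine (tsum_subtype_eq_of_support_subset (f := fun x => μ₂ x * φ x) ?_).symm
      intro x hx hxs
      refine hx ?_
      simp [hμ₂, hn x hxs]
    rw [h4]
    refine ENNReal.tsum_le_tsum fun x => ?_
    calc μ₂ x * φ x ≤ μ x * 1 := mul_le_mul' (h2 x) (hφ x)
      _ = μ x := mul_one _
  rw [e, poi_add hm1 hm2, act_mul]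
  refine (act_mono _ (fun ξ => (hg.act_poi_le hm2 ξ).trans (add_le_add le_rfl h3)) 0).trans ?_
  rw [act_add_apply, act_poi_const hm1]
  refine add_le_add ?_ le_rfl
  exact (hg.act_poi_mono (isProfile_box hM n).mass h1 0).trans
    (le_iSup (fun n => act (poi (box M n)) g 0) n)

theorem Conc.tendsto_box (hg : Conc φ g) (hφ : ∀ x, φ x ≤ 1) (hM : M ≠ ∞) :
    Tendsto (fun n => act (poi (box M n)) g 0) atTop (𝓝 (topMean M g)) := by
  rw [← hg.iSup_box hφ hM]
  exact tendsto_atTop_iSup (hg.monotone_box hM)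

/-- Estimates proved for one initial state pass to the suprema at all times and sites
simultaneously, by monotone convergence along the boxes. -/
theorem tendsto_lintegral_box {α : Type*} [MeasurableSpace α] {m : Measure α} {ι : Type*}
    (D : Finset ι) {w : ι → α → ℝ≥0∞} (hw : ∀ i, Measurable (w i))
    {G : ι → α → FinConfig d → ℝ≥0∞} (hG : ∀ i ξ, Measurable fun s => G i s ξ)
    (hGC : ∀ i, ∀ᵐ s ∂m, ∃ φ : Site d → ℝ≥0∞, (∀ x, φ x ≤ 1) ∧ Conc φ (G i s))
    (hwfin : ∀ i s, w i s ≠ ∞) (hM : M ≠ ∞) :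
    Tendsto (fun n => ∫⁻ s, ∑ i ∈ D, w i s * act (poi (box M n)) (G i s) 0 ∂m) atTop
      (𝓝 (∫⁻ s, ∑ i ∈ D, w i s * topMean M (G i s) ∂m)) := by
  have hall : ∀ᵐ s ∂m, ∀ i ∈ D, ∃ φ : Site d → ℝ≥0∞, (∀ x, φ x ≤ 1) ∧ Conc φ (G i s) :=
    (Finset.eventually_all D).mpr fun i _ => hGC i
  refine lintegral_tendsto_of_tendsto_of_monotone (fun n => ?_) ?_ ?_
  · exact (Finset.measurable_sum _ fun i _ => (hw i).mul (Measurable.tsum fun ξ =>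
      (hG i ξ).const_mul _)).aemeasurable
  · filter_upwards [hall] with s hs m n hmn
    refine Finset.sum_le_sum fun i hi => mul_le_mul_right ?_ _
    obtain ⟨φ, -, h⟩ := hs i hi
    exact h.monotone_box hM hmn
  · filter_upwards [hall] with s hs
    refine tendsto_finsetSum _ fun i hi => ?_
    obtain ⟨φ, hφ, h⟩ := hs i hi
    refine ENNReal.Tendsto.const_mul (h.tendsto_box hφ hM) (Or.inr (hwfin i s))

/-! ### Truncated particle numbers -/

/-- The number of particles at `o`, truncated at `K`. -/
def trunc (K : ℕ) (o : Site d) (ξ : FinConfig d) : ℝ≥0∞ := ((min (ξ o) K : ℕ) : ℝ≥0∞)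

open Classical in
theorem conc_trunc (K : ℕ) (o : Site d) : Conc (fun x => if x = o then 1 else 0) (trunc K o) where
  mono ξ x := by
    unfold trunc
    rw [addAt_apply]
    exact_mod_cast min_le_min (Nat.le_add_right _ _) le_rfl
  lip ξ x := by
    unfold trunc
    rw [addAt_apply]
    split_ifs
    all_goals norm_cast
    all_goals omega
  sub ξ x y := by
    unfold trunc
    simp only [addAt_apply]
    norm_cast
    split_ifs <;> omega

theorem trunc_le (K : ℕ) (o : Site d) (ξ : FinConfig d) : trunc K o ξ ≤ K := by
  unfold trunc
  exact_mod_cast min_le_right _ _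

theorem trunc_shift (K : ℕ) (o z : Site d) : trunc K (o + z) ∘ shift z = trunc K o := by
  funext ξ
  simp [trunc, shift_apply]

variable (β : ℝ≥0) (Λ : Finset (Site d)) (K : ℕ) (o : Site d)

theorem conc_lonely_trunc {t : ℝ} (ht : 0 ≤ t) :
    Conc (fun x => walk p t x o) (act (lonely p β Λ t) (trunc K o)) := by
  classical
  have h := (conc_trunc K o).act_lonely p β Λ (ENNReal.natCast_ne_top K) (trunc_le K o) ht
  have e : act (walk p t) (fun x => if x = o then 1 else 0) = fun x => walk p t x o :=
    funext fun x => by convert act_indicator _ x o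
  rwa [e] at h

theorem walk_le_one {t : ℝ} (ht : 0 ≤ t) (x y : Site d) : walk p t x y ≤ 1 :=
  (ENNReal.le_tsum y).trans (walk_row_sum p ht x).le

theorem lonely_trunc_le {t : ℝ} (ht : 0 ≤ t) (ξ : FinConfig d) :
    act (lonely p β Λ t) (trunc K o) ξ ≤ K :=
  act_lonely_le p β Λ (trunc_le K o) ht ξ

/-- The largest mean number of particles at `o`, truncated at `K`, at time `t`. -/
def topOcc (M : ℝ≥0∞) (t : ℝ) : ℝ≥0∞ := topMean M (act (lonely p β Λ t) (trunc K o))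

theorem topOcc_le {t : ℝ} (ht : 0 ≤ t) : topOcc p β Λ K o M t ≤ K :=
  topMean_le (lonely_trunc_le p β Λ K o ht)

/-- Dropping the branching during the first `t - s` time units increases the mean; the pure motion
then leads from one admissible Poisson state to another. -/
theorem topOcc_antitone {Λ' : Finset (Site d)} (hΛ : Λ ⊆ Λ') {s t : ℝ} (hs : 0 ≤ s) (hst : s ≤ t) :
    topOcc p β Λ' K o M t ≤ topOcc p β Λ K o M s := by
  refine le_trans (topMean_mono fun ξ => ?_) (topMean_motion_le p (sub_nonneg.mpr hst) _)
  refine (lonely_antitone p β hΛ (conc_trunc K o) (ENNReal.natCast_ne_top K) (trunc_le K o)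
    t ξ).trans ?_
  have e : lonely p β Λ t = lonely p β Λ (t - s) * lonely p β Λ s := by
    rw [← lonely_add p β Λ hs (sub_nonneg.mpr hst), sub_add_cancel]
  rw [e, act_mul]
  exact lonely_le_motion p β Λ (conc_lonely_trunc p β Λ K o hs) (ENNReal.natCast_ne_top K)
    (lonely_trunc_le p β Λ K o hs) (t - s) ξ

theorem topOcc_shift (z : Site d) (t : ℝ) :
    topOcc p β (Λ.map (addRightEmbedding z)) K (o + z) M t = topOcc p β Λ K o M t := by
  rw [topOcc, topOcc, ← topMean_shift z]
  congr 1
  funext ξ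
  rw [Function.comp, act_lonely_shift, trunc_shift]

/-- The infimum of `topOcc` over times and branching regions. -/
def limOcc (M : ℝ≥0∞) : ℝ≥0∞ := ⨅ (Λ : Finset (Site d)) (t : ℝ≥0), topOcc p β Λ K 0 M t

theorem limOcc_le {t : ℝ} (ht : 0 ≤ t) : limOcc p β K M ≤ topOcc p β Λ K o M t := by
  have e : topOcc p β Λ K o M t =
      topOcc p β (Λ.map (addRightEmbedding (-o))) K 0 M t := by
    rw [← topOcc_shift p β Λ K o (-o), add_neg_cancel]
  rw [e]
  exact iInf₂_le_of_le _ ⟨t, ht⟩ le_rfl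

theorem limOcc_ne_top : limOcc p β K M ≠ ∞ :=
  ne_top_of_le_ne_top (ENNReal.natCast_ne_top K)
    ((limOcc_le p β ∅ K 0 le_rfl).trans (topOcc_le p β ∅ K 0 le_rfl))

theorem exists_topOcc_le {ε : ℝ≥0∞} (hε : ε ≠ 0) : ∃ (Λ₀ : Finset (Site d)) (T : ℝ), 0 ≤ T ∧
    ∀ (o : Site d) (Λ : Finset (Site d)), Λ₀.map (addRightEmbedding o) ⊆ Λ → ∀ t, T ≤ t →
      topOcc p β Λ K o M t ≤ limOcc p β K M + ε := by
  have h : limOcc p β K M < limOcc p β K M + ε :=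
    ENNReal.lt_add_right (limOcc_ne_top p β K) hε
  conv_lhs at h => rw [limOcc]
  obtain ⟨Λ₀, h⟩ := iInf_lt_iff.mp h
  obtain ⟨T, h⟩ := iInf_lt_iff.mp h
  refine ⟨Λ₀, T, T.coe_nonneg, fun o Λ hΛ t ht => ?_⟩
  refine (topOcc_antitone p β _ K o hΛ T.coe_nonneg ht).trans ?_
  have := topOcc_shift p β Λ₀ K 0 (M := M) o T
  rw [zero_add] at this
  rw [this]
  exact h.le

end

end SCBRW

namespace SCBRW

noncomputable section

open Ker

/-! ### Dissipation of thinned configurations -/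

variable {d : ℕ} (p : PMF (Site d)) {M : ℝ≥0∞} {μ : Site d → ℝ≥0∞}

/-- The probability that `o` is still occupied when every particle is kept with probability `θ`
and discarded with probability `r`. -/
def thin (θ r : ℝ≥0∞) (o : Site d) (ξ : FinConfig d) : ℝ≥0∞ := θ * ∑ i ∈ Finset.range (ξ o), r ^ i

/-- The probability that `o` is empty when every particle is discarded with probability `r`. -/
def surv (r : ℝ≥0∞) (o : Site d) (ξ : FinConfig d) : ℝ≥0∞ := r ^ ξ o

variable {θ r : ℝ≥0∞} {o : Site d}

theorem thin_addAt (θ r : ℝ≥0∞) (o x : Site d) (ξ : FinConfig d) :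
    thin θ r o (addAt ξ x) = thin θ r o ξ + (if x = o then θ else 0) * r ^ ξ o := by
  unfold thin
  rw [addAt_apply]
  split_ifs
  · rw [Finset.sum_range_succ, mul_add]
  · simp

theorem conc_thin (hr : r ≤ 1) : Conc (fun x => if x = o then θ else 0) (thin θ r o) where
  mono ξ x := by rw [thin_addAt]; exact le_self_add
  lip ξ x := by
    rw [thin_addAt]
    exact add_le_add le_rfl (mul_le_of_le_one_right' (pow_le_one' hr _))
  sub ξ x y := by
    rw [thin_addAt, thin_addAt, thin_addAt, add_assoc, add_comm (_ * _) (thin θ r o ξ)]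
    refine add_le_add le_rfl (add_le_add le_rfl (mul_le_mul_right ?_ _))
    rw [addAt_apply]
    exact pow_le_pow_right_of_le_one' hr (Nat.le_add_right _ _)

theorem thin_add_surv (h : θ + r = 1) (ξ : FinConfig d) : thin θ r o ξ + surv r o ξ = 1 := by
  unfold thin surv
  induction ξ o with
  | zero => simp
  | succ n ih =>
    rw [Finset.sum_range_succ, mul_add, add_assoc, pow_succ', ← add_mul, h, one_mul, ih]

theorem act_motion_thin_add {v : ℝ} (hv : 0 ≤ v) (h : θ + r = 1) (ξ : FinConfig d) :
    act (motion p 0 v) (thin θ r o) ξ + act (motion p 0 v) (surv r o) ξ = 1 := by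
  rw [← act_add_apply]
  simp only [thin_add_surv h]
  exact act_motion_one p hv ξ

/-- Avoidance probabilities are products over the particles; a particle at `x` contributes the
factor `ρ`, the complement of reaching `o` and being kept. -/
theorem exists_act_motion_surv {v : ℝ} (hv : 0 ≤ v) (h : θ + r = 1) (x : Site d) :
    ∃ ρ, θ * walk p v x o + ρ = 1 ∧ ∀ ξ, act (motion p 0 v) (surv r o) (addAt ξ x) =
      ρ * act (motion p 0 v) (surv r o) ξ := by
  refine ⟨act (walk p v) (fun y => if y = o then r else 1) x, ?_, fun ξ => ?_⟩
  · have e : walk p v x o = act (walk p v) (fun y => if y = o then 1 else 0) x := by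
      convert (act_indicator _ x o).symm
    rw [e, ← act_const_mul, ← act_add_apply]
    refine Eq.trans ?_ (act_walk_one p hv x)
    congr 1
    funext y
    split_ifs
    · rw [mul_one, h]
    · simp
  · rw [act_motion_addAt p hv, ← act_mul_const]
    congr 1
    funext y
    have e : (fun ζ => surv r o (addAt ζ y)) = fun ζ => (if y = o then r else 1) * surv r o ζ := by
      funext ζ
      unfold surv
      rw [addAt_apply]
      split_ifs
      · rw [pow_succ']
      · simp
    rw [e, act_const_mul]

/-- With `a = 1 - ρ`, zero, one and two particles at `x` contribute `1`, `ρ`, `ρ²` to the avoidance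
probability, so branching raises it by the factor `(1 + ρ²)/2 - ρ = a²/2` times that of the other
particles. The latter is at least the avoidance probability of the whole configuration. -/
theorem act_branchKer_motion_thin_add {v : ℝ} (hv : 0 ≤ v) (h : θ + r = 1) {x : Site d}
    {ξ : FinConfig d} (hx : ξ x = 1) :
    act (branchKer x) (act (motion p 0 v) (thin θ r o)) ξ +
      2⁻¹ * (θ * walk p v x o) ^ 2 * act (motion p 0 v) (surv r o) ξ ≤
      act (motion p 0 v) (thin θ r o) ξ := by
  obtain ⟨ζ, rfl, -⟩ := exists_addAt_eq hx
  obtain ⟨ρ, hρ, hA⟩ := exists_act_motion_surv p (o := o) hv h x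
  rw [act_branchKer, if_pos hx, removeAt_addAt]
  set a := θ * walk p v x o
  set G := act (motion p 0 v) (thin θ r o)
  set A := act (motion p 0 v) (surv r o)
  have h0 : G ζ + A ζ = 1 := act_motion_thin_add p hv h ζ
  have h1 : G (addAt ζ x) + ρ * A ζ = 1 := by rw [← hA]; exact act_motion_thin_add p hv h _
  have h2 : G (addAt (addAt ζ x) x) + ρ * (ρ * A ζ) = 1 := by
    rw [← hA, ← hA]; exact act_motion_thin_add p hv h _
  have hA1 : A ζ ≤ 1 := h0 ▸ le_add_self
  have hρ1 : ρ ≤ 1 := hρ ▸ le_add_self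
  rw [hA]
  have hfin : 2 * (ρ * A ζ) ≠ ∞ := ENNReal.mul_ne_top ENNReal.ofNat_ne_top
    (ne_top_of_le_ne_top ENNReal.one_ne_top (h1 ▸ le_add_self))
  have key : G (addAt (addAt ζ x) x) + G ζ + a ^ 2 * (ρ * A ζ) ≤ 2 * G (addAt ζ x) := by
    refine (ENNReal.add_le_add_iff_right hfin).mp ?_
    calc _ = G (addAt (addAt ζ x) x) + G ζ + (a ^ 2 * ρ + 2 * ρ) * A ζ := by ring
      _ ≤ G (addAt (addAt ζ x) x) + G ζ + (a ^ 2 * 1 + 2 * ρ) * A ζ := by gcongr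
      _ = G (addAt (addAt ζ x) x) + G ζ + (a ^ 2 + 2 * ρ * (a + ρ)) * A ζ := by
        rw [hρ, mul_one, mul_one]
      _ = G (addAt (addAt ζ x) x) + G ζ + (ρ * ρ + (a + ρ) * (a + ρ)) * A ζ := by ring
      _ = (G (addAt (addAt ζ x) x) + ρ * (ρ * A ζ)) + (G ζ + A ζ) := by rw [hρ]; ring
      _ = 2 * (G (addAt ζ x) + ρ * A ζ) := by rw [h0, h1, h2]; norm_num
      _ = _ := by ring
  calc _ = 2⁻¹ * (G (addAt (addAt ζ x) x) + G ζ + a ^ 2 * (ρ * A ζ)) := by ring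
    _ ≤ 2⁻¹ * (2 * G (addAt ζ x)) := mul_le_mul_right key _
    _ = _ := by rw [← mul_assoc, ENNReal.inv_mul_cancel two_ne_zero ENNReal.ofNat_ne_top, one_mul]

/-- The link between single occupation and the concave functions to which the limits `limOcc` apply.
-/
theorem two_mul_trunc_one (x : Site d) (ξ : FinConfig d) :
    2 * trunc 1 x ξ = (if ξ x = 1 then 1 else 0) + trunc 2 x ξ := by
  unfold trunc
  split_ifs with h
  · rw [h]; norm_num
  · rcases Nat.lt_or_ge (ξ x) 1 with h0 | h0
    · have : ξ x = 0 := by omega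
      simp [this]
    · have h1 : min (ξ x) 1 = 1 := by omega
      have h2 : min (ξ x) 2 = 2 := by omega
      rw [h1, h2]; norm_num

/-- The avoidance probability in the drop is one minus the thinned occupation probability. The
latter and `trunc 2` are moved to the right, where they can be bounded in the mean. -/
theorem sum_le_dissipation (β : ℝ≥0) {Λ D : Finset (Site d)} (hD : D ⊆ Λ) {v : ℝ} (hv : 0 ≤ v)
    (h : θ + r = 1) (ξ : FinConfig d) :
    ∑ x ∈ D, β * (2⁻¹ * (θ * walk p v x o) ^ 2) * (2 * trunc 1 x ξ) ≤
      dissipation β Λ (act (motion p 0 v) (thin θ r o)) ξ +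
      ∑ x ∈ D, β * (2⁻¹ * (θ * walk p v x o) ^ 2) *
        (act (motion p 0 v) (thin θ r o) ξ + trunc 2 x ξ) := by
  set G := act (motion p 0 v) (thin θ r o) with hG
  have hdiss : ∑ x ∈ D, (β : ℝ≥0∞) * (G ξ - act (branchKer x) G ξ) ≤ dissipation β Λ G ξ :=
    Finset.sum_le_sum_of_subset hD
  refine le_trans ?_ (add_le_add hdiss le_rfl)
  rw [← Finset.sum_add_distrib]
  refine Finset.sum_le_sum fun x _ => ?_
  rw [two_mul_trunc_one, mul_add, mul_add, ← add_assoc]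
  refine add_le_add ?_ le_rfl
  split_ifs with hx
  · have h1 := act_branchKer_motion_thin_add p (o := o) hv h hx
    have h2 := act_motion_thin_add p (o := o) hv h ξ
    rw [← hG] at h1 h2
    set A := act (motion p 0 v) (surv r o) ξ
    have hfin : act (branchKer x) G ξ ≠ ∞ := by
      refine ne_top_of_le_ne_top ENNReal.one_ne_top ((le_self_add.trans h1).trans ?_)
      rw [← h2]
      exact le_self_add
    have h3 : 2⁻¹ * (θ * walk p v x o) ^ 2 * A ≤ G ξ - act (branchKer x) G ξ :=
      ENNReal.le_sub_of_add_le_left hfin h1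
    calc _ = β * (2⁻¹ * (θ * walk p v x o) ^ 2) * (G ξ + A) := by rw [h2]
      _ = β * (2⁻¹ * (θ * walk p v x o) ^ 2 * A) + β * (2⁻¹ * (θ * walk p v x o) ^ 2) * G ξ := by
        ring
      _ ≤ _ := add_le_add (mul_le_mul_right h3 _) le_rfl
  · rw [mul_zero]; exact zero_le

theorem act_poi_motion_thin_le (hμ : IsProfile M μ) {t : ℝ} (ht : 0 ≤ t) (hr : r ≤ 1) :
    act (poi μ) (act (motion p 0 t) (thin θ r o)) 0 ≤ θ * M := by
  rw [act_poi_motion_zero p ht]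
  refine ((conc_thin hr).act_poi_le (by rw [tsum_pushWalk p ht]; exact hμ.mass) 0).trans ?_
  rw [tsum_eq_single o (by intro x hx; simp [hx])]
  simp only [thin, Finsupp.coe_zero, Pi.zero_apply, Finset.range_zero, Finset.sum_empty, mul_zero,
    zero_add, if_true]
  rw [mul_comm]
  exact mul_le_mul_right (pushWalk_le p ht hμ.le o) _

theorem thin_le_one (h : θ + r = 1) (ξ : FinConfig d) : thin θ r o ξ ≤ 1 :=
  thin_add_surv h ξ ▸ le_self_add

theorem act_poi_lonely_motion_thin_le (β : ℝ≥0) (Λ : Finset (Site d)) (hμ : IsProfile M μ)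
    {s t : ℝ} (hs : 0 ≤ s) (ht : 0 ≤ t) (h : θ + r = 1) :
    act (poi μ) (act (lonely p β Λ s) (act (motion p 0 t) (thin θ r o))) 0 ≤ θ * M := by
  have hr : r ≤ 1 := h ▸ le_add_self
  refine le_trans (act_mono _ (fun ξ => lonely_le_motion p β Λ ((conc_thin hr).act_motion p ht)
    ENNReal.one_ne_top (fun ξ => (act_mono _ (thin_le_one h) ξ).trans (act_motion_one p ht ξ).le)
    s ξ) 0) ?_
  rw [← act_mul (motion p 0 s), ← motion_add p 0 s t hs ht]
  exact act_poi_motion_thin_le p hμ (add_nonneg hs ht) hr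

/-- A lower bound on the dissipation of the thinned system between the times `T` and `T + V`. -/
theorem lintegral_sum_trunc_le (β : ℝ≥0) {Λ D : Finset (Site d)} (hD : D ⊆ Λ) (hμ : IsProfile M μ)
    {T V : ℝ} (hT : 0 ≤ T) (hV : 0 ≤ V) (h : θ + r = 1) {c : ℝ≥0∞}
    (hc : ∀ x ∈ D, ∀ s, 0 ≤ s → act (poi μ) (act (lonely p β Λ (T + s)) (trunc 2 x)) 0 ≤ c) :
    ∫⁻ s in Set.Icc 0 V, ∑ x ∈ D, β * (2⁻¹ * (θ * walk p (V - s) x o) ^ 2) * 2 *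
      act (poi μ) (act (lonely p β Λ (T + s)) (trunc 1 x)) 0 ≤
    θ * M + ∫⁻ s in Set.Icc 0 V, ∑ x ∈ D,
      β * (2⁻¹ * (θ * walk p (V - s) x o) ^ 2) * (θ * M + c) := by
  set S := lonely p β Λ with hS
  set κ : ℝ → Site d → ℝ≥0∞ := fun s x => β * (2⁻¹ * (θ * walk p (V - s) x o) ^ 2) with hκ
  set G : ℝ → FinConfig d → ℝ≥0∞ := fun v => act (motion p 0 v) (thin θ r o) with hG
  have hr : r ≤ 1 := h ▸ le_add_self
  have mS : TMeas S := lonely_meas p β Λ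
  have mG : ∀ ξ, Measurable fun s => G (V - s) ξ := fun ξ =>
    ((motion_meas p 0).comp (u := fun s => V - s) (by fun_prop)).act _ ξ
  have mdiss : ∀ ξ, Measurable fun s => dissipation β Λ (G (V - s)) ξ := fun ξ =>
    Finset.measurable_sum _ fun x _ => Measurable.const_mul
      ((mG ξ).sub ((TMeas.const _).act_act mG ξ)) _
  have mSd : ∀ ξ, Measurable fun s => act (S s) (dissipation β Λ (G (V - s))) ξ := fun ξ =>
    mS.act_act mdiss ξ
  have h1 : ∀ ξ, ∫⁻ s in Set.Icc 0 V, act (S s) (dissipation β Λ (G (V - s))) ξ ≤ G V ξ := by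
    intro ξ
    exact le_add_self.trans (lonely_add_dissipation_motion p β Λ (conc_thin hr)
      ENNReal.one_ne_top (thin_le_one h) V ξ).le
  -- The total loss after time `T` is at most the mean available at time `T`, which thinning makes
  -- as small as `θ * M`.
  have h2 : ∫⁻ s in Set.Icc 0 V, act (poi μ) (act (S (T + s)) (dissipation β Λ (G (V - s)))) 0 ≤
      θ * M := by
    refine le_trans ?_ (act_poi_lonely_motion_thin_le p (o := o) β Λ hμ hT hV h)
    have e1 : ∀ s ∈ Set.Icc 0 V, act (poi μ) (act (S (T + s)) (dissipation β Λ (G (V - s)))) 0 =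
        act (poi μ) (act (S T) (act (S s) (dissipation β Λ (G (V - s))))) 0 := fun s hs => by
      rw [hS, lonely_add p β Λ hs.1 hT, act_mul]
    rw [setLIntegral_congr_fun measurableSet_Icc e1,
      ← act_lintegral (poi μ) (fun ξ => (TMeas.const _).act_act mSd ξ)]
    refine act_mono _ (fun ξ => ?_) 0
    rw [← act_lintegral (S T) mSd]
    exact act_mono _ h1 ξ
  have h3 : ∀ s ∈ Set.Icc 0 V, ∑ x ∈ D, κ s x * 2 * act (poi μ) (act (S (T + s)) (trunc 1 x)) 0 ≤
      act (poi μ) (act (S (T + s)) (dissipation β Λ (G (V - s)))) 0 +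
        ∑ x ∈ D, κ s x * (θ * M + c) := by
    intro s hs
    have hv := sub_nonneg.mpr hs.2
    have hTs := add_nonneg hT hs.1
    have e := act_mono (poi μ) (act_mono (S (T + s)) fun ξ =>
      sum_le_dissipation p (o := o) β hD hv h ξ) 0
    simp only [act_sum, act_const_mul, act_add_apply, ← act_mul] at e
    simp only [← act_mul]
    refine le_trans (le_of_eq ?_) (e.trans (add_le_add le_rfl ?_))
    · exact Finset.sum_congr rfl fun x _ => by simp only [hκ]; ring
    · refine Finset.sum_le_sum fun x hx => mul_le_mul_right (add_le_add ?_ ?_) _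
      · have := act_poi_lonely_motion_thin_le p (o := o) β Λ hμ hTs hv h
        rwa [← act_mul, ← act_mul] at this
      · have := hc x hx s hs.1
        rwa [← act_mul] at this
  refine (setLIntegral_mono' measurableSet_Icc h3).trans ?_
  rw [lintegral_add_left]
  · exact add_le_add h2 le_rfl
  · exact (TMeas.const _).act_act (fun ξ => (mS.comp (u := fun s => T + s) (by fun_prop)).act_act
      mdiss ξ) 0

end

end SCBRW

namespace SCBRW

noncomputable section

open Ker

/-! ### Single particles become rare -/

variable {d : ℕ} (p : PMF (Site d)) {M : ℝ≥0∞} {μ : Site d → ℝ≥0∞} {θ r : ℝ≥0∞}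

theorem exists_finset_lintegral_walk_sq_gt (hrec : IsRecurrent (symmetrised p)) {C : ℝ≥0∞}
    (hC : C ≠ ∞) : ∃ (V : ℝ) (D : Finset (Site d)), 0 ≤ V ∧
      C < ∫⁻ s in Set.Icc 0 V, ∑ x ∈ D, walk p (V - s) x 0 * walk p (V - s) x 0 := by
  obtain ⟨V, hV, h⟩ := exists_lintegral_walk_sq_ge p hrec (C := C + 1)
    (ENNReal.add_ne_top.mpr ⟨hC, ENNReal.one_ne_top⟩)
  have hm : ∀ x, Measurable fun s => walk p s x 0 * walk p s x 0 := fun x =>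
    (walk_meas p x 0).mul (walk_meas p x 0)
  have h2 : C < ∑' x, ∫⁻ s in Set.Icc 0 V, walk p s x 0 * walk p s x 0 := by
    rw [← lintegral_tsum fun x => (hm x).aemeasurable]
    exact (ENNReal.lt_add_right hC one_ne_zero).trans_le h
  rw [ENNReal.tsum_eq_iSup_sum] at h2
  obtain ⟨D, hD⟩ := lt_iSup_iff.mp h2
  refine ⟨V, D, hV, ?_⟩
  rw [lintegral_Icc_sub (fun s => ∑ x ∈ D, walk p s x 0 * walk p s x 0) V,
    lintegral_finsetSum _ fun x _ => hm x]
  exact hD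

/-- The loss bounds the time integral of single occupation weighted by squared transition
probabilities. By recurrence this weight can be made large enough that the weighted average of `2 ℓ₁
- ℓ₂` is below any `δ`. -/
theorem two_mul_limOcc_one_le (hrec : IsRecurrent (symmetrised p)) {β : ℝ≥0} (hβ : β ≠ 0)
    (hM : M ≠ ∞) : 2 * limOcc p β 1 M ≤ limOcc p β 2 M := by
  refine ENNReal.le_of_forall_pos_le_add fun δ hδ _ => ?_
  set ε : ℝ≥0∞ := (δ : ℝ≥0∞) / 3 with hεdef
  have hδ0 : (δ : ℝ≥0∞) ≠ 0 := by exact_mod_cast hδ.ne'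
  have hε : ε ≠ 0 := ENNReal.div_ne_zero.mpr ⟨hδ0, ENNReal.ofNat_ne_top⟩
  have hεtop : ε ≠ ∞ := ENNReal.div_ne_top ENNReal.coe_ne_top (by norm_num)
  have h3ε : ε + (ε + ε) = δ := by
    rw [hεdef, ← add_assoc]
    exact ENNReal.add_thirds _
  -- The thinning makes the mean occupation at most `ε`, so it is negligible against one. `θ` is
  -- fixed before the time `V`, so its size does not matter for the divergence.
  obtain ⟨θ, r, hθr, hθ0, hθM⟩ : ∃ θ r : ℝ≥0∞, θ + r = 1 ∧ θ ≠ 0 ∧ θ * M ≤ ε := by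
    refine ⟨min 1 (ε / M), 1 - min 1 (ε / M), add_tsub_cancel_of_le (min_le_left _ _), ?_, ?_⟩
    · exact (lt_min one_pos (ENNReal.div_pos hε hM)).ne'
    · calc _ ≤ ε / M * M := mul_le_mul_left (min_le_right _ _) _
        _ ≤ ε := by rw [mul_comm]; exact ENNReal.mul_div_le
  have hθ1 : θ ≤ 1 := hθr ▸ le_self_add
  set c : ℝ≥0∞ := β * (2⁻¹ * θ ^ 2) with hc
  have hc0 : c ≠ 0 := by
    simp only [hc]
    exact mul_ne_zero (by exact_mod_cast hβ) (mul_ne_zero (by simp) (pow_ne_zero _ hθ0))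
  have hctop : c ≠ ∞ := ENNReal.mul_ne_top ENNReal.coe_ne_top (ENNReal.mul_ne_top (by simp)
    (ENNReal.pow_ne_top (ne_top_of_le_ne_top ENNReal.one_ne_top hθ1)))
  -- The constant is `1 / c`, so that `c * I ≥ 1` and the total loss `ε` is at most `ε` per unit of
  -- weight.
  obtain ⟨V, D, hV, hD⟩ := exists_finset_lintegral_walk_sq_gt p hrec
    (C := ε / (c * ε)) (ENNReal.div_ne_top hεtop (mul_ne_zero hc0 hε))
  set I := ∫⁻ s in Set.Icc 0 V, ∑ x ∈ D, walk p (V - s) x 0 * walk p (V - s) x 0 with hI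
  have mwalk : ∀ x, Measurable fun s => walk p (V - s) x 0 := fun x =>
    (walk_meas p x 0).comp (by fun_prop)
  have hItop : I ≠ ∞ := by
    refine ((setLIntegral_mono' (g := fun _ => (D.card : ℝ≥0∞)) measurableSet_Icc
      fun s hs => ?_).trans_lt ?_).ne
    · rw [← nsmul_one]
      refine Finset.sum_le_card_nsmul _ _ _ fun x _ => ?_
      exact mul_le_one' (walk_le_one p (sub_nonneg.mpr hs.2) _ _)
        (walk_le_one p (sub_nonneg.mpr hs.2) _ _)
    · rw [setLIntegral_const, Real.volume_Icc]
      exact ENNReal.mul_lt_top (ENNReal.natCast_lt_top _) ENNReal.ofReal_lt_top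
  have hI0 : I ≠ 0 := (pos_of_gt hD).ne'
  have hbig : ε ≤ c * I * ε := by
    have h1 : ε = ε / (c * ε) * (c * ε) := (ENNReal.div_mul_cancel (mul_ne_zero hc0 hε)
      (ENNReal.mul_ne_top hctop hεtop)).symm
    calc ε = ε / (c * ε) * (c * ε) := h1
      _ ≤ I * (c * ε) := mul_le_mul_left hD.le _
      _ = c * I * ε := by ring
  obtain ⟨Λ₀, T, hT, hℓ⟩ := exists_topOcc_le p β 2 (M := M) hε
  set ℓ₁ := limOcc p β 1 M
  set ℓ₂ := limOcc p β 2 M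
  classical
  -- `D ⊆ Λ` makes the sites of `D` contribute to the loss; the translates of `Λ₀` bring the mean of
  -- `trunc 2` at each of them close to its limit.
  set Λ : Finset (Site d) := D ∪ D.biUnion fun x => Λ₀.map (addRightEmbedding x)
  have hDΛ : D ⊆ Λ := Finset.subset_union_left
  have hΛ : ∀ x ∈ D, Λ₀.map (addRightEmbedding x) ⊆ Λ := fun x hx =>
    (Finset.subset_biUnion_of_mem (fun x => Λ₀.map (addRightEmbedding x)) hx).trans
      Finset.subset_union_right
  set κ : Site d → ℝ → ℝ≥0∞ := fun x s => β * (2⁻¹ * (θ * walk p (V - s) x 0) ^ 2) with hκ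
  have mκ : ∀ x, Measurable (κ x) := fun x =>
    (((mwalk x).const_mul θ).pow_const 2).const_mul _ |>.const_mul _
  have hκtop : ∀ x s, κ x s ≠ ∞ := by
    intro x s
    refine ENNReal.mul_ne_top ENNReal.coe_ne_top (ENNReal.mul_ne_top (by simp)
      (ENNReal.pow_ne_top (ENNReal.mul_ne_top (ne_top_of_le_ne_top ENNReal.one_ne_top hθ1) ?_)))
    rcases lt_or_ge (V - s) 0 with hs | hs
    · rw [walk_causal p _ hs]; simp [zero_apply]
    · exact ne_top_of_le_ne_top ENNReal.one_ne_top (walk_le_one p hs _ _)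
  have hsum : ∀ a : ℝ≥0∞, ∫⁻ s in Set.Icc 0 V, ∑ x ∈ D, κ x s * a = c * I * a := by
    intro a
    have mI : Measurable fun s => ∑ x ∈ D, walk p (V - s) x 0 * walk p (V - s) x 0 :=
      Finset.measurable_sum _ fun x _ => (mwalk x).mul (mwalk x)
    rw [hI, ← lintegral_const_mul _ mI, ← lintegral_mul_const _ (mI.const_mul _)]
    refine lintegral_congr fun s => ?_
    rw [Finset.mul_sum, Finset.sum_mul]
    exact Finset.sum_congr rfl fun x _ => by simp only [hκ, hc]; ring
  have hn : ∀ n, ∫⁻ s in Set.Icc 0 V, ∑ x ∈ D, κ x s * 2 *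
      act (poi (box M n)) (act (lonely p β Λ (T + s)) (trunc 1 x)) 0 ≤
      ε + c * I * (ε + (ℓ₂ + ε)) := by
    intro n
    refine (lintegral_sum_trunc_le p β hDΛ (isProfile_box hM n) hT hV hθr
      (c := ℓ₂ + ε) fun x hx s hs => ?_).trans ?_
    · exact ((isProfile_box hM n).le_topMean _).trans
        (hℓ x Λ (hΛ x hx) (T + s) (le_add_of_nonneg_right hs))
    · rw [← hsum]
      refine add_le_add hθM (lintegral_mono fun s => Finset.sum_le_sum fun x _ => ?_)
      exact mul_le_mul_right (add_le_add hθM le_rfl) _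
  have hlim := tendsto_lintegral_box (m := volume.restrict (Set.Icc 0 V)) (M := M) D
    (w := fun x s => κ x s * 2) (fun x => (mκ x).mul_const _)
    (G := fun x s => act (lonely p β Λ (T + s)) (trunc 1 x))
    (fun x ξ => ((lonely_meas p β Λ).comp (u := fun s => T + s) (by fun_prop)).act _ ξ)
    (fun x => ae_restrict_of_forall_mem measurableSet_Icc fun s hs =>
      ⟨_, fun y => walk_le_one p (add_nonneg hT hs.1) y x,
        conc_lonely_trunc p β Λ 1 x (add_nonneg hT hs.1)⟩)
    (fun x s => ENNReal.mul_ne_top (hκtop x s) ENNReal.ofNat_ne_top) hM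
  have hle : ∫⁻ s in Set.Icc 0 V, ∑ x ∈ D, κ x s * 2 *
      topMean M (act (lonely p β Λ (T + s)) (trunc 1 x)) ≤ ε + c * I * (ε + (ℓ₂ + ε)) :=
    le_of_tendsto' hlim hn
  have hge : c * I * (2 * ℓ₁) ≤ ∫⁻ s in Set.Icc 0 V, ∑ x ∈ D, κ x s * 2 *
      topMean M (act (lonely p β Λ (T + s)) (trunc 1 x)) := by
    rw [← hsum]
    refine setLIntegral_mono' measurableSet_Icc fun s hs => Finset.sum_le_sum fun x _ => ?_
    exact (mul_le_mul_right (mul_le_mul_right (limOcc_le p β Λ 1 x (add_nonneg hT hs.1)) 2)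
      (κ x s)).trans (mul_assoc _ _ _).ge
  have hfinal : c * I * (2 * ℓ₁) ≤ c * I * (ℓ₂ + δ) := by
    calc _ ≤ ε + c * I * (ε + (ℓ₂ + ε)) := hge.trans hle
      _ ≤ c * I * ε + c * I * (ε + (ℓ₂ + ε)) := add_le_add hbig le_rfl
      _ = c * I * (ℓ₂ + (ε + (ε + ε))) := by ring
      _ = _ := by rw [h3ε]
  exact (ENNReal.mul_le_mul_iff_right (mul_ne_zero hc0 hI0) (ENNReal.mul_ne_top hctop hItop)).mp
    hfinal

end

end SCBRW

namespace SCBRW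

noncomputable section

open Ker

/-! ### Occupied sites become rare -/

variable {d : ℕ} (p : PMF (Site d)) {M : ℝ≥0∞} {μ : Site d → ℝ≥0∞}

theorem one_le_exp_mul_one_sub {a b : ℝ≥0∞} (h : a + b = 1) (ha : a ≤ 2⁻¹) :
    ENNReal.ofReal (Real.exp (-(2 * a.toReal))) ≤ b := by
  have hatop : a ≠ ∞ := ne_top_of_le_ne_top (by simp) ha
  have hb : b ≠ ∞ := ne_top_of_le_ne_top ENNReal.one_ne_top (h ▸ le_add_self)
  have h1 : a.toReal + b.toReal = 1 := by
    rw [← ENNReal.toReal_add hatop hb, h, ENNReal.toReal_one]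
  have h2 : a.toReal ≤ 1 / 2 := by
    have := ENNReal.toReal_mono (by simp) ha
    simpa using this
  rw [← ENNReal.ofReal_toReal hb]
  refine ENNReal.ofReal_le_ofReal ?_
  rw [Real.exp_neg, inv_le_comm₀ (Real.exp_pos _) (by linarith)]
  refine le_trans ?_ (Real.add_one_le_exp _)
  rw [inv_le_iff_one_le_mul₀ (by linarith)]
  have h3 := ENNReal.toReal_nonneg (a := a)
  nlinarith

theorem linear_ne_top {φ : Site d → ℝ≥0∞} (hφ : ∀ x, φ x ≤ 1) (ξ : FinConfig d) :
    linear φ ξ ≠ ∞ := by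
  induction ξ using finConfig_induction with
  | h0 => simp [linear_zero]
  | h1 ξ x ih =>
    rw [linear_addAt]
    exact ENNReal.add_ne_top.mpr ⟨ih, ne_top_of_le_ne_top ENNReal.one_ne_top (hφ x)⟩

/-- The probability that no particle is at `o` is the product of `1 - walk p h x o`, and `1 - a ≥
e^{-2a}` for `a ≤ 1/2`. -/
theorem exp_linear_le_act_motion_surv {h : ℝ} (hh : 0 ≤ h) {o : Site d}
    (hw : ∀ x, walk p h x o ≤ 2⁻¹) (ξ : FinConfig d) :
    ENNReal.ofReal (Real.exp (-(2 * (linear (fun x => walk p h x o) ξ).toReal))) ≤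
      act (motion p 0 h) (surv 0 o) ξ := by
  have hw1 : ∀ x, walk p h x o ≤ 1 := fun x => walk_le_one p hh x o
  induction ξ using finConfig_induction with
  | h0 => rw [act_motion_zero p hh]; simp [linear_zero, surv]
  | h1 ξ x ih =>
    obtain ⟨ρ, hρ, hA⟩ := exists_act_motion_surv p (θ := 1) (r := 0) (o := o) hh (add_zero 1) x
    rw [one_mul] at hρ
    rw [linear_addAt, hA, ENNReal.toReal_add (linear_ne_top hw1 ξ)
      (ne_top_of_le_ne_top ENNReal.one_ne_top (hw1 x)), mul_add, neg_add, Real.exp_add,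
      ENNReal.ofReal_mul (by positivity), mul_comm]
    exact mul_le_mul' (one_le_exp_mul_one_sub hρ (hw x)) ih

theorem walk_mul_act_motion_surv_le {h : ℝ} (hh : 0 ≤ h) (o x : Site d) (ξ : FinConfig d) :
    walk p h x o * act (motion p 0 h) (surv 0 o) ξ ≤
      act (motion p 0 h) (fun ζ => if ζ o = 1 then 1 else 0) (addAt ξ x) := by
  rw [act_motion_addAt p hh]
  refine le_trans ?_ (ENNReal.le_tsum o)
  refine mul_le_mul_right (act_mono _ (fun ζ => ?_) ξ) _
  rw [addAt_apply_self, surv]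
  rcases Nat.eq_zero_or_pos (ζ o) with h0 | h0
  · simp [h0]
  · rw [zero_pow h0.ne']; exact zero_le

/-- An occupied site is occupied by a single particle a while later, unless there are many
particles around. -/
theorem exists_trunc_le_single {h : ℝ} (hh : 0 ≤ h) {o : Site d} (hw : ∀ x, walk p h x o ≤ 2⁻¹)
    {K : ℕ} (hK : K ≠ 0) : ∃ C : ℝ≥0∞, C ≠ ∞ ∧ ∀ ξ, trunc 1 o ξ ≤
      C * act (motion p 0 h) (fun ζ => if ζ o = 1 then 1 else 0) ξ +
      (K : ℝ≥0∞)⁻¹ * linear (fun x => walk p h x o) ξ := by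
  -- One particle makes no jump for a time `h`, and the others are away from `o` at the end. The
  -- second factor is valid if at most `K` particles are expected at `o`; otherwise the linear term
  -- alone exceeds one.
  set c := ENNReal.ofReal (Real.exp (-h)) * ENNReal.ofReal (Real.exp (-(2 * (K : ℝ)))) with hc
  have hc0 : c ≠ 0 := mul_ne_zero (ENNReal.ofReal_pos.mpr (Real.exp_pos _)).ne'
    (ENNReal.ofReal_pos.mpr (Real.exp_pos _)).ne'
  have hctop : c ≠ ∞ := ENNReal.mul_ne_top ENNReal.ofReal_ne_top ENNReal.ofReal_ne_top
  refine ⟨c⁻¹, ENNReal.inv_ne_top.mpr hc0, fun ξ => ?_⟩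
  rcases Nat.eq_zero_or_pos (ξ o) with h0 | h0
  · simp [trunc, h0]
  have h1 : trunc 1 o ξ ≤ 1 := by simpa using trunc_le 1 o ξ
  refine h1.trans ?_
  rcases le_or_gt (linear (fun x => walk p h x o) ξ) K with hL | hL
  · refine le_trans ?_ le_self_add
    refine (ENNReal.inv_mul_cancel hc0 hctop).ge.trans (mul_le_mul_right ?_ _)
    have e : ξ = addAt (removeAt ξ o) o := (addAt_removeAt h0.ne').symm
    have hlin : linear (fun x => walk p h x o) (removeAt ξ o) ≤ K := by
      refine le_trans ?_ hL
      conv_rhs => rw [e, linear_addAt]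
      exact le_self_add
    conv_rhs => rw [e]
    refine le_trans ?_ (walk_mul_act_motion_surv_le p hh o o _)
    refine mul_le_mul' (walk_self_ge p hh o)
      (le_trans ?_ (exp_linear_le_act_motion_surv p hh hw _))
    refine ENNReal.ofReal_le_ofReal (Real.exp_le_exp.mpr ?_)
    have := ENNReal.toReal_mono (ENNReal.natCast_ne_top K) hlin
    rw [ENNReal.toReal_natCast] at this
    linarith
  · refine le_trans ?_ le_add_self
    rw [← ENNReal.inv_mul_cancel (a := (K : ℝ≥0∞)) (by exact_mod_cast hK)
      (ENNReal.natCast_ne_top K)]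
    exact mul_le_mul_right hL.le _

theorem Conc.sub_branch_le {φ : Site d → ℝ≥0∞} {g : FinConfig d → ℝ≥0∞} (hg : Conc φ g)
    (z : Site d) (ξ : FinConfig d) :
    g ξ - act (branchKer z) g ξ ≤ 2⁻¹ * (φ z * if ξ z = 1 then 1 else 0) := by
  rw [tsub_le_iff_left, act_branchKer]
  split_ifs with hz
  · obtain ⟨ζ, rfl, -⟩ := exists_addAt_eq hz
    rw [removeAt_addAt, mul_one, ← mul_add]
    calc g (addAt ζ z) = 2⁻¹ * (g (addAt ζ z) + g (addAt ζ z)) := by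
          rw [← two_mul, ← mul_assoc, ENNReal.inv_mul_cancel two_ne_zero ENNReal.ofNat_ne_top,
            one_mul]
      _ ≤ 2⁻¹ * (g (addAt (addAt ζ z) z) + (g ζ + φ z)) :=
        mul_le_mul_right (add_le_add (hg.mono _ _) (hg.lip _ _)) _
      _ = _ := by rw [add_assoc]
  · exact le_self_add

-- Upper bound on the loss: branching of a lone particle at `z` costs at most `φ z / 2`. Inside `D`
-- single occupation is expressed by truncations; outside `D` it is bounded by one, which leaves the
-- tail of `φ`.
open Classical in
theorem Conc.dissipation_add_le {φ : Site d → ℝ≥0∞} {g : FinConfig d → ℝ≥0∞} (hg : Conc φ g)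
    (β : ℝ≥0) (Λ D : Finset (Site d)) (ξ : FinConfig d) :
    dissipation β Λ g ξ + ∑ z ∈ D, β * 2⁻¹ * φ z * trunc 2 z ξ ≤
      ∑ z ∈ D, β * φ z * trunc 1 z ξ + β * 2⁻¹ * ∑' z, if z ∈ D then 0 else φ z := by
  have h1 : dissipation β Λ g ξ ≤
      ∑ z ∈ D, β * 2⁻¹ * φ z * (if ξ z = 1 then 1 else 0) +
        β * 2⁻¹ * ∑' z, if z ∈ D then 0 else φ z := by
    calc dissipation β Λ g ξ ≤ ∑ z ∈ Λ, β * 2⁻¹ * (φ z * if ξ z = 1 then 1 else 0) := by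
          refine Finset.sum_le_sum fun z _ => ?_
          rw [mul_assoc]
          exact mul_le_mul_right (hg.sub_branch_le z ξ) _
      _ ≤ ∑' z, β * 2⁻¹ * (φ z * if ξ z = 1 then 1 else 0) := ENNReal.sum_le_tsum _
      _ ≤ ∑' z, ((if z ∈ D then β * 2⁻¹ * φ z * (if ξ z = 1 then 1 else 0) else 0) +
          β * 2⁻¹ * if z ∈ D then 0 else φ z) := by
        refine ENNReal.tsum_le_tsum fun z => ?_
        split_ifs <;> simp [mul_assoc]
      _ = _ := by
        rw [ENNReal.tsum_add, ENNReal.tsum_mul_left, tsum_eq_sum (s := D)]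
        · congr 1
          exact Finset.sum_congr rfl fun z hz => if_pos hz
        · intro z hz
          exact if_neg hz
  refine (add_le_add h1 le_rfl).trans (le_of_eq ?_)
  rw [add_right_comm, ← Finset.sum_add_distrib]
  congr 1
  refine Finset.sum_congr rfl fun z _ => ?_
  rw [← mul_add, ← two_mul_trunc_one]
  calc _ = β * (2⁻¹ * 2) * φ z * trunc 1 z ξ := by ring
    _ = _ := by rw [ENNReal.inv_mul_cancel two_ne_zero ENNReal.ofNat_ne_top, mul_one]

theorem conc_lonely_motion_trunc (β : ℝ≥0) (Λ : Finset (Site d)) (K : ℕ) (o : Site d) {s h : ℝ}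
    (hs : 0 ≤ s) (hh : 0 ≤ h) :
    Conc (fun x => walk p (s + h) x o)
      (act (lonely p β Λ s) (act (motion p 0 h) (trunc K o))) := by
  have h1 := conc_lonely_trunc p β ∅ K o hh
  rw [lonely_empty] at h1
  have h2 := h1.act_lonely p β Λ (ENNReal.natCast_ne_top K) (fun ξ =>
    (act_mono _ (trunc_le K o) ξ).trans (act_const_of_one (act_motion_one p hh ξ) _).le) hs
  have e : act (walk p s) (fun x => walk p h x o) = fun x => walk p (s + h) x o := by
    rw [walk_add p hs hh]
    rfl
  rwa [e] at h2

open Classical in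
/-- The effect of the branching during a time `h`. -/
theorem act_lonely_motion_trunc_add_le (β : ℝ≥0) (Λ D : Finset (Site d)) (μ : Site d → ℝ≥0∞)
    (hμ : ∑' x, μ x ≠ ∞) (o : Site d) {s h : ℝ} (hs : 0 ≤ s) (hh : 0 ≤ h) :
    act (poi μ) (act (lonely p β Λ s) (act (motion p 0 h) (trunc 1 o))) 0 +
      ∫⁻ r in Set.Icc 0 h, ∑ z ∈ D, β * 2⁻¹ * walk p (h - r) z o *
        act (poi μ) (act (lonely p β Λ (s + r)) (trunc 2 z)) 0 ≤
    act (poi μ) (act (lonely p β Λ (s + h)) (trunc 1 o)) 0 +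
      ((∫⁻ r in Set.Icc 0 h, ∑ z ∈ D, β * walk p (h - r) z o *
        act (poi μ) (act (lonely p β Λ (s + r)) (trunc 1 z)) 0) +
      ∫⁻ r in Set.Icc 0 h, β * 2⁻¹ * ∑' z, if z ∈ D then 0 else walk p (h - r) z o) := by
  set S := lonely p β Λ with hS
  set G : ℝ → FinConfig d → ℝ≥0∞ := fun v => act (motion p 0 v) (trunc 1 o) with hG
  have mS : TMeas S := lonely_meas p β Λ
  have mG : ∀ ξ, Measurable fun r => G (h - r) ξ := fun ξ =>
    ((motion_meas p 0).comp (u := fun r => h - r) (by fun_prop)).act _ ξ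
  have mdiss : ∀ ξ, Measurable fun r => dissipation β Λ (G (h - r)) ξ := fun ξ =>
    Finset.measurable_sum _ fun x _ => Measurable.const_mul
      ((mG ξ).sub ((TMeas.const _).act_act mG ξ)) _
  have mSd : ∀ ξ, Measurable fun r => act (S r) (dissipation β Λ (G (h - r))) ξ := fun ξ =>
    mS.act_act mdiss ξ
  have mSs : TMeas fun r => S (s + r) := mS.comp (by fun_prop)
  have mwalk : ∀ z, Measurable fun r => walk p (h - r) z o := fun z =>
    (walk_meas p z o).comp (by fun_prop)
  have mE : ∀ (K : ℕ) z, Measurable fun r => act (poi μ) (act (S (s + r)) (trunc K z)) 0 :=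
    fun K z => (TMeas.const _).act_act (fun ξ => mSs.act _ ξ) 0
  have h1 : act (poi μ) (act (S s) (G h)) 0 = act (poi μ) (act (S (s + h)) (trunc 1 o)) 0 +
      ∫⁻ r in Set.Icc 0 h, act (poi μ) (act (S (s + r)) (dissipation β Λ (G (h - r)))) 0 := by
    have e1 : ∀ r ∈ Set.Icc 0 h, act (poi μ) (act (S (s + r)) (dissipation β Λ (G (h - r)))) 0 =
        act (poi μ) (act (S s) (act (S r) (dissipation β Λ (G (h - r))))) 0 := fun r hr => by
      rw [hS, lonely_add p β Λ hr.1 hs, act_mul]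
    rw [setLIntegral_congr_fun measurableSet_Icc e1,
      ← act_lintegral (poi μ) (fun ξ => (TMeas.const _).act_act mSd ξ), ← act_add_apply]
    congr 1
    funext ξ
    rw [← act_lintegral (S s) mSd, hS, lonely_add p β Λ hh hs, act_mul, ← act_add_apply]
    congr 1
    funext ζ
    exact (lonely_add_dissipation_motion p β Λ (conc_trunc 1 o) (ENNReal.natCast_ne_top 1)
      (trunc_le 1 o) h ζ).symm
  have m2 : Measurable fun r => ∑ z ∈ D, β * 2⁻¹ * walk p (h - r) z o *
      act (poi μ) (act (S (s + r)) (trunc 2 z)) 0 :=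
    Finset.measurable_sum _ fun z _ => ((mwalk z).const_mul _).mul (mE 2 z)
  have m1 : Measurable fun r => ∑ z ∈ D, β * walk p (h - r) z o *
      act (poi μ) (act (S (s + r)) (trunc 1 z)) 0 :=
    Finset.measurable_sum _ fun z _ => ((mwalk z).const_mul _).mul (mE 1 z)
  rw [h1, add_assoc, ← lintegral_add_right _ m2, ← lintegral_add_left m1]
  refine add_le_add le_rfl (setLIntegral_mono' measurableSet_Icc fun r hr => ?_)
  have hv := sub_nonneg.mpr hr.2
  have hg : Conc (fun x => walk p (h - r) x o) (G (h - r)) := by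
    have h2 := conc_lonely_trunc p β ∅ 1 o hv
    rwa [lonely_empty] at h2
  have key := act_mono (poi μ) (act_mono (S (s + r)) fun ξ => hg.dissipation_add_le β Λ D ξ) 0
  simp only [← act_mul, act_add_apply, act_sum, act_const_mul] at key
  simp only [← act_mul]
  refine key.trans (add_le_add le_rfl (mul_le_mul_right ?_ _))
  have h3 : ∀ C : ℝ≥0∞, act (poi μ * S (s + r)) (fun _ => C) 0 ≤ C := fun C => by
    rw [act_mul]
    exact (act_mono _ (fun ξ => act_lonely_const_le p β Λ (add_nonneg hs hr.1) C ξ) 0).trans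
      (act_poi_const hμ C 0).le
  exact h3 _

end

end SCBRW

namespace SCBRW

noncomputable section

open Ker

variable {d : ℕ} (p : PMF (Site d)) {M : ℝ≥0∞} {μ : Site d → ℝ≥0∞}

open Classical in
theorem exists_finset_tail_le (h : ℝ) (o : Site d) {ε : ℝ≥0∞} (hε : ε ≠ 0) :
    ∃ D : Finset (Site d),
      ∫⁻ r in Set.Icc 0 h, ∑' z, (if z ∈ D then 0 else walk p (h - r) z o) ≤ ε := by
  have mwalk : ∀ z, Measurable fun r => walk p (h - r) z o := fun z =>
    (walk_meas p z o).comp (by fun_prop)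
  set a : Site d → ℝ≥0∞ := fun z => ∫⁻ r in Set.Icc 0 h, walk p (h - r) z o with ha
  have hsum : ∑' z, a z ≠ ∞ := by
    rw [ha, ← lintegral_tsum fun z => (mwalk z).aemeasurable]
    refine ((setLIntegral_mono' (g := fun _ => 1) measurableSet_Icc fun r hr =>
      (walk_col_sum p (sub_nonneg.mpr hr.2) o).le).trans_lt ?_).ne
    rw [setLIntegral_const, Real.volume_Icc, one_mul]
    exact ENNReal.ofReal_lt_top
  obtain ⟨D, hD⟩ := ((ENNReal.tendsto_tsum_compl_atTop_zero hsum).eventually_lt_const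
    (pos_iff_ne_zero.mpr hε)).exists
  refine ⟨D, le_trans (le_of_eq ?_) hD.le⟩
  rw [lintegral_tsum fun z => ?_]
  · have h1 : ∀ z, ∫⁻ r in Set.Icc 0 h, (if z ∈ D then 0 else walk p (h - r) z o) =
        if z ∈ D then 0 else a z := fun z => by
      split_ifs <;> simp [ha]
    simp only [h1]
    have h2 := tsum_subtype_eq_of_support_subset (f := fun z => if z ∈ D then 0 else a z)
      (s := {z | z ∉ D}) (fun z hz hzD => hz (if_pos hzD))
    rw [← h2]
    exact tsum_congr fun z => if_neg z.2
  · split_ifs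
    · exact aemeasurable_const
    · exact (mwalk z).aemeasurable

theorem act_poi_lonely_linear_le (β : ℝ≥0) (Λ : Finset (Site d)) (hμ : IsProfile M μ) {s h : ℝ}
    (hs : 0 ≤ s) (hh : 0 ≤ h) (o : Site d) :
    act (poi μ) (act (lonely p β Λ s) (linear fun x => walk p h x o)) 0 ≤ M := by
  refine (act_mono _ (fun ξ => act_lonely_linear_le p β Λ hs _ ξ) 0).trans ?_
  refine ((Conc.linear _).act_poi_le hμ.mass 0).trans ?_
  have e : act (walk p s) (fun x => walk p h x o) = fun x => walk p (s + h) x o := by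
    rw [walk_add p hs hh]
    rfl
  rw [linear_zero, zero_add, e]
  exact pushWalk_le p (add_nonneg hs hh) hμ.le o

/-- Switching off the branching for a last period `h` changes the occupation probability little,
since lone particles are rare. After this period single occupation has probability at most about `2
ℓ₁ - ℓ₂ ≤ 0`, while `hCL` bounds occupation before it by a multiple of that probability. -/
theorem limOcc_one_le (hrec : IsRecurrent (symmetrised p)) {β : ℝ≥0} (hβ : β ≠ 0)
    (hM : M ≠ ∞) {h : ℝ} (hh : 0 ≤ h) {C L : ℝ≥0∞} (hC : C ≠ ∞)
    (hCL : ∀ ξ, trunc 1 0 ξ ≤ C * act (motion p 0 h) (fun ζ => if ζ 0 = 1 then 1 else 0) ξ +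
      L * linear (fun x => walk p h x 0) ξ) {ε : ℝ≥0∞} (hε : ε ≠ 0) :
    limOcc p β 1 M ≤ 2 * C * (1 + β * ENNReal.ofReal h + β * 2⁻¹) * ε + L * M := by
  classical
  obtain ⟨D, hD⟩ := exists_finset_tail_le p h 0 hε
  obtain ⟨Λ₀, T, hT, hℓ⟩ := exists_topOcc_le p β 1 (M := M) hε
  have hℓ₁₂ := two_mul_limOcc_one_le p hrec hβ hM
  have hℓtop := limOcc_ne_top p β 1 (M := M)
  have hℓ₂top := limOcc_ne_top p β 2 (M := M)
  set ℓ₁ := limOcc p β 1 M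
  set ℓ₂ := limOcc p β 2 M
  set Λ : Finset (Site d) := (insert 0 D).biUnion fun x => Λ₀.map (addRightEmbedding x)
  have hΛ : ∀ x ∈ insert 0 D, Λ₀.map (addRightEmbedding x) ⊆ Λ := fun x hx =>
    Finset.subset_biUnion_of_mem (fun x => Λ₀.map (addRightEmbedding x)) hx
  set S := lonely p β Λ
  set X := topMean M (act (S T) (act (motion p 0 h) (trunc 1 0))) with hX
  have mwalk : ∀ z, Measurable fun r => walk p (h - r) z 0 := fun z =>
    (walk_meas p z 0).comp (by fun_prop)
  set I := ∫⁻ r in Set.Icc 0 h, ∑ z ∈ D, walk p (h - r) z 0 with hI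
  have hIle : I ≤ ENNReal.ofReal h := by
    refine (setLIntegral_mono' (g := fun _ => 1) measurableSet_Icc fun r hr =>
      (ENNReal.sum_le_tsum D).trans (walk_col_sum p (sub_nonneg.mpr hr.2) 0).le).trans ?_
    rw [setLIntegral_const, Real.volume_Icc, one_mul, sub_zero]
  have hsum : ∀ a b : ℝ≥0∞, ∫⁻ r in Set.Icc 0 h, ∑ z ∈ D, a * walk p (h - r) z 0 * b =
      a * I * b := by
    intro a b
    have mI : Measurable fun r => ∑ z ∈ D, walk p (h - r) z 0 :=
      Finset.measurable_sum _ fun z _ => mwalk z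
    rw [hI, ← lintegral_const_mul _ mI, ← lintegral_mul_const _ (mI.const_mul _)]
    refine lintegral_congr fun s => ?_
    rw [Finset.mul_sum, Finset.sum_mul]
  have hn : ∀ n, act (poi (box M n)) (act (S T) (act (motion p 0 h) (trunc 1 0))) 0 +
      ∫⁻ r in Set.Icc 0 h, ∑ z ∈ D, β * 2⁻¹ * walk p (h - r) z 0 *
        act (poi (box M n)) (act (S (T + r)) (trunc 2 z)) 0 ≤
      (ℓ₁ + ε) + (β * I * (ℓ₁ + ε) + β * 2⁻¹ * ε) := by
    intro n
    refine (act_lonely_motion_trunc_add_le p β Λ D (box M n) (isProfile_box hM n).mass 0 hT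
      hh).trans (add_le_add ?_ (add_le_add ?_ ?_))
    · exact ((isProfile_box hM n).le_topMean _).trans
        (hℓ 0 Λ (hΛ 0 (Finset.mem_insert_self _ _)) _ (le_add_of_nonneg_right hh))
    · rw [← hsum]
      refine setLIntegral_mono' measurableSet_Icc fun r hr => Finset.sum_le_sum fun z hz =>
        mul_le_mul_right ?_ _
      exact ((isProfile_box hM n).le_topMean _).trans
        (hℓ z Λ (hΛ z (Finset.mem_insert_of_mem hz)) _ (le_add_of_nonneg_right hr.1))
    · rw [lintegral_const_mul' _ _ (ENNReal.mul_ne_top ENNReal.coe_ne_top (by simp))]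
      exact mul_le_mul_right hD _
  have htop : ∀ z r, β * 2⁻¹ * walk p (h - r) z 0 ≠ ∞ := by
    intro z r
    refine ENNReal.mul_ne_top (ENNReal.mul_ne_top ENNReal.coe_ne_top (by simp)) ?_
    rcases lt_or_ge (h - r) 0 with hs | hs
    · rw [walk_causal p _ hs]; simp [zero_apply]
    · exact ne_top_of_le_ne_top ENNReal.one_ne_top (walk_le_one p hs _ _)
  have hlim := tendsto_lintegral_box (m := volume.restrict (Set.Icc 0 h)) (M := M) D
    (w := fun z r => β * 2⁻¹ * walk p (h - r) z 0) (fun z => (mwalk z).const_mul _)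
    (G := fun z r => act (S (T + r)) (trunc 2 z))
    (fun z ξ => ((lonely_meas p β Λ).comp (u := fun r => T + r) (by fun_prop)).act _ ξ)
    (fun z => ae_restrict_of_forall_mem measurableSet_Icc fun r hr =>
      ⟨_, fun y => walk_le_one p (add_nonneg hT hr.1) y z,
        conc_lonely_trunc p β Λ 2 z (add_nonneg hT hr.1)⟩) htop hM
  have cX := conc_lonely_motion_trunc p β Λ 1 0 hT hh
  have wle : ∀ x, walk p (T + h) x 0 ≤ 1 := fun x => walk_le_one p (add_nonneg hT hh) x 0
  have h1 : X + β * 2⁻¹ * I * ℓ₂ ≤ (ℓ₁ + ε) + (β * I * (ℓ₁ + ε) + β * 2⁻¹ * ε) := by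
    refine le_trans (add_le_add le_rfl ?_)
      (le_of_tendsto' ((cX.tendsto_box wle hM).add hlim) hn)
    rw [← hsum]
    exact setLIntegral_mono' measurableSet_Icc fun r hr => Finset.sum_le_sum fun z _ =>
      mul_le_mul_right (limOcc_le p β Λ 2 z (add_nonneg hT hr.1)) _
  -- The loss during the last period is at most `β * 2⁻¹ * I * (2 ℓ₁ - ℓ₂)` up to multiples of `ε`,
  -- and `2 ℓ₁ ≤ ℓ₂`.
  have h2 : X ≤ ℓ₁ + (1 + β * ENNReal.ofReal h + β * 2⁻¹) * ε := by
    have hfin : β * I * ℓ₁ ≠ ∞ := ENNReal.mul_ne_top (ENNReal.mul_ne_top ENNReal.coe_ne_top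
      (ne_top_of_le_ne_top ENNReal.ofReal_ne_top hIle)) hℓtop
    refine (ENNReal.add_le_add_iff_right hfin).mp ?_
    calc X + β * I * ℓ₁ = X + β * (2⁻¹ * 2) * I * ℓ₁ := by
          rw [ENNReal.inv_mul_cancel two_ne_zero ENNReal.ofNat_ne_top, mul_one]
      _ = X + β * 2⁻¹ * I * (2 * ℓ₁) := by ring
      _ ≤ X + β * 2⁻¹ * I * ℓ₂ := add_le_add le_rfl (mul_le_mul_right hℓ₁₂ _)
      _ ≤ (ℓ₁ + ε) + (β * I * (ℓ₁ + ε) + β * 2⁻¹ * ε) := h1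
      _ = ℓ₁ + (1 + β * I + β * 2⁻¹) * ε + β * I * ℓ₁ := by ring
      _ ≤ _ := by gcongr
  have hn2 : ∀ n, act (poi (box M n)) (act (S T) (trunc 1 0)) 0 +
      C * act (poi (box M n)) (act (S T) (act (motion p 0 h) (trunc 2 0))) 0 ≤
      C * (2 * X) + L * M := by
    intro n
    have e : ∀ ξ, trunc 1 0 ξ + C * act (motion p 0 h) (trunc 2 0) ξ ≤
        C * (2 * act (motion p 0 h) (trunc 1 0) ξ) + L * linear (fun x => walk p h x 0) ξ := by
      intro ξ
      have e1 : act (motion p 0 h) (fun ζ => if ζ 0 = 1 then 1 else 0) ξ +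
          act (motion p 0 h) (trunc 2 0) ξ = 2 * act (motion p 0 h) (trunc 1 0) ξ := by
        rw [← act_add_apply, ← act_const_mul]
        congr 1
        funext ζ
        exact (two_mul_trunc_one 0 ζ).symm
      refine (add_le_add (hCL ξ) le_rfl).trans (le_of_eq ?_)
      rw [← e1]
      ring
    have key := act_mono (poi (box M n)) (act_mono (S T) e) 0
    simp only [← act_mul, act_add_apply, act_const_mul, mul_assoc] at key
    simp only [← act_mul]
    refine key.trans (add_le_add (mul_le_mul_right (mul_le_mul_right ?_ _) _)
      (mul_le_mul_right ?_ _))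
    · rw [hX]
      simp only [← act_mul]
      rw [act_mul]
      exact (isProfile_box hM n).le_topMean _
    · rw [act_mul]
      exact act_poi_lonely_linear_le p β Λ (isProfile_box hM n) hT hh 0
  have h3 : ℓ₁ + C * ℓ₂ ≤ C * (2 * X) + L * M := by
    have t1 := (conc_lonely_trunc p β Λ 1 0 hT).tendsto_box (fun x => walk_le_one p hT x 0) hM
    have t2 := (conc_lonely_motion_trunc p β Λ 2 0 hT hh).tendsto_box wle hM
    refine le_trans (add_le_add (limOcc_le p β Λ 1 0 hT) (mul_le_mul_right ?_ C))
      (le_of_tendsto' (t1.add (ENNReal.Tendsto.const_mul t2 (Or.inr hC))) hn2)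
    -- A lower bound on the mean of `trunc 2` after pure motion is needed, since it enters single
    -- occupation with a minus sign. Restoring the branching only lowers it, and then `ℓ₂` is a
    -- lower bound.
    refine (limOcc_le p β Λ 2 0 (add_nonneg hT hh)).trans (topMean_mono fun ξ => ?_)
    rw [lonely_add p β Λ hh hT, act_mul]
    exact act_mono _ (fun ζ => lonely_le_motion p β Λ (conc_trunc 2 0)
      (ENNReal.natCast_ne_top 2) (trunc_le 2 0) h ζ) ξ
  have hfin : C * ℓ₂ ≠ ∞ := ENNReal.mul_ne_top hC hℓ₂top
  refine (ENNReal.add_le_add_iff_right hfin).mp (h3.trans ?_)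
  calc C * (2 * X) + L * M
      ≤ C * (2 * (ℓ₁ + (1 + β * ENNReal.ofReal h + β * 2⁻¹) * ε)) + L * M := by gcongr
    _ = 2 * C * (1 + β * ENNReal.ofReal h + β * 2⁻¹) * ε + L * M + C * (2 * ℓ₁) := by ring
    _ ≤ _ := add_le_add le_rfl (mul_le_mul_right hℓ₁₂ _)

/-- The period `h` is chosen so that all transition probabilities are at most `1/2`. For fixed `K`
the constant `C` is finite and `ε` tends to zero; then `K` tends to infinity. -/
theorem limOcc_one_eq_zero (hd : 1 ≤ d) (hirr : IsIrreducible fun x => p x)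
    (hrec : IsRecurrent (symmetrised p)) {β : ℝ≥0} (hβ : β ≠ 0) (hM : M ≠ ∞) :
    limOcc p β 1 M = 0 := by
  obtain ⟨h, hw, hh⟩ := ((eventually_walk_le p hd hirr (ε := 2⁻¹) (by simp)).and
    (eventually_ge_atTop 0)).exists
  have hK : ∀ K : ℕ, K ≠ 0 → limOcc p β 1 M ≤ (K : ℝ≥0∞)⁻¹ * M := by
    intro K hK
    obtain ⟨C, hC, hCL⟩ := exists_trunc_le_single p hh (fun x => hw x 0) hK
    refine ENNReal.le_of_forall_pos_le_add fun δ hδ _ => ?_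
    set B : ℝ≥0∞ := 2 * C * (1 + β * ENNReal.ofReal h + β * 2⁻¹) with hB
    have hBtop : B ≠ ∞ := by
      refine ENNReal.mul_ne_top (ENNReal.mul_ne_top ENNReal.ofNat_ne_top hC) ?_
      refine ENNReal.add_ne_top.mpr ⟨ENNReal.add_ne_top.mpr ⟨ENNReal.one_ne_top, ?_⟩, ?_⟩
      · exact ENNReal.mul_ne_top ENNReal.coe_ne_top ENNReal.ofReal_ne_top
      · exact ENNReal.mul_ne_top ENNReal.coe_ne_top (by simp)
    have hδ0 : (δ : ℝ≥0∞) ≠ 0 := by exact_mod_cast hδ.ne'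
    have h1 := limOcc_one_le p hrec hβ hM hh hC hCL (ε := δ / (B + 1))
      (ENNReal.div_ne_zero.mpr ⟨hδ0, ENNReal.add_ne_top.mpr ⟨hBtop, ENNReal.one_ne_top⟩⟩)
    refine h1.trans ?_
    rw [add_comm]
    refine add_le_add le_rfl ?_
    calc B * (δ / (B + 1)) ≤ (B + 1) * (δ / (B + 1)) := mul_le_mul_left le_self_add _
      _ ≤ δ := ENNReal.mul_div_le
  have ht : Tendsto (fun K : ℕ => (K : ℝ≥0∞)⁻¹ * M) atTop (𝓝 (0 * M)) :=
    ENNReal.Tendsto.mul_const ENNReal.tendsto_inv_nat_nhds_zero (Or.inr hM)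
  rw [zero_mul] at ht
  refine le_antisymm (ge_of_tendsto ht ?_) zero_le
  filter_upwards [eventually_ne_atTop 0] with K hK0 using hK K hK0

end

end SCBRW

namespace SCBRW

noncomputable section

open Ker

/-! ### Comparison of independent particles with a Poisson configuration -/

variable {d : ℕ} (p : PMF (Site d)) {M : ℝ≥0∞} {μ : Site d → ℝ≥0∞}
  {φ : Site d → ℝ≥0∞} {g : FinConfig d → ℝ≥0∞}

theorem exp_le_two_add {x : ℝ} (h0 : 0 ≤ x) (h1 : x ≤ 1) : Real.exp x ≤ 2 + x := by
  have h := Real.abs_exp_sub_one_sub_id_le (x := x) (by rwa [abs_of_nonneg h0])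
  have h2 := (abs_le.mp h).2
  nlinarith

/-- A Bernoulli particle is dominated by a Poisson number of particles. -/
theorem Conc.bernoulli_le_poi (hg : Conc φ g) {q q' : ℝ≥0∞} (hq : q + q' = 1) (hq2 : q ≤ 2⁻¹)
    (hμ : ∑' x, μ x = q) (ζ : FinConfig d) :
    act (addKer μ) g ζ + q' * g ζ ≤ act (poi fun x => 2 * μ x) g ζ := by
  have hqtop : q ≠ ∞ := ne_top_of_le_ne_top (by simp) hq2
  have h2q1 : 2 * q ≤ 1 := by
    calc 2 * q ≤ 2 * 2⁻¹ := mul_le_mul_right hq2 _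
      _ = 1 := ENNReal.mul_inv_cancel two_ne_zero ENNReal.ofNat_ne_top
  have h2qtop : 2 * q ≠ ∞ := ne_top_of_le_ne_top ENNReal.one_ne_top h2q1
  have hmass : ∑' x, 2 * μ x = 2 * q := by rw [ENNReal.tsum_mul_left, hμ]
  set J := act (addKer μ) g ζ with hJ
  set E : ℝ≥0∞ := ENNReal.ofReal (Real.exp (2 * q).toReal) with hE
  have hEtop : E ≠ ∞ := ENNReal.ofReal_ne_top
  -- `W` is the series of `(e^{2q} - 1) / (2q)`. A Poisson variable is empty with probability
  -- `e^{-2q} ≤ 1 - q` when `q ≤ 1/2`; with mean `q` instead of `2q` this would fail, hence the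
  -- factor `2` in the intensity.
  set W : ℝ≥0∞ := ∑' n : ℕ, ((n + 1).factorial : ℝ≥0∞)⁻¹ * (2 * q) ^ n with hW
  have hEsum : E = ∑' n : ℕ, (n.factorial : ℝ≥0∞)⁻¹ * (2 * q) ^ n := by
    rw [hE, ofReal_exp_eq_tsum ENNReal.toReal_nonneg, ENNReal.ofReal_toReal h2qtop]
  have hEW : E = 1 + W * (2 * q) := by
    rw [hEsum, tsum_eq_zero_add' ENNReal.summable, hW, ← ENNReal.tsum_mul_right]
    congr 1
    · simp
    · exact tsum_congr fun n => by rw [pow_succ]; ring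
  have hWE : E ≤ 2 * W := by
    have h1 : E ≤ 2 + 2 * q := by
      rw [hE, ← ENNReal.ofReal_toReal h2qtop, ENNReal.toReal_ofReal ENNReal.toReal_nonneg]
      have : (2 : ℝ≥0∞) = ENNReal.ofReal 2 := by simp
      rw [this, ← ENNReal.ofReal_add (by norm_num) ENNReal.toReal_nonneg, ← this]
      refine ENNReal.ofReal_le_ofReal (exp_le_two_add ENNReal.toReal_nonneg ?_)
      have := ENNReal.toReal_mono ENNReal.one_ne_top h2q1
      simpa using this
    have h2 : 1 + 2⁻¹ * (2 * q) ≤ W := by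
      refine le_trans (le_of_eq ?_) (ENNReal.sum_le_tsum (Finset.range 2))
      simp [Finset.sum_range_succ]
    calc E ≤ 2 + 2 * q := h1
      _ = 2 * (1 + 2⁻¹ * (2 * q)) := by
        rw [← mul_assoc, ENNReal.inv_mul_cancel two_ne_zero ENNReal.ofNat_ne_top]; ring
      _ ≤ 2 * W := mul_le_mul_right h2 _
  -- The surplus `δ = 2W - E` turns surplus weight on `g ζ` into weight on `J`, which is possible
  -- because adding a particle increases `g`.
  obtain ⟨δ, hδ⟩ := exists_add_of_le hWE
  have hid : 1 + δ * q = E * q' := by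
    refine (ENNReal.add_left_inj (ENNReal.mul_ne_top hEtop hqtop)).mp ?_
    calc 1 + δ * q + E * q = 1 + (E + δ) * q := by ring
      _ = 1 + W * (2 * q) := by rw [← hδ]; ring
      _ = E * (q + q') := by rw [← hEW, hq, mul_one]
      _ = _ := by ring
  have hJq : q * g ζ ≤ J := by
    have := hg.pow_addKer_ge (μ := μ) 1 ζ
    rwa [pow_one, pow_one, hμ] at this
  have hJ2 : act (addKer fun x => 2 * μ x) g ζ = 2 * J := by
    rw [hJ, act_addKer, act_addKer, ← ENNReal.tsum_mul_left]
    simp only [mul_assoc]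
  have hpow : ∀ n : ℕ, (2 * q) ^ n * (2 * J) ≤ act (addKer (fun x => 2 * μ x) ^ (n + 1)) g ζ := by
    intro n
    rw [pow_succ', act_mul, ← hJ2, ← act_const_mul]
    refine act_mono _ (fun χ => ?_) ζ
    have := hg.pow_addKer_ge (μ := fun x => 2 * μ x) n χ
    rwa [hmass] at this
  have hmain : E * (J + q' * g ζ) ≤ act (exp (addKer fun x => 2 * μ x)) g ζ := by
    rw [act_exp, tsum_eq_zero_add' ENNReal.summable]
    calc E * (J + q' * g ζ) = (1 + δ * q) * g ζ + E * J := by rw [hid]; ring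
      _ = g ζ + δ * (q * g ζ) + E * J := by ring
      _ ≤ g ζ + δ * J + E * J := by gcongr
      _ = g ζ + W * (2 * J) := by
        rw [add_assoc, ← add_mul, add_comm δ, ← hδ]; ring
      _ ≤ _ := by
        refine add_le_add ?_ ?_
        · simp [act_one]
        · rw [hW, ← ENNReal.tsum_mul_right]
          refine ENNReal.tsum_le_tsum fun n => ?_
          rw [mul_assoc]
          exact mul_le_mul_right (hpow n) _
  rw [SCBRW.act_poi, hmass]
  calc J + q' * g ζ = ENNReal.ofReal (Real.exp (-(2 * q).toReal)) * (E * (J + q' * g ζ)) := by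
        rw [← mul_assoc, hE, ofReal_exp_neg_mul, one_mul]
    _ ≤ _ := mul_le_mul_right hmain _

-- Landing in `B` is a Bernoulli event with a distributed position, dominated by a Poisson
-- configuration; landing at `y` outside `B` costs at most `φ y`.
open Classical in
theorem Conc.act_walk_le_poi (hg : Conc φ g) {s : ℝ} (hs : 0 ≤ s) (B : Finset (Site d)) {x : Site d}
    (hB : ∑ y ∈ B, walk p s x y ≤ 2⁻¹) (ζ : FinConfig d) :
    act (walk p s) (fun y => g (addAt ζ y)) x ≤
      act (poi fun y => 2 * if y ∈ B then walk p s x y else 0) g ζ +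
        ∑' y, walk p s x y * if y ∈ B then 0 else φ y := by
  set π : Site d → ℝ≥0∞ := fun y => if y ∈ B then walk p s x y else 0 with hπ
  set q' : ℝ≥0∞ := ∑' y, if y ∈ B then 0 else walk p s x y with hq'
  have hq : ∑' y, π y = ∑ y ∈ B, walk p s x y := by
    rw [tsum_eq_sum (s := B) fun y hy => if_neg hy]
    exact Finset.sum_congr rfl fun y hy => if_pos hy
  have h1 : ∑ y ∈ B, walk p s x y + q' = 1 := by
    rw [← hq, hq', ← ENNReal.tsum_add, ← walk_row_sum p hs x]
    refine tsum_congr fun y => ?_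
    simp only [hπ]
    split_ifs <;> simp
  refine le_trans ?_ (add_le_add (hg.bernoulli_le_poi h1 hB hq ζ) le_rfl)
  rw [act_addKer, hq', ← ENNReal.tsum_mul_right, ← ENNReal.tsum_add, ← ENNReal.tsum_add]
  refine ENNReal.tsum_le_tsum fun y => ?_
  simp only [hπ]
  split_ifs
  · simp
  · rw [zero_mul, zero_add, ← mul_add]
    exact mul_le_mul_right (hg.lip ζ y) _

-- Induction over the particles. After the last one is replaced by a Poisson configuration, the test
-- function `act (poi _) g` is concave with the same `φ`, and the Poisson configurations superpose.
open Classical in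
theorem Conc.act_motion_le_poi {s : ℝ} (hs : 0 ≤ s) (B : Finset (Site d))
    (hB : ∀ x, ∑ y ∈ B, walk p s x y ≤ 2⁻¹) (ξ : FinConfig d) (hg : Conc φ g) :
    act (motion p 0 s) g ξ ≤
      act (poi fun y => 2 * SCBRW.linear (fun x => if y ∈ B then walk p s x y else 0) ξ) g 0 +
        SCBRW.linear (fun x => ∑' y, walk p s x y * if y ∈ B then 0 else φ y) ξ := by
  have hmass : ∀ ξ : FinConfig d,
      ∑' y, 2 * SCBRW.linear (fun x => if y ∈ B then walk p s x y else 0) ξ ≠ ∞ := by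
    intro ξ
    rw [tsum_eq_sum (s := B)]
    · refine ENNReal.sum_ne_top.mpr fun y hy => ENNReal.mul_ne_top ENNReal.ofNat_ne_top ?_
      refine linear_ne_top (fun x => ?_) ξ
      rw [if_pos hy]
      exact walk_le_one p hs x y
    · intro y hy
      simp [hy, SCBRW.linear]
  induction ξ using finConfig_induction generalizing g with
  | h0 =>
    rw [act_motion_zero p hs]
    refine le_trans ?_ (le_self_add)
    simpa using hg.le_act_poi (hmass 0) 0
  | h1 ξ x ih =>
    have hmx : ∑' y, 2 * (if y ∈ B then walk p s x y else 0) ≠ ∞ := by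
      have := hmass (addAt 0 x)
      simpa [linear_addAt, linear_zero] using this
    have e1 : act (motion p 0 s) g (addAt ξ x) =
        act (motion p 0 s) (fun ζ => act (walk p s) (fun y => g (addAt ζ y)) x) ξ := by
      rw [act_motion_addAt p hs]
      exact act_act_swap (walk p s) (motion p 0 s) (fun y ζ => g (addAt ζ y)) x ξ
    rw [e1]
    refine (act_mono _ (fun ζ => hg.act_walk_le_poi p hs B (hB x) ζ) ξ).trans ?_
    rw [act_add_apply, act_const_of_one (act_motion_one p hs ξ), linear_addAt]
    simp only [linear_addAt, mul_add]
    rw [poi_add (hmass ξ) hmx, act_mul, ← add_assoc]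
    exact add_le_add (ih (hg.act_poi hmx)) le_rfl

theorem tsum_walk_sub (s : ℝ) (y : Site d) :
    ∑' x, (walk p s x y - walk p s x 0) = walkDiff p s y := by
  have h (u : Site d) : walk p s (y - u) y - walk p s (y - u) 0 =
      walk p s 0 u - walk p s 0 (u - y) := by
    rw [walk_eq_zero_sub p s (y - u) y, walk_eq_zero_sub p s (y - u) 0, sub_sub_cancel, zero_sub,
      neg_sub]
  rw [walkDiff, ← tsum_congr h]
  exact ((Equiv.subLeft y).tsum_eq fun x => walk p s x y - walk p s x 0).symm

/-- At late times, the probability that a site is occupied is small, uniformly in the initial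
configurations of bounded mean. -/
theorem eventually_exists_lonely_le (hd : 1 ≤ d) (hirr : IsIrreducible fun x => p x)
    (hrec : IsRecurrent (symmetrised p)) {β : ℝ≥0} (hβ : β ≠ 0) (o : Site d) {ε : ℝ≥0∞}
    (hε : ε ≠ 0) (hεtop : ε ≠ ∞) : ∃ Λ : Finset (Site d), ∀ᶠ t in atTop, ∃ ψ : Site d → ℝ≥0∞,
      ∑' x, ψ x ≤ 2 * ε ∧ ∀ ξ, act (lonely p β Λ t) (trunc 1 o) ξ ≤ ε + linear ψ ξ := by
  classical
  -- The linear function that dominates all intensities on `B` has total weight at most `4`: a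
  -- factor `2` from the Poisson comparison, and `1 + 1` for one transition probability and the
  -- total variation correction.
  set M : ℝ≥0∞ := 4 / ε with hMdef
  have hM : M ≠ ∞ := ENNReal.div_ne_top ENNReal.ofNat_ne_top hε
  have hM0 : M ≠ 0 := ENNReal.div_ne_zero.mpr ⟨by norm_num, hεtop⟩
  have hM4 : M⁻¹ * 4 = ε := by
    rw [hMdef, ENNReal.inv_div (Or.inl hεtop) (Or.inl hε)]
    exact ENNReal.div_mul_cancel (by norm_num) ENNReal.ofNat_ne_top
  obtain ⟨Λ₀, T, hT, hℓ⟩ := exists_topOcc_le p β 1 (M := M) hε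
  rw [limOcc_one_eq_zero p hd hirr hrec hβ hM] at hℓ
  set Λ := Λ₀.map (addRightEmbedding o)
  have hw := hℓ o Λ subset_rfl T le_rfl
  rw [zero_add, topOcc] at hw
  set w := act (lonely p β Λ T) (trunc 1 o) with hwdef
  have cw : Conc (fun x => walk p T x o) w := conc_lonely_trunc p β Λ 1 o hT
  have hw1 : ∀ ξ, w ξ ≤ 1 := fun ξ => by simpa using lonely_trunc_le p β Λ 1 o hT ξ
  -- Particles outside `B` at the intermediate time have little influence on `o` a time `T` later.
  obtain ⟨B, hBtail⟩ : ∃ B : Finset (Site d), ∑' y, (if y ∈ B then 0 else walk p T y o) ≤ ε := by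
    have hsum : ∑' y, walk p T y o ≠ ∞ := by rw [walk_col_sum p hT]; exact ENNReal.one_ne_top
    obtain ⟨B, hB⟩ := ((ENNReal.tendsto_tsum_compl_atTop_zero hsum).eventually_lt_const
      (pos_iff_ne_zero.mpr hε)).exists
    refine ⟨B, le_trans (le_of_eq ?_) hB.le⟩
    have h2 := tsum_subtype_eq_of_support_subset (f := fun y => if y ∈ B then 0 else walk p T y o)
      (s := {y | y ∉ B}) (fun z hz hzD => hz (if_pos hzD))
    rw [← h2]
    exact tsum_congr fun z => if_neg z.2
  refine ⟨Λ, ?_⟩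
  -- Makes the probability of hitting `B` at most `1/2`, as the Poisson comparison requires; the `+
  -- 1` covers empty `B`.
  have hsmall : ∀ᶠ s in atTop, ∀ x y, walk p s x y ≤ (2 * (B.card + 1 : ℝ≥0∞))⁻¹ :=
    eventually_walk_le p hd hirr (by simp [ENNReal.mul_eq_top])
  have hdiff : ∀ᶠ s in atTop, ∑ y ∈ B, walkDiff p s y ≤ 1 := by
    have : Tendsto (fun s => ∑ y ∈ B, walkDiff p s y) atTop (𝓝 (∑ y ∈ B, 0)) :=
      tendsto_finsetSum _ fun y _ => tendsto_walkDiff p hirr y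
    rw [Finset.sum_const_zero] at this
    exact (this.eventually_lt_const one_pos).mono fun s hs => hs.le
  have hev : ∀ᶠ s in atTop, ∃ ψ : Site d → ℝ≥0∞, ∑' x, ψ x ≤ 2 * ε ∧
      ∀ ξ, act (lonely p β Λ (s + T)) (trunc 1 o) ξ ≤ ε + linear ψ ξ := by
    filter_upwards [hsmall, hdiff, eventually_ge_atTop 0] with s h1 h2 hs
    have hB : ∀ x, ∑ y ∈ B, walk p s x y ≤ 2⁻¹ := by
      intro x
      calc ∑ y ∈ B, walk p s x y ≤ B.card • (2 * (B.card + 1 : ℝ≥0∞))⁻¹ :=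
            Finset.sum_le_card_nsmul _ _ _ fun y _ => h1 x y
        _ ≤ (B.card + 1 : ℝ≥0∞) * (2 * (B.card + 1 : ℝ≥0∞))⁻¹ := by
          rw [nsmul_eq_mul]
          exact mul_le_mul_left le_self_add _
        _ = 2⁻¹ := by
          rw [ENNReal.mul_inv (by simp) (by simp), mul_left_comm,
            ENNReal.mul_inv_cancel (by simp) (by simp), mul_one]
    set ψ₀ : Site d → ℝ≥0∞ := fun x => ∑' y, walk p s x y * if y ∈ B then 0 else walk p T y o
    -- One linear function dominates the intensities at all points of `B` at once. Since the walk
    -- merges, its weight does not grow with the size of `B`, which was chosen after `M`.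
    set ψ₁ : Site d → ℝ≥0∞ := fun x =>
      M⁻¹ * (2 * (walk p s x 0 + ∑ y ∈ B, (walk p s x y - walk p s x 0))) with hψ₁
    refine ⟨fun x => ψ₀ x + ψ₁ x, ?_, fun ξ => ?_⟩
    · rw [ENNReal.tsum_add, two_mul]
      refine add_le_add ?_ ?_
      · rw [ENNReal.tsum_comm]
        simp only [ENNReal.tsum_mul_right, walk_col_sum p hs, one_mul]
        exact hBtail
      · simp only [hψ₁, ENNReal.tsum_mul_left, ENNReal.tsum_add]
        rw [Summable.tsum_finsetSum fun _ _ => ENNReal.summable, walk_col_sum p hs]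
        simp only [tsum_walk_sub]
        calc M⁻¹ * (2 * (1 + ∑ y ∈ B, walkDiff p s y)) ≤ M⁻¹ * (2 * (1 + 1)) := by gcongr
          _ = M⁻¹ * 4 := by norm_num
          _ = ε := hM4
    · have hlin : linear (fun x => ψ₀ x + ψ₁ x) ξ = linear ψ₀ ξ + linear ψ₁ ξ := by
        simp only [linear, mul_add, ENNReal.tsum_add]
      rw [lonely_add p β Λ hT hs, act_mul, hlin, add_comm (linear ψ₀ ξ), ← add_assoc]
      refine (lonely_le_motion p β Λ cw ENNReal.one_ne_top hw1 s ξ).trans ?_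
      refine (Conc.act_motion_le_poi p hs B hB ξ cw).trans (add_le_add ?_ le_rfl)
      set ν : Site d → ℝ≥0∞ := fun y =>
        2 * linear (fun x => if y ∈ B then walk p s x y else 0) ξ with hν
      have hν0 : ∀ y ∉ B, ν y = 0 := fun y hy => by simp [hν, hy, linear]
      have hνtop : ∑' y, ν y ≠ ∞ := by
        rw [tsum_eq_sum (s := B) hν0]
        refine ENNReal.sum_ne_top.mpr fun y hy => ENNReal.mul_ne_top ENNReal.ofNat_ne_top ?_
        refine linear_ne_top (fun x => ?_) ξ
        rw [if_pos hy]
        exact walk_le_one p hs x y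
      -- Either the intensity is an admissible profile and the Poisson bound applies, or it exceeds
      -- `M` somewhere on `B` and the linear function `ψ₁` is at least one.
      by_cases hall : ∀ y, ν y ≤ M
      · exact ((IsProfile.le_topMean ⟨hall, hνtop⟩ w).trans hw).trans le_self_add
      · push Not at hall
        obtain ⟨y, hy⟩ := hall
        have hyB : y ∈ B := by
          by_contra hyB
          rw [hν0 y hyB] at hy
          exact absurd hy (not_lt.mpr zero_le)
        refine le_trans ?_ le_add_self
        calc act (poi ν) w 0 ≤ 1 := (act_mono _ hw1 0).trans (act_poi_const hνtop 1 0).le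
          _ = M⁻¹ * M := (ENNReal.inv_mul_cancel hM0 hM).symm
          _ ≤ M⁻¹ * ν y := mul_le_mul_right hy.le _
          _ ≤ linear ψ₁ ξ := by
            simp only [hν, if_pos hyB, linear, hψ₁]
            rw [← ENNReal.tsum_mul_left, ← ENNReal.tsum_mul_left]
            refine ENNReal.tsum_le_tsum fun x => ?_
            have h3 : walk p s x y ≤ walk p s x 0 + ∑ y ∈ B, (walk p s x y - walk p s x 0) := by
              refine le_add_tsub.trans (add_le_add le_rfl ?_)
              exact Finset.single_le_sum (f := fun y => walk p s x y - walk p s x 0)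
                (fun _ _ => zero_le) hyB
            calc _ = (ξ x : ℝ≥0∞) * (M⁻¹ * (2 * walk p s x y)) := by ring
              _ ≤ _ := by gcongr
  have := (tendsto_atTop_add_const_right atTop (-T) tendsto_id).eventually hev
  refine this.mono fun t ht => ?_
  simpa using ht

end

end SCBRW

namespace SCBRW

noncomputable section

open Ker

/-! ### The occupation probability -/

variable {d : ℕ} (p : PMF (Site d)) (b : ℕ → ℝ≥0)

theorem tsum_finDimProb_le (t : ℝ≥0) (o : Site d) (ξ : FinConfig d) :
    ∑' k : ℕ, finDimProb p b [⟨t, {o}, fun _ => k + 1⟩] ξ ≤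
      ∑' ζ, trans p b t ξ ζ * trunc 1 o ζ := by
  classical
  simp only [finDimProb, Finset.mem_singleton, forall_eq, mul_one]
  rw [ENNReal.tsum_comm]
  refine ENNReal.tsum_le_tsum fun ζ => ?_
  rcases Nat.eq_zero_or_pos (ζ o) with h | h
  · simp [h]
  · rw [tsum_eq_single (ζ o - 1) fun k hk => if_neg fun h' => hk (by omega)]
    have h1 : trunc 1 o ζ = 1 := by simp [trunc, Nat.min_eq_right h]
    rw [h1, mul_one]
    split_ifs <;> simp

theorem linear_restrict_le (ψ : Site d → ℝ≥0∞) (Λ : Finset (Site d)) (ξ : Config d) :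
    linear ψ (restrict Λ ξ) ≤ ∑' y, (ξ y : ℝ≥0∞) * ψ y := by
  classical
  refine ENNReal.tsum_le_tsum fun y => mul_le_mul_left ?_ _
  rw [restrict, Finsupp.indicator_apply]
  split_ifs <;> simp

variable {b} {p}

/-- The process is known only through limits of cylinder probabilities. Occupation is split into the
events of exactly `k + 1` particles; finite subsums pass to the limit `Λ ↑ ℤ^d`, and the bound is
uniform in `Λ`. -/
theorem IsSCBRW.occupied_le {Ω : Type*} [MeasurableSpace Ω] {P : Measure Ω}
    [IsProbabilityMeasure P] {η : ℝ≥0 → Ω → Config d} (hη : IsSCBRW p b P η) {t : ℝ≥0}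
    {o : Site d} {ε : ℝ≥0∞} {ψ : Site d → ℝ≥0∞}
    (h : ∀ ξ, ∑' ζ, trans p b t ξ ζ * trunc 1 o ζ ≤ ε + linear ψ ξ) :
    P {ω | η t ω o ≠ 0} ≤ ε + (∑' x, ψ x) * ⨆ x, ∫⁻ ω, (η 0 ω x : ℝ≥0∞) ∂P := by
  have hcyl (k : ℕ) : {ω | η t ω o = k + 1} =
      cylinderEvent η [⟨t, {o}, fun _ => k + 1⟩] 0 := by
    ext ω
    simp [cylinderEvent]
  have hsub : {ω | η t ω o ≠ 0} ⊆ ⋃ k : ℕ, {ω | η t ω o = k + 1} := by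
    intro ω hω
    obtain ⟨k, hk⟩ := Nat.exists_eq_succ_of_ne_zero hω
    exact Set.mem_iUnion.mpr ⟨k, hk⟩
  refine (measure_mono hsub).trans ((measure_iUnion_le _).trans ?_)
  refine ENNReal.summable.tsum_le_of_sum_le fun s => ?_
  simp only [hcyl]
  refine le_of_tendsto
    (tendsto_finsetSum s fun k _ => hη.tendsto_finDimProb [⟨t, {o}, fun _ => k + 1⟩])
    (Eventually.of_forall fun Λ => ?_)
  refine (ENNReal.sum_le_tsum s).trans ((tsum_lintegral_le _).trans ?_)
  have hmeas (y : Site d) : Measurable fun ω => (η 0 ω y : ℝ≥0∞) :=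
    measurable_from_top.comp ((measurable_pi_apply y).comp (hη.measurable 0))
  calc _ ≤ ∫⁻ ω, ε + ∑' y, (η 0 ω y : ℝ≥0∞) * ψ y ∂P := lintegral_mono fun ω =>
        (tsum_finDimProb_le p b t o _).trans ((h _).trans
          (add_le_add le_rfl (linear_restrict_le ψ Λ (η 0 ω))))
    _ = ε + ∑' y, ψ y * ∫⁻ ω, (η 0 ω y : ℝ≥0∞) ∂P := by
        rw [lintegral_add_left measurable_const, lintegral_const, measure_univ, mul_one,
          lintegral_tsum fun y => ((hmeas y).mul_const _).aemeasurable]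
        simp only [lintegral_mul_const _ (hmeas _), mul_comm (ψ _)]
    _ ≤ _ := by
        rw [← ENNReal.tsum_mul_right]
        refine add_le_add le_rfl (ENNReal.tsum_le_tsum fun y => mul_le_mul_right ?_ _)
        exact le_iSup (fun x => ∫⁻ ω, (η 0 ω x : ℝ≥0∞) ∂P) y

theorem IsSCBRW.tendsto_occupied {d : ℕ} (hd : 1 ≤ d) {p : PMF (Site d)}
    (hirr : IsIrreducible fun x => p x) (hrec : IsRecurrent (symmetrised p)) {b : ℕ → ℝ≥0}
    (hb : 0 < b 1) {Ω : Type*} [MeasurableSpace Ω] {P : Measure Ω} [IsProbabilityMeasure P]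
    {η : ℝ≥0 → Ω → Config d} (hη : IsSCBRW p b P η)
    (hbdd : (⨆ x, ∫⁻ ω, (η 0 ω x : ℝ≥0∞) ∂P) < ∞) (o : Site d) :
    Tendsto (fun t : ℝ≥0 => P {ω | η t ω o ≠ 0}) atTop (𝓝 0) := by
  set ρ := ⨆ x, ∫⁻ ω, (η 0 ω x : ℝ≥0∞) ∂P
  have hc0 : 1 + 2 * ρ ≠ 0 := by simp
  have hctop : 1 + 2 * ρ ≠ ∞ := by finiteness
  refine ENNReal.tendsto_nhds_zero.mpr fun δ hδ => ?_
  -- The total bound is `ε + 2 * ε * ρ`. The minimum with one keeps `ε` finite when `δ = ∞`.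
  set ε := min δ 1 / (1 + 2 * ρ)
  have hε : ε ≠ 0 := ENNReal.div_ne_zero.mpr ⟨(lt_min hδ one_pos).ne', hctop⟩
  have hεtop : ε ≠ ∞ :=
    ENNReal.div_ne_top (ne_top_of_le_ne_top ENNReal.one_ne_top (min_le_right _ _)) hc0
  obtain ⟨Λ, hΛ⟩ := eventually_exists_lonely_le p hd hirr hrec hb.ne' o hε hεtop
  filter_upwards [(NNReal.tendsto_coe_atTop.mpr tendsto_id).eventually hΛ] with t ⟨ψ, hψ, hle⟩
  have h := hη.occupied_le (t := t) (o := o) fun ξ =>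
    (trans_act_le p b Λ (conc_trunc 1 o) ENNReal.one_ne_top
      (fun ξ => by simpa using trunc_le 1 o ξ) t ξ).trans (hle ξ)
  calc P {ω | η t ω o ≠ 0} ≤ ε + 2 * ε * ρ := h.trans (by gcongr)
    _ = ε * (1 + 2 * ρ) := by ring
    _ = min δ 1 := ENNReal.div_mul_cancel hc0 hctop
    _ ≤ δ := min_le_left _ _

end

end SCBRW

theorem corollary1p5 {d : ℕ} (hd : 1 ≤ d)
    (p : PMF (SCBRW.Site d))
    (hirr : SCBRW.IsIrreducible (fun x => p x))
    (hrec : SCBRW.IsRecurrent (SCBRW.symmetrised p))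
    (b : ℕ → ℝ≥0) (hb : 0 < b 1)
    {Ω : Type*} [MeasurableSpace Ω] (P : Measure Ω) [IsProbabilityMeasure P]
    (η : ℝ≥0 → Ω → SCBRW.Config d) (hη : SCBRW.IsSCBRW p b P η)
    (hbdd : (⨆ x, ∫⁻ ω, (η 0 ω x : ℝ≥0∞) ∂P) < ∞) :
    ∀ x : SCBRW.Site d, Tendsto (fun t : ℝ≥0 => P {ω | η t ω x = 0}) atTop (𝓝 1) := by
  intro x
  have h := hη.tendsto_occupied hd hirr hrec hb hbdd x
  have hcompl (t : ℝ≥0) : P {ω | η t ω x = 0} = 1 - P {ω | η t ω x ≠ 0} := by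
    have hm : MeasurableSet {ω | η t ω x = 0} :=
      ((measurable_pi_apply x).comp (hη.measurable t)) (measurableSet_singleton 0)
    exact (congrArg P (compl_compl _).symm).trans (prob_compl_eq_one_sub hm.compl)
  simp only [hcompl]
  simpa using ENNReal.Tendsto.sub tendsto_const_nhds h (Or.inl ENNReal.one_ne_top)
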